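/- **Setting.** Let $\mathring u:\mathbb R\to\mathbb R$ be smooth, constant outside a compact interval, with $\mathring u(0)=0$, $\mathring u'(0)<0$, $\mathring u'(x)>\mathring u'(0)$ for all $x\neq0$, and $\mathring u'''(0)>0$. Put $t_0=1/\mathring u'(0)<0$ and $\beta_3=\tfrac16t_0^4\,\mathring u'''(0)>0$. For $t<0$ and $x\in\mathbb R$, let $\mathfrak u(t,x)$ be the unique real solution $y$ of $ty-\beta_3y^3=x$, and let $\mathfrak m=(|t|+3\beta_3\mathfrak u^2)^{-1}$. For $a\in\mathbb Z$ and $b\in\mathbb Z_{\ge0}$ let $\mathcal P(a,b)=\mathfrak u^a\mathfrak m^b\,\mathbb R[\mathfrak u^2\mathfrak m]$ if $a\ge0$, and $\mathcal P(a,b)=\mathcal P(a+2c,\,b+c)$ with $c=\lceil |a|/2\rceil$ if $a<0$. For $a,b\in\mathbb Z$ let $\mathfrak e(a,b)=|\mathfrak u|^a\mathfrak m^b$ if $a\ge0$ and $\mathfrak e(a,b)=\mathfrak m^{b+|a|/2}$ if $a<0$. A function $f$ on $(-\infty,0)\times\mathbb R$ is called $r$-homogeneous if $f(\lambda^2t,\lambda^3x)=\lambda^rf(t,x)$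 for all $\lambda\ne0$. Let $u^{\mathrm{out}}_k$, $k\ge0$, be the smooth solutions on $[t_0,0)\times\mathbb R$ of $$\partial_tu^{\mathrm{out}}_0=-u^{\mathrm{out}}_0\,\partial_xu^{\mathrm{out}}_0,\qquad u^{\mathrm{out}}_0(t_0,\cdot)=\mathring u,$$ $$\partial_tu^{\mathrm{out}}_k=-\partial_x\bigl(u^{\mathrm{out}}_0u^{\mathrm{out}}_k\bigr)-\sum_{k'=1}^{k-1}u^{\mathrm{out}}_{k'}\,\partial_xu^{\mathrm{out}}_{k-k'}+\partial_x^2u^{\mathrm{out}}_{k-1},\qquad u^{\mathrm{out}}_k(t_0,\cdot)=0\qquad(k\ge1).$$ **Proposition.** There are functions $u_{k,\ell}$ on $(-\infty,0)\times\mathbb R$, $k,\ell\in\mathbb Z_{\ge0}$, depending only on $\mathring u$, such that, with $u_{k,[\ell]}=\sum_{\ell'=0}^{\ell}u_{k,\ell'}$, the following hold. 1. $u_{0,0}=\mathfrak u$; each $u_{k,\ell}$ is smooth and $(-4k+\ell+1)$-homogeneous; with $u_{-1,\ell}=0$, $$\partial_tu_{k,\ell}=-\frac12\sum_{\substack{k'+k''=k\\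 \ell'+\ell''=\ell}}\partial_x\bigl(u_{k',\ell'}u_{k'',\ell''}\bigr)+\partial_x^2u_{k-1,\ell};$$ and $\partial_x^n u_{k,[\ell]}(t_0,0)=\partial_x^n u^{\mathrm{out}}_k(t_0,0)$ for all integers $0\le n\le-4k+\ell+3$. 2. $u_{k,\ell}\in\mathcal P(-4k+\ell+3,1)$ for all $(k,\ell)\neq(0,0)$. 3. For all $i,k,\ell\in\mathbb Z_{\ge0}$ there is a constant $C$, depending only on $i,k,\ell$ and $\mathring u$, such that $$\bigl|\partial_x^i\bigl(u^{\mathrm{out}}_k-u_{k,[\ell]}\bigr)\bigr|\le C\,\mathfrak e(-4k+\ell-i+4,\;i+1)\quad\text{on }[t_0,0)\times[-1,1].$$ -/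

import Mathlib

open scoped ContDiff

namespace BurgersOuter

/-- Initial data with a nondegenerate first shock, in the Galilean gauge in which the steepest
point and the value there are both `0`: smooth, constant outside a compact interval, with
negative slope minimized exactly at `0`, and with positive third derivative there. -/
structure IsShockData (u₀ : ℝ → ℝ) : Prop where
  smooth : ContDiff ℝ ∞ u₀
  const_outside : ∃ c L : ℝ, 0 < L ∧ ∀ x, x ∉ Set.Icc (-L) L → u₀ x = c
  slope_neg : deriv u₀ 0 < 0
  unique_min : ∀ x, x ≠ 0 → deriv u₀ 0 < deriv u₀ x
  nondegenerate : 0 < iteratedDeriv 3 u₀ 0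
  value_zero : u₀ 0 = 0

/-- The initial time `t₀ = (min u₀')⁻¹`; the minimum of `u₀'` is attained at `0`. -/
noncomputable def startTime (u₀ : ℝ → ℝ) : ℝ := (deriv u₀ 0)⁻¹

/-- The cubic coefficient `β₃ = t₀⁴ u₀'''(0) / 6`. -/
noncomputable def beta (u₀ : ℝ → ℝ) : ℝ := startTime u₀ ^ 4 * iteratedDeriv 3 u₀ 0 / 6

/-- For `t ≤ 0` and `β > 0` the cubic equation `t y - β y³ = x` has exactly one real solution. -/
theorem existsUnique_cubic {β t : ℝ} (hβ : 0 < β) (ht : t ≤ 0) (x : ℝ) :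
    ∃! y : ℝ, t * y - β * y ^ 3 = x := by
  have hanti : StrictAnti (fun y : ℝ => t * y - β * y ^ 3) := by
    intro a b hab
    have h3 : a ^ 3 < b ^ 3 := (Odd.strictMono_pow (by decide)) hab
    have h1 : t * b ≤ t * a := mul_le_mul_of_nonpos_left hab.le ht
    have h2 : β * a ^ 3 < β * b ^ 3 := mul_lt_mul_of_pos_left h3 hβ
    simp only
    linarith
  have hcont : Continuous (fun y : ℝ => t * y - β * y ^ 3) := by fun_prop
  set M : ℝ := |x| / β + 1 with hM
  have hq : 0 ≤ |x| / β := by positivity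
  have hM1 : 1 ≤ M := by linarith
  have hMx : |x| ≤ β * M := by
    have : β * (|x| / β) = |x| := by field_simp
    rw [hM, mul_add, this]
    linarith
  have hM3 : β * M ≤ β * M ^ 3 :=
    mul_le_mul_of_nonneg_left (by nlinarith [sq_nonneg M, sq_nonneg (M - 1)]) hβ.le
  have htM : t * M ≤ 0 := mul_nonpos_of_nonpos_of_nonneg ht (by linarith)
  have hx := abs_le.mp (le_refl |x|)
  obtain ⟨y, -, hy⟩ := intermediate_value_Icc' (show -M ≤ M by linarith) hcont.continuousOn
    (show x ∈ Set.Icc _ _ from ⟨by linarith [hx.1], by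
      have : (-M) ^ 3 = -M ^ 3 := by ring
      rw [this]
      linarith [hx.2]⟩)
  exact ⟨y, hy, fun z hz => hanti.injective (hz.trans hy.symm)⟩

/-- The inverse cubic profile `𝔲(t, x)`: the real solution `y` of `t y - β y³ = x`
(it is unique when `t ≤ 0` and `β > 0`). -/
noncomputable def cubicU (β t x : ℝ) : ℝ := Classical.epsilon fun y : ℝ => t * y - β * y ^ 3 = x

theorem cubicU_spec {β t : ℝ} (hβ : 0 < β) (ht : t ≤ 0) (x : ℝ) :
    t * cubicU β t x - β * cubicU β t x ^ 3 = x :=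
  Classical.epsilon_spec (existsUnique_cubic hβ ht x).exists

/-- The slope `𝔪 = (|t| + 3 β 𝔲²)⁻¹ = -∂ₓ𝔲`. -/
noncomputable def cubicM (β t x : ℝ) : ℝ := (|t| + 3 * β * cubicU β t x ^ 2)⁻¹

/-- The control function `𝔢(a, b)`: `|𝔲|ᵃ 𝔪ᵇ` if `a ≥ 0`, and `𝔪 ^ (b + |a| / 2)` if `a < 0`. -/
noncomputable def errE (β : ℝ) (a b : ℤ) (t x : ℝ) : ℝ :=
  if 0 ≤ a then |cubicU β t x| ^ a * cubicM β t x ^ b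
  else cubicM β t x ^ ((b : ℝ) + |(a : ℝ)| / 2)

/-- Membership of a function on `{t < 0} × ℝ` in `𝒫(a, b)`. For `a ≥ 0` this is
`𝔲ᵃ 𝔪ᵇ ℝ[𝔲² 𝔪]`. For `a < 0`, it is `𝒫(a + 2c, b + c)` with `c = ⌈|a| / 2⌉`
(the natural number `c` below is `0` when `a ≥ 0`). -/
def MemP (β : ℝ) (a : ℤ) (b : ℕ) (f : ℝ → ℝ → ℝ) : Prop :=
  let c : ℕ := ((-a).toNat + 1) / 2
  ∃ p : Polynomial ℝ, ∀ t < 0, ∀ x, f t x =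
    cubicU β t x ^ (a + 2 * c).toNat * cubicM β t x ^ (b + c) *
      p.eval (cubicU β t x ^ 2 * cubicM β t x)

/-- `r`-homogeneity on `{t < 0} × ℝ` under the scaling `(t, x) ↦ (μ² t, μ³ x)`. -/
def IsHomogeneous (r : ℤ) (f : ℝ → ℝ → ℝ) : Prop :=
  ∀ μ : ℝ, μ ≠ 0 → ∀ t < 0, ∀ x, f (μ ^ 2 * t) (μ ^ 3 * x) = μ ^ r * f t x

/-- The initial data of the outer terms at time `t₀`: `u₀` for `k = 0`, and `0` for `k ≥ 1`. -/
def outerInit (u₀ : ℝ → ℝ) : ℕ → ℝ → ℝ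
  | 0 => u₀
  | _ + 1 => fun _ => 0

/-- The terms `uo k` of the outer expansion on `[t₀, 0) × ℝ`: `uo 0` is the (smooth) solution of
the inviscid Burgers equation with data `u₀`, and for `k ≥ 1`
`∂ₜ u_k = -∂ₓ(u_0 u_k) - ∑_{0 < j < k} u_j ∂ₓ u_{k-j} + ∂ₓ² u_{k-1}` with zero data. -/
structure IsOuterExpansion (u₀ : ℝ → ℝ) (uo : ℕ → ℝ → ℝ → ℝ) : Prop where
  smooth : ∀ k, ContDiffOn ℝ ∞ (fun p : ℝ × ℝ => uo k p.1 p.2)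
    (Set.Ico (startTime u₀) 0 ×ˢ Set.univ)
  init : ∀ k x, uo k (startTime u₀) x = outerInit u₀ k x
  burgers : ∀ t ∈ Set.Ioo (startTime u₀) 0, ∀ x,
    deriv (fun s => uo 0 s x) t = -(uo 0 t x * deriv (uo 0 t) x)
  transport : ∀ k, ∀ t ∈ Set.Ioo (startTime u₀) 0, ∀ x,
    deriv (fun s => uo (k + 1) s x) t =
      -deriv (fun y => uo 0 t y * uo (k + 1) t y) x
        - ∑ j ∈ Finset.Icc 1 k, uo j t x * deriv (uo (k + 1 - j) t) x
        + iteratedDeriv 2 (uo k t) x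

/-- The partial sum `u_{k,[ℓ]} = ∑_{ℓ' ≤ ℓ} u_{k,ℓ'}`. -/
noncomputable def partialSum (u : ℕ → ℕ → ℝ → ℝ → ℝ) (k l : ℕ) (t x : ℝ) : ℝ :=
  ∑ j ∈ Finset.range (l + 1), u k j t x

/-- The quadratic part `-½ ∑_{k'+k''=k, ℓ'+ℓ''=ℓ} ∂ₓ(u_{k',ℓ'} u_{k'',ℓ''})` of the hierarchy. -/
noncomputable def advection (u : ℕ → ℕ → ℝ → ℝ → ℝ) (k l : ℕ) (t x : ℝ) : ℝ :=
  -(1 / 2) * ∑ a ∈ Finset.HasAntidiagonal.antidiagonal k, ∑ b ∈ Finset.HasAntidiagonal.antidiagonal l,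
    deriv (fun y => u a.1 b.1 t y * u a.2 b.2 t y) x

/-- The homogeneous components `u k ℓ = u_{k,ℓ}` on `{t < 0} × ℝ`: `u_{0,0} = 𝔲`; `u_{k,ℓ}` is
smooth and `(-4k+ℓ+1)`-homogeneous; the `u_{k,ℓ}` solve the hierarchy that results from inserting
the formal sums into the equations of the outer expansion; and at the initial time the partial
sums match the data of the `k`-th outer term at `x = 0` up to order `-4k+ℓ+3`
(no condition when this number is negative). -/
structure IsHomogeneousExpansion (u₀ : ℝ → ℝ) (u : ℕ → ℕ → ℝ → ℝ → ℝ) : Prop where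
  leading : ∀ t < 0, ∀ x, u 0 0 t x = cubicU (beta u₀) t x
  smooth : ∀ k l, ContDiffOn ℝ ∞ (fun p : ℝ × ℝ => u k l p.1 p.2) (Set.Iio 0 ×ˢ Set.univ)
  homogeneous : ∀ k l : ℕ, IsHomogeneous (-4 * k + l + 1) (u k l)
  inviscid : ∀ l, ∀ t < 0, ∀ x, deriv (fun s => u 0 l s x) t = advection u 0 l t x
  viscous : ∀ k l, ∀ t < 0, ∀ x, deriv (fun s => u (k + 1) l s x) t =
    advection u (k + 1) l t x + iteratedDeriv 2 (u k l t) x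
  matching : ∀ k l n : ℕ, (n : ℤ) ≤ -4 * k + l + 3 →
    iteratedDeriv n (partialSum u k l (startTime u₀)) 0 = iteratedDeriv n (outerInit u₀ k) 0

end BurgersOuter

/-! The outer equations are solved explicitly by characteristics. Let `Y (t, x)` be the starting
point of the characteristic through `(t, x)`, and put `U = u₀(Y)`, `N = ∂ₓY`, `Z = (t - t₀) N`.
Along the flow `Y` is constant, `N` solves the homogeneous linearized equation and `Z` has
derivative `N²`. Hence each transport equation is integrated by raising a power of `Z`: for `k ≥ 1`
the `k`-th outer term is `N` times a polynomial in `Z` with smooth functions of `Y` as coefficients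
(`exists_outer`). The quantity to follow is the order of vanishing of these coefficients at `0`: a
power of `Z` may grow like `𝔪` and is paid for by two orders. Uniqueness for linear transport
identifies every outer expansion with this one (`outer_unique`).

Near the shock `U` is compared with `𝔲`. Subtracting their implicit equations gives `(U - 𝔲)(-t +
β(U² + U𝔲 + 𝔲²)) = H(Y)` with `H(y) = y - t₀ u₀(y) + β u₀(y)³`, and `β` is the value for which `H`
vanishes to fourth order. The strict, nondegenerate minimum of the slope makes the Jacobian of the
flow comparable to `|t| + y²`, hence `|Y| ≲ |𝔲|` and `N ≲ 𝔪` (`IsLabel.comparable`). These bounds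
hold with all derivatives in the classes `Weight.Bd`, which are stable under products, derivatives,
compositions and suitable reciprocals.

The identities `U - 𝔲 = 𝔪 (H(Y) - β (U - 𝔲)² (U + 2𝔲))` and `Y = t₀ U + O(Y³)` gain one homogeneous
term per round (`IsLabel.expands`). So `Y`, `N`, `Z`, and with them all outer terms, have expansions
with components in `InP` and remainders in the right class.

The components have distinct degrees of homogeneity, so letting `(μ² t, μ³ x)` tend to the origin
determines them (`HasExp.unique`). Expanding both sides of the outer equations and comparing
components yields the hierarchy. The remainder bound is the third claim; it also gives the matching
at `(t₀, 0)`, where the control function vanishes because `𝔲` does. For this the label is defined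
slightly before `t₀`, which makes `t₀` an interior time. -/

namespace BurgersOuter

/-! ### Partial derivatives on the plane -/

/-- The unit vector in the direction of `x` (`true`) or of `t` (`false`). -/
def pdir (d : Bool) : ℝ × ℝ := if d then (0, 1) else (1, 0)

/-- The partial derivative `∂ₓ` (`true`) or `∂ₜ` (`false`). -/
noncomputable def pd (d : Bool) (f : ℝ × ℝ → ℝ) (p : ℝ × ℝ) : ℝ := fderiv ℝ f p (pdir d)

/-- The number of space derivatives in `pd d`. -/
def sh (d : Bool) : ℤ := if d then 1 else 0

section pd

variable {s : Set (ℝ × ℝ)} {f g : ℝ × ℝ → ℝ} {p : ℝ × ℝ} {d : Bool}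

theorem smooth_differentiableAt (hs : IsOpen s) (hf : ContDiffOn ℝ ∞ f s) (hp : p ∈ s) :
    DifferentiableAt ℝ f p :=
  (hf.contDiffAt (hs.mem_nhds hp)).differentiableAt (by simp)

theorem smooth_pd (hs : IsOpen s) (hf : ContDiffOn ℝ ∞ f s) (d : Bool) :
    ContDiffOn ℝ ∞ (pd d f) s :=
  (hf.fderiv_of_isOpen hs (m := ∞) (by simp)).clm_apply contDiffOn_const

theorem pd_congr (hs : IsOpen s) (h : Set.EqOn f g s) (d : Bool) : Set.EqOn (pd d f) (pd d g) s := by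
  intro p hp
  have : f =ᶠ[nhds p] g := Filter.eventuallyEq_of_mem (hs.mem_nhds hp) h
  simp only [pd, this.fderiv_eq]

theorem pd_add (hf : DifferentiableAt ℝ f p) (hg : DifferentiableAt ℝ g p) :
    pd d (fun q => f q + g q) p = pd d f p + pd d g p := by
  simp [pd, fderiv_fun_add hf hg]

theorem pd_mul (hf : DifferentiableAt ℝ f p) (hg : DifferentiableAt ℝ g p) :
    pd d (fun q => f q * g q) p = pd d f p * g p + f p * pd d g p := by
  simp [pd, fderiv_fun_mul hf hg]; ring

theorem pd_const (c : ℝ) : pd d (fun _ => c) p = 0 := by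
  simp [pd]

theorem pd_const_mul (c : ℝ) (hf : DifferentiableAt ℝ f p) :
    pd d (fun q => c * f q) p = c * pd d f p := by
  simp [pd, fderiv_const_mul hf]

theorem pd_comp {φ : ℝ → ℝ} (hφ : DifferentiableAt ℝ φ (f p)) (hf : DifferentiableAt ℝ f p) :
    pd d (fun q => φ (f q)) p = deriv φ (f p) * pd d f p := by
  have h := (hφ.hasDerivAt.comp_hasFDerivAt p hf.hasFDerivAt).fderiv
  have h' : fderiv ℝ (fun q => φ (f q)) p = deriv φ (f p) • fderiv ℝ f p := h
  simp [pd, h']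

theorem pd_inv (hf : DifferentiableAt ℝ f p) (h0 : f p ≠ 0) :
    pd d (fun q => (f q)⁻¹) p = -pd d f p * ((f p)⁻¹ * (f p)⁻¹) := by
  rw [pd_comp (φ := fun y => y⁻¹) (differentiableAt_inv h0) hf, deriv_inv]
  field_simp

theorem pd_pow (n : ℕ) (hf : DifferentiableAt ℝ f p) :
    pd d (fun q => f q ^ n) p = n * f p ^ (n - 1) * pd d f p := by
  rw [pd_comp (φ := fun y => y ^ n) (by fun_prop) hf]
  simp

theorem pd_sum {ι : Type*} (t : Finset ι) {F : ι → ℝ × ℝ → ℝ}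
    (hF : ∀ i ∈ t, DifferentiableAt ℝ (F i) p) :
    pd d (fun q => ∑ i ∈ t, F i q) p = ∑ i ∈ t, pd d (F i) p := by
  simp only [pd]
  rw [fderiv_fun_sum hF]
  simp

theorem pd_true_eq_deriv (hf : DifferentiableAt ℝ f p) :
    pd true f p = deriv (fun y => f (p.1, y)) p.2 := by
  have h1 : HasDerivAt (fun y : ℝ => (p.1, y)) ((0, 1) : ℝ × ℝ) p.2 :=
    (hasDerivAt_const _ _).prodMk (hasDerivAt_id _)
  have h2 := (hf.hasFDerivAt (x := (p.1, p.2))).comp_hasDerivAt p.2 h1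
  exact h2.deriv.symm

theorem pd_false_eq_deriv (hf : DifferentiableAt ℝ f p) :
    pd false f p = deriv (fun s => f (s, p.2)) p.1 := by
  have h1 : HasDerivAt (fun s : ℝ => (s, p.2)) ((1, 0) : ℝ × ℝ) p.1 :=
    (hasDerivAt_id _).prodMk (hasDerivAt_const _ _)
  have h2 := (hf.hasFDerivAt (x := (p.1, p.2))).comp_hasDerivAt p.1 h1
  exact h2.deriv.symm

theorem pd_fst : pd d (fun q => q.1) p = if d then 0 else 1 := by
  have : fderiv ℝ (fun q : ℝ × ℝ => q.1) p = ContinuousLinearMap.fst ℝ ℝ ℝ := fderiv_fst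
  cases d <;> simp [pd, this, pdir]

theorem pd_snd : pd d (fun q => q.2) p = if d then 1 else 0 := by
  have : fderiv ℝ (fun q : ℝ × ℝ => q.2) p = ContinuousLinearMap.snd ℝ ℝ ℝ := fderiv_snd
  cases d <;> simp [pd, this, pdir]

/-- Iterated space derivatives of a smooth function are iterated derivatives of its slices. -/
theorem iteratedDeriv_slice (hs : IsOpen s) (n : ℕ) (hf : ContDiffOn ℝ ∞ f s) {t x : ℝ}
    (hp : (t, x) ∈ s) : iteratedDeriv n (fun y => f (t, y)) x = (pd true)^[n] f (t, x) := by
  induction n generalizing f with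
  | zero => simp
  | succ n ih =>
    rw [iteratedDeriv_succ', Function.iterate_succ_apply, ← ih (smooth_pd hs hf true)]
    have hev : ∀ᶠ y in nhds x, (t, y) ∈ s :=
      (Continuous.prodMk_right t).continuousAt.eventually (hs.mem_nhds hp)
    apply Filter.EventuallyEq.iteratedDeriv_eq
    filter_upwards [hev] with y hy
    exact (pd_true_eq_deriv (smooth_differentiableAt hs hf hy)).symm

end pd

/-! ### Weighted symbol classes -/

/-- An open set of the plane with two weights `0 ≤ r ≤ 1 ≤ σ` on it. -/
structure Weight where
  dom : Set (ℝ × ℝ)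
  isOpen : IsOpen dom
  r : ℝ × ℝ → ℝ
  σ : ℝ × ℝ → ℝ
  r_nonneg : ∀ p ∈ dom, 0 ≤ r p
  r_le : ∀ p ∈ dom, r p ≤ 1
  one_le : ∀ p ∈ dom, 1 ≤ σ p

namespace Weight

variable (w : Weight)

/-- The control function of the symbol classes. -/
noncomputable def e (a b : ℤ) (p : ℝ × ℝ) : ℝ := w.r p ^ a.toNat * w.σ p ^ (2 * b - a)

/-- Smooth functions bounded by `w.e a b`. -/
def Bd0 (a b : ℤ) (f : ℝ × ℝ → ℝ) : Prop :=
  ContDiffOn ℝ ∞ f w.dom ∧ ∃ C, ∀ p ∈ w.dom, |f p| ≤ C * w.e a b p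

/-- Smooth functions of size `w.e a b`, each `x`-derivative costing `(-1, 1)` and each
`t`-derivative costing `(0, 1)` in the exponents, up to `K` derivatives. -/
def Bd : ℕ → ℤ → ℤ → (ℝ × ℝ → ℝ) → Prop
  | 0, a, b, f => w.Bd0 a b f
  | K + 1, a, b, f => w.Bd0 a b f ∧ ∀ d, Bd K (a - sh d) (b + 1) (pd d f)

variable {w} {a b a' b' : ℤ} {f g : ℝ × ℝ → ℝ} {K : ℕ} {p : ℝ × ℝ}

theorem e_nonneg (hp : p ∈ w.dom) : 0 ≤ w.e a b p :=
  mul_nonneg (pow_nonneg (w.r_nonneg p hp) _) (zpow_nonneg (by linarith [w.one_le p hp]) _)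

/-- Because `r ≤ 1 ≤ σ`, raising the power of `r` or lowering that of `σ` only decreases the
product. All later weakenings of exponents rest on this. -/
theorem e_le (h1 : a ≤ a') (h2 : 2 * b' - a' ≤ 2 * b - a) (hp : p ∈ w.dom) :
    w.e a' b' p ≤ w.e a b p := by
  have h := w.one_le p hp
  exact mul_le_mul (pow_le_pow_of_le_one (w.r_nonneg p hp) (w.r_le p hp) (by omega))
    (zpow_le_zpow_right₀ h h2) (zpow_nonneg (by linarith) _) (pow_nonneg (w.r_nonneg p hp) _)

/-- The powers of `σ` multiply exactly. Those of `r` do so only up to an inequality, as the positive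
part is subadditive and `r ≤ 1`. -/
theorem e_mul_le (hp : p ∈ w.dom) :
    w.e a b p * w.e a' b' p ≤ w.e (a + a') (b + b') p := by
  have h := w.one_le p hp
  have h0 : w.σ p ≠ 0 := by linarith
  have : w.e a b p * w.e a' b' p =
      w.r p ^ (a.toNat + a'.toNat) * w.σ p ^ (2 * (b + b') - (a + a')) := by
    simp only [e]
    rw [pow_add, show 2 * (b + b') - (a + a') = (2 * b - a) + (2 * b' - a') by ring, zpow_add₀ h0]
    ring
  rw [this]
  exact mul_le_mul_of_nonneg_right
    (pow_le_pow_of_le_one (w.r_nonneg p hp) (w.r_le p hp) (by omega)) (zpow_nonneg (by linarith) _)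

theorem Bd0.exists_nonneg (h : w.Bd0 a b f) : ∃ C, 0 ≤ C ∧ ∀ p ∈ w.dom, |f p| ≤ C * w.e a b p := by
  obtain ⟨-, C, hC⟩ := h
  exact ⟨|C|, abs_nonneg C, fun p hp => (hC p hp).trans
    (mul_le_mul_of_nonneg_right (le_abs_self C) (e_nonneg hp))⟩

theorem Bd.bd0 (h : w.Bd K a b f) : w.Bd0 a b f := by
  cases K with
  | zero => exact h
  | succ K => exact h.1

theorem Bd.smooth (h : w.Bd K a b f) : ContDiffOn ℝ ∞ f w.dom := h.bd0.1

theorem Bd.differentiableAt (h : w.Bd K a b f) (hp : p ∈ w.dom) : DifferentiableAt ℝ f p :=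
  smooth_differentiableAt w.isOpen h.smooth hp

theorem Bd0.congr (h : w.Bd0 a b f) (he : Set.EqOn f g w.dom) : w.Bd0 a b g := by
  obtain ⟨hs, C, hC⟩ := h
  exact ⟨hs.congr fun p hp => (he hp).symm, C, fun p hp => by rw [← he hp]; exact hC p hp⟩

theorem Bd.congr (h : w.Bd K a b f) (he : Set.EqOn f g w.dom) : w.Bd K a b g := by
  induction K generalizing a b f g with
  | zero => exact Bd0.congr h he
  | succ K ih => exact ⟨Bd0.congr h.1 he, fun d => ih (h.2 d) (pd_congr w.isOpen he d)⟩

theorem Bd0.weaken (h : w.Bd0 a' b' f) (h1 : a ≤ a') (h2 : 2 * b' - a' ≤ 2 * b - a) :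
    w.Bd0 a b f := by
  obtain ⟨C, h0, hC⟩ := h.exists_nonneg
  exact ⟨h.1, C, fun p hp => (hC p hp).trans (mul_le_mul_of_nonneg_left (e_le h1 h2 hp) h0)⟩

theorem Bd.weaken (h : w.Bd K a' b' f) (h1 : a ≤ a') (h2 : 2 * b' - a' ≤ 2 * b - a) :
    w.Bd K a b f := by
  induction K generalizing a b a' b' f with
  | zero => exact Bd0.weaken h h1 h2
  | succ K ih => exact ⟨Bd0.weaken h.1 h1 h2, fun d => ih (h.2 d) (by omega) (by omega)⟩

theorem Bd.of_succ (h : w.Bd (K + 1) a b f) : w.Bd K a b f := by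
  induction K generalizing a b f with
  | zero => exact h.1
  | succ K ih => exact ⟨h.1, fun d => ih (h.2 d)⟩

theorem Bd.pd (h : w.Bd (K + 1) a b f) (d : Bool) : w.Bd K (a - sh d) (b + 1) (pd d f) := h.2 d

theorem Bd0.add (hf : w.Bd0 a b f) (hg : w.Bd0 a b g) : w.Bd0 a b (fun p => f p + g p) := by
  obtain ⟨C, h0, hC⟩ := hf.exists_nonneg
  obtain ⟨C', h0', hC'⟩ := hg.exists_nonneg
  refine ⟨hf.1.add hg.1, C + C', fun p hp => ?_⟩
  have := abs_add_le (f p) (g p)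
  linarith [hC p hp, hC' p hp]

theorem Bd.add (hf : w.Bd K a b f) (hg : w.Bd K a b g) : w.Bd K a b (fun p => f p + g p) := by
  induction K generalizing a b f g with
  | zero => exact Bd0.add hf hg
  | succ K ih =>
    exact ⟨Bd0.add hf.1 hg.1, fun d => (ih (hf.2 d) (hg.2 d)).congr fun p hp =>
      (pd_add (hf.differentiableAt hp) (hg.differentiableAt hp)).symm⟩

theorem Bd0.mul (hf : w.Bd0 a b f) (hg : w.Bd0 a' b' g) :
    w.Bd0 (a + a') (b + b') (fun p => f p * g p) := by
  obtain ⟨C, h0, hC⟩ := hf.exists_nonneg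
  obtain ⟨C', h0', hC'⟩ := hg.exists_nonneg
  refine ⟨hf.1.mul hg.1, C * C', fun p hp => ?_⟩
  rw [abs_mul]
  calc |f p| * |g p| ≤ (C * w.e a b p) * (C' * w.e a' b' p) :=
        mul_le_mul (hC p hp) (hC' p hp) (abs_nonneg _) (mul_nonneg h0 (e_nonneg hp))
    _ = C * C' * (w.e a b p * w.e a' b' p) := by ring
    _ ≤ _ := mul_le_mul_of_nonneg_left (e_mul_le hp) (by positivity)

theorem Bd.mul (hf : w.Bd K a b f) (hg : w.Bd K a' b' g) :
    w.Bd K (a + a') (b + b') (fun p => f p * g p) := by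
  induction K generalizing a b a' b' f g with
  | zero => exact Bd0.mul hf hg
  | succ K ih =>
    refine ⟨Bd0.mul hf.1 hg.1, fun d => ?_⟩
    have h1 := ih (hf.2 d) hg.of_succ
    have h2 := ih hf.of_succ (hg.2 d)
    exact ((h1.weaken (a := a + a' - sh d) (b := b + b' + 1) (by omega) (by omega)).add
      (h2.weaken (by omega) (by omega))).congr fun p hp =>
      (pd_mul (hf.differentiableAt hp) (hg.differentiableAt hp)).symm

theorem Bd.zero : w.Bd K a b (fun _ => 0) := by
  have h0 : ∀ a b, w.Bd0 a b (fun _ => 0) := fun a b => ⟨contDiffOn_const, 0, by simp⟩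
  induction K generalizing a b with
  | zero => exact h0 a b
  | succ K ih => exact ⟨h0 a b, fun d => ih.congr fun p _ => (pd_const 0).symm⟩

theorem Bd.const (c : ℝ) : w.Bd K 0 0 (fun _ => c) := by
  have h0 : w.Bd0 0 0 (fun _ => c) := ⟨contDiffOn_const, |c|, by simp [e]⟩
  cases K with
  | zero => exact h0
  | succ K => exact ⟨h0, fun d => Bd.zero.congr fun p _ => (pd_const c).symm⟩

theorem Bd.const_mul (c : ℝ) (hf : w.Bd K a b f) : w.Bd K a b (fun p => c * f p) := by
  have := (Bd.const (w := w) (K := K) c).mul hf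
  simpa using this

theorem Bd.neg (hf : w.Bd K a b f) : w.Bd K a b (fun p => -f p) :=
  (hf.const_mul (-1)).congr fun p _ => by simp

theorem Bd.sub (hf : w.Bd K a b f) (hg : w.Bd K a b g) : w.Bd K a b (fun p => f p - g p) :=
  (hf.add hg.neg).congr fun p _ => by simp [sub_eq_add_neg]

theorem Bd.sum {ι : Type*} (s : Finset ι) {F : ι → ℝ × ℝ → ℝ} (h : ∀ i ∈ s, w.Bd K a b (F i)) :
    w.Bd K a b (fun p => ∑ i ∈ s, F i p) := by
  classical
  induction s using Finset.induction_on with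
  | empty => simpa using Bd.zero
  | insert i s hi ih =>
    simp only [Finset.sum_insert hi]
    exact (h i (by simp)).add (ih fun j hj => h j (by simp [hj]))

theorem Bd.pow (hf : w.Bd K a b f) (n : ℕ) : w.Bd K (n * a) (n * b) (fun p => f p ^ n) := by
  induction n with
  | zero => simpa using Bd.const (w := w) (K := K) 1
  | succ n ih =>
    have := ih.mul hf
    simp only [pow_succ]
    convert this using 1 <;> push_cast <;> ring

/-- Reciprocals of functions comparable to `w.e 0 (-1)`. -/
theorem Bd.inv {c : ℝ} (hc : 0 < c) (hf : w.Bd K 0 (-1) f)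
    (hlow : ∀ p ∈ w.dom, c * w.σ p ^ (-2 : ℤ) ≤ f p) : w.Bd K 0 1 (fun p => (f p)⁻¹) := by
  have hpos : ∀ p ∈ w.dom, 0 < f p := fun p hp =>
    (mul_pos hc (zpow_pos (by linarith [w.one_le p hp]) _)).trans_le (hlow p hp)
  have h0 : w.Bd0 0 1 (fun p => (f p)⁻¹) := by
    refine ⟨hf.smooth.inv fun p hp => (hpos p hp).ne', c⁻¹, fun p hp => ?_⟩
    have hσ : 0 < w.σ p := by linarith [w.one_le p hp]
    rw [abs_of_pos (inv_pos.2 (hpos p hp))]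
    calc (f p)⁻¹ ≤ (c * w.σ p ^ (-2 : ℤ))⁻¹ :=
          inv_anti₀ (mul_pos hc (zpow_pos hσ _)) (hlow p hp)
      _ = c⁻¹ * w.e 0 1 p := by simp [e, ← zpow_neg, mul_comm]
  induction K with
  | zero => exact h0
  | succ K ih =>
    -- The derivative of `1 / f` is `-f' / f²`, so `K + 1` derivatives of the reciprocal need only
    -- `K` derivatives of `f'` and of the reciprocal itself.
    have hi := ih hf.of_succ
    refine ⟨h0, fun d => ?_⟩
    have := ((hf.2 d).neg).mul (hi.mul hi)
    exact (this.weaken (by omega) (by omega)).congr fun p hp =>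
      (pd_inv (hf.differentiableAt hp) (hpos p hp).ne').symm

theorem Bd.iterate (n : ℕ) (h : ∀ K, w.Bd K a b f) : w.Bd0 (a - n) (b + n) ((BurgersOuter.pd true)^[n] f) := by
  suffices h' : ∀ K, w.Bd K (a - n) (b + n) ((BurgersOuter.pd true)^[n] f) from h' 0
  induction n with
  | zero => simpa using h
  | succ n ih =>
    intro K
    rw [Function.iterate_succ_apply']
    have := (ih (K + 1)).pd true
    simp only [sh] at this
    convert this using 1 <;> push_cast <;> ring

end Weight

/-! ### Smooth functions vanishing to a given order at the origin -/

/-- `g` is smooth and vanishes to order `n` at `0` (no condition if `n ≤ 0`). -/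
def Van (n : ℤ) (g : ℝ → ℝ) : Prop :=
  ContDiff ℝ ∞ g ∧ ∀ i : ℕ, (i : ℤ) < n → iteratedDeriv i g 0 = 0

namespace Van

variable {n m : ℤ} {g h : ℝ → ℝ}

theorem weaken (hg : Van m g) (hnm : n ≤ m) : Van n g := ⟨hg.1, fun i hi => hg.2 i (by omega)⟩

theorem differentiable (hg : Van n g) : Differentiable ℝ g := hg.1.differentiable (by simp)

theorem of_nonpos (hg : ContDiff ℝ ∞ g) (hn : n ≤ 0) : Van n g := ⟨hg, fun i hi => by omega⟩

theorem add (hg : Van n g) (hh : Van n h) : Van n (fun y => g y + h y) :=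
  ⟨hg.1.add hh.1, fun i hi => by
    rw [iteratedDeriv_fun_add (hg.1.of_le (by exact_mod_cast le_top)).contDiffAt
      (hh.1.of_le (by exact_mod_cast le_top)).contDiffAt, hg.2 i hi, hh.2 i hi, add_zero]⟩

theorem const_mul (c : ℝ) (hg : Van n g) : Van n (fun y => c * g y) :=
  ⟨contDiff_const.mul hg.1, fun i hi => by
    rw [iteratedDeriv_const_mul_field, hg.2 i hi, mul_zero]⟩

theorem deriv (hg : Van n g) : Van (n - 1) (deriv g) :=
  ⟨(contDiff_infty_iff_deriv.1 hg.1).2, fun i hi => by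
    rw [← iteratedDeriv_succ']; exact hg.2 _ (by push_cast; omega)⟩

/-- Induction on the order of the derivative, with one product rule per step: each summand loses one
order in one factor. At order zero, `n + m > 0` forces one of the two orders to be positive, and
that factor vanishes. -/
theorem mul (hg : Van n g) (hh : Van m h) : Van (n + m) (fun y => g y * h y) := by
  refine ⟨hg.1.mul hh.1, fun i hi => ?_⟩
  induction i generalizing n m g h with
  | zero =>
    rcases le_or_gt n 0 with hn | hn
    · have := hh.2 0 (by push_cast at hi ⊢; omega)
      simp_all
    · have := hg.2 0 (by simpa using hn)
      simp_all
  | succ i ih =>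
    have hd : _root_.deriv (fun y => g y * h y) =
        fun y => _root_.deriv g y * h y + g y * _root_.deriv h y := by
      funext y
      exact deriv_fun_mul (hg.differentiable y) (hh.differentiable y)
    have h1 := ih hg.deriv hh (by push_cast at hi; omega)
    have h2 := ih hg hh.deriv (by push_cast at hi; omega)
    have s1 : ContDiff ℝ i (fun y => _root_.deriv g y * h y) :=
      (hg.deriv.1.mul hh.1).of_le (by exact_mod_cast le_top)
    have s2 : ContDiff ℝ i (fun y => g y * _root_.deriv h y) :=
      (hg.1.mul hh.deriv.1).of_le (by exact_mod_cast le_top)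
    rw [iteratedDeriv_succ', hd, iteratedDeriv_fun_add s1.contDiffAt s2.contDiffAt, h1, h2, add_zero]

theorem pow_id (k : ℕ) : Van k (fun y : ℝ => y ^ k) := by
  induction k with
  | zero => exact of_nonpos (by fun_prop) (by simp)
  | succ k ih =>
    have h1 : Van 1 (fun y : ℝ => y) := ⟨contDiff_id, fun i hi => by
      have : i = 0 := by omega
      subst this; simp⟩
    simpa [pow_succ] using ih.mul h1

/-- Subtracting the leading Taylor monomial raises the order of vanishing. -/
theorem sub_leading {k : ℕ} (hg : Van k g) :
    Van (k + 1) (fun y => g y - iteratedDeriv k g 0 / k.factorial * y ^ k) := by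
  have hs : ∀ i : ℕ, ContDiffAt ℝ i (fun y => iteratedDeriv k g 0 / k.factorial * y ^ k) (0 : ℝ) :=
    fun i => by fun_prop
  refine ⟨hg.1.sub (by fun_prop), fun i hi => ?_⟩
  rw [iteratedDeriv_fun_sub (hg.1.of_le (by exact_mod_cast le_top)).contDiffAt (hs i),
    iteratedDeriv_const_mul_field]
  rcases lt_or_eq_of_le (show i ≤ k by omega) with h | rfl
  · rw [hg.2 i (by exact_mod_cast h), (pow_id k).2 i (by exact_mod_cast h)]; simp
  · have : iteratedDeriv i (fun y : ℝ => y ^ i) 0 = i.factorial := by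
      simp [Nat.descFactorial_self]
    rw [this]
    field_simp
    simp

/-- Taylor's bound without the formula: a bound `C |y|ᵏ` on the derivative and the mean value
inequality on the segment from `0` to `y` give `C |y|ᵏ⁺¹`. -/
theorem bound_pow {k : ℕ} (hg : Van k g) (B : ℝ) :
    ∃ C, 0 ≤ C ∧ ∀ y, |y| ≤ B → |g y| ≤ C * |y| ^ k := by
  induction k generalizing g with
  | zero =>
    obtain ⟨C, hC⟩ := (isCompact_Icc (a := -B) (b := B)).exists_bound_of_continuousOn
      hg.1.continuous.continuousOn
    refine ⟨|C|, abs_nonneg C, fun y hy => ?_⟩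
    have := hC y (abs_le.1 hy)
    rw [Real.norm_eq_abs] at this
    simpa using this.trans (le_abs_self C)
  | succ k ih =>
    have hd := hg.deriv
    push_cast at hd
    rw [add_sub_cancel_right] at hd
    obtain ⟨C, h0, hC⟩ := ih hd
    refine ⟨C, h0, fun y hy => ?_⟩
    have hb : ∀ z ∈ Set.uIcc 0 y, ‖_root_.deriv g z‖ ≤ C * |y| ^ k := by
      intro z hz
      have hz' : |z| ≤ |y| := by simpa using Set.abs_sub_left_of_mem_uIcc hz
      exact (hC z (hz'.trans hy)).trans
        (mul_le_mul_of_nonneg_left (pow_le_pow_left₀ (abs_nonneg z) hz' k) h0)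
    have := Convex.norm_image_sub_le_of_norm_deriv_le (fun z _ => hg.differentiable z) hb
      (convex_uIcc 0 y) Set.left_mem_uIcc Set.right_mem_uIcc
    have hg0 : g 0 = 0 := by simpa using hg.2 0 (by push_cast; omega)
    rw [hg0] at this
    simpa [pow_succ, mul_assoc] using this

end Van

namespace Weight

variable {w : Weight} {K : ℕ} {Y : ℝ × ℝ → ℝ}

/-- Composition with a smooth function vanishing to order `n`. -/
theorem Bd.comp (hY : w.Bd K 1 0 Y) {n : ℤ} {g : ℝ → ℝ} (hg : Van n g) :
    w.Bd K n 0 (fun p => g (Y p)) := by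
  have h0 : ∀ {n : ℤ} {g : ℝ → ℝ}, Van n g → w.Bd0 n 0 (fun p => g (Y p)) := by
    intro n g hg
    refine ⟨hg.1.comp_contDiffOn hY.smooth, ?_⟩
    obtain ⟨C, hC0, hC⟩ := hY.bd0.exists_nonneg
    have he : ∀ p ∈ w.dom, w.e 1 0 p = w.r p * (w.σ p)⁻¹ := fun p hp => by simp [e]
    have hYb : ∀ p ∈ w.dom, |Y p| ≤ C := fun p hp => by
      refine (hC p hp).trans ?_
      have h1 := w.one_le p hp
      have : w.r p * (w.σ p)⁻¹ ≤ 1 :=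
        mul_le_one₀ (w.r_le p hp) (by positivity) (inv_le_one_of_one_le₀ h1)
      rw [he p hp]
      nlinarith
    obtain ⟨C', hC0', hC'⟩ := Van.bound_pow (k := n.toNat) ⟨hg.1, fun i hi => hg.2 i (by omega)⟩ C
    refine ⟨C' * C ^ n.toNat, fun p hp => ?_⟩
    have h1 := w.one_le p hp
    have h2 : |Y p| ^ n.toNat ≤ (C * (w.r p * (w.σ p)⁻¹)) ^ n.toNat :=
      pow_le_pow_left₀ (abs_nonneg _) ((hC p hp).trans_eq (by rw [he p hp])) _
    -- An equality for `n ≥ 0`; for `n < 0` the left side is `1` and the right side a positive power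
    -- of `σ ≥ 1`.
    have h3 : (w.σ p)⁻¹ ^ n.toNat ≤ w.σ p ^ (2 * 0 - n) := by
      rw [← zpow_natCast, inv_zpow, ← zpow_neg]
      exact zpow_le_zpow_right₀ h1 (by omega)
    calc |g (Y p)| ≤ C' * |Y p| ^ n.toNat := hC' _ (hYb p hp)
      _ ≤ C' * (C * (w.r p * (w.σ p)⁻¹)) ^ n.toNat := mul_le_mul_of_nonneg_left h2 hC0'
      _ = C' * C ^ n.toNat * (w.r p ^ n.toNat * (w.σ p)⁻¹ ^ n.toNat) := by
        rw [mul_pow, mul_pow]; ring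
      _ ≤ C' * C ^ n.toNat * w.e n 0 p :=
        mul_le_mul_of_nonneg_left (mul_le_mul_of_nonneg_left h3
          (pow_nonneg (w.r_nonneg p hp) _)) (by positivity)
  induction K generalizing n g with
  | zero => exact h0 hg
  | succ K ih =>
    refine ⟨h0 hg, fun d => ?_⟩
    have := (ih hY.of_succ hg.deriv).mul (hY.2 d)
    exact (this.weaken (by omega) (by omega)).congr fun p hp =>
      (pd_comp hg.differentiable.differentiableAt (hY.differentiableAt hp)).symm

end Weight

/-! ### Implicitly defined labels -/

/-- Smoothness and derivatives of the solution `y = L (t, x)` of `h y + t k y = x`. -/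
theorem implicit_label {h k : ℝ → ℝ} (hh : ContDiff ℝ ∞ h) (hk : ContDiff ℝ ∞ k)
    {L : ℝ × ℝ → ℝ} {s : Set (ℝ × ℝ)} (hs : IsOpen s)
    (hL : ∀ p ∈ s, h (L p) + p.1 * k (L p) = p.2)
    (huniq : ∀ p ∈ s, ∀ y, h y + p.1 * k y = p.2 → y = L p)
    (hJ : ∀ p ∈ s, deriv h (L p) + p.1 * deriv k (L p) ≠ 0) :
    ContDiffOn ℝ ∞ L s ∧ ∀ p ∈ s,
      pd true L p = (deriv h (L p) + p.1 * deriv k (L p))⁻¹ ∧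
      pd false L p = -k (L p) * (deriv h (L p) + p.1 * deriv k (L p))⁻¹ := by
  have dh : Differentiable ℝ h := hh.differentiable (by simp)
  have dk : Differentiable ℝ k := hk.differentiable (by simp)
  have hsm : ContDiffOn ℝ ∞ L s := by
    intro p hp
    apply ContDiffAt.contDiffWithinAt
    set F : (ℝ × ℝ) × ℝ → ℝ := fun z => h z.2 + z.1.1 * k z.2 - z.1.2 with hF
    have cF : ContDiffAt ℝ ∞ F (p, L p) := by
      apply ContDiff.contDiffAt
      have := hh.comp (contDiff_snd (E := ℝ × ℝ) (F := ℝ) (𝕜 := ℝ) (n := ∞))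
      have := hk.comp (contDiff_snd (E := ℝ × ℝ) (F := ℝ) (𝕜 := ℝ) (n := ∞))
      fun_prop
    have hd : HasDerivAt (fun y => F (p, y)) (deriv h (L p) + p.1 * deriv k (L p)) (L p) :=
      ((dh _).hasDerivAt.add ((dk _).hasDerivAt.const_mul p.1)).sub_const p.2
    have hd' : HasDerivAt (fun y => F (p, y)) (fderiv ℝ F (p, L p) (0, 1)) (L p) := by
      have h1 : HasDerivAt (fun y : ℝ => (p, y)) (((0 : ℝ × ℝ), (1 : ℝ))) (L p) :=
        (hasDerivAt_const _ _).prodMk (hasDerivAt_id _)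
      exact ((cF.differentiableAt (by simp)).hasFDerivAt).comp_hasDerivAt (L p) h1
    have hval := hd'.unique hd
    have hinv : (fderiv ℝ F (p, L p) ∘L .inr ℝ (ℝ × ℝ) ℝ).IsInvertible := by
      refine ⟨ContinuousLinearEquiv.unitsEquivAut ℝ (Units.mk0 _ (hJ p hp)), ?_⟩
      ext
      simp [hval]
    have hev := cF.eventually_apply_implicitFunction (by simp) hinv
    have hc := cF.contDiffAt_implicitFunction (by simp) hinv
    -- The local implicit function solves the equation near `p`, and `huniq` identifies it with `L`,
    -- so no continuity of `L` is needed beforehand.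
    refine hc.congr_of_eventuallyEq ?_
    filter_upwards [hev, hs.mem_nhds hp] with q hq hqs
    refine (huniq q hqs _ ?_).symm
    have h0 : F (p, L p) = 0 := by simp [hF, hL p hp]
    rw [h0] at hq
    simp only [hF] at hq
    linarith
  refine ⟨hsm, fun p hp => ?_⟩
  have dL := smooth_differentiableAt hs hsm hp
  -- Both partial derivatives come from differentiating the defining identity.
  have key : ∀ d, pd d (fun q => h (L q) + q.1 * k (L q)) p = pd d (fun q => q.2) p :=
    fun d => pd_congr hs (fun q hq => hL q hq) d hp
  have dhL : DifferentiableAt ℝ (fun q => h (L q)) p := (dh _).comp p dL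
  have dkL : DifferentiableAt ℝ (fun q => k (L q)) p := (dk _).comp p dL
  have key' : ∀ d, deriv h (L p) * pd d L p + (pd d (fun q => q.1) p * k (L p) +
      p.1 * (deriv k (L p) * pd d L p)) = pd d (fun q => q.2) p := by
    intro d
    rw [← key d, pd_add (g := fun q => q.1 * k (L q)) dhL (differentiableAt_fst.mul dkL), pd_mul differentiableAt_fst dkL,
      pd_comp (dh _) dL, pd_comp (dk _) dL]
  have h1 := key' true
  have h2 := key' false
  simp only [pd_fst, pd_snd] at h1 h2
  have hJp := hJ p hp
  constructor
  · refine eq_inv_of_mul_eq_one_left ?_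
    simp at h1; linarith
  · rw [eq_mul_inv_iff_mul_eq₀ hJp]
    simp at h2; linarith

/-! ### The cubic profile -/

/-- The profile `𝔲` as a function on the plane. -/
noncomputable def cu (β : ℝ) (p : ℝ × ℝ) : ℝ := cubicU β p.1 p.2

/-- The slope `𝔪` as a function on the plane. -/
noncomputable def cm (β : ℝ) (p : ℝ × ℝ) : ℝ := cubicM β p.1 p.2

/-- The open left half plane `t < 0`. -/
def past : Set (ℝ × ℝ) := {p | p.1 < 0}

theorem isOpen_past : IsOpen past := isOpen_lt continuous_fst continuous_const

section cubic

variable {β : ℝ} {p : ℝ × ℝ}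

theorem cu_spec (hβ : 0 < β) (hp : p ∈ past) : p.1 * cu β p - β * cu β p ^ 3 = p.2 :=
  cubicU_spec hβ (le_of_lt hp) p.2

theorem cu_unique (hβ : 0 < β) (hp : p ∈ past) {y : ℝ} (hy : p.1 * y - β * y ^ 3 = p.2) :
    y = cu β p :=
  (existsUnique_cubic hβ (le_of_lt hp) p.2).unique hy (cu_spec hβ hp)

theorem cm_eq (hp : p ∈ past) : cm β p = (-p.1 + 3 * β * cu β p ^ 2)⁻¹ := by
  simp only [cm, cubicM, cu, abs_of_neg (show p.1 < 0 from hp)]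

theorem cm_denom_pos (hβ : 0 < β) (hp : p ∈ past) : 0 < -p.1 + 3 * β * cu β p ^ 2 := by
  have : p.1 < 0 := hp
  nlinarith [mul_nonneg hβ.le (sq_nonneg (cu β p))]

theorem cm_pos (hβ : 0 < β) (hp : p ∈ past) : 0 < cm β p := by
  rw [cm_eq hp]; exact inv_pos.2 (cm_denom_pos hβ hp)

theorem cm_mul (hβ : 0 < β) (hp : p ∈ past) : cm β p * (-p.1 + 3 * β * cu β p ^ 2) = 1 := by
  rw [cm_eq hp]; exact inv_mul_cancel₀ (cm_denom_pos hβ hp).ne'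

/-- The implicit label with `h y = -β y³` and `k y = y`. In particular `𝔲` solves the inviscid
Burgers equation. -/
theorem cu_label (hβ : 0 < β) : ContDiffOn ℝ ∞ (cu β) past ∧ ∀ p ∈ past,
    pd true (cu β) p = -cm β p ∧ pd false (cu β) p = cu β p * cm β p := by
  have hd1 : ∀ y : ℝ, deriv (fun y : ℝ => -(β * y ^ 3)) y = -(3 * β * y ^ 2) := fun y => by
    simp; ring
  have hd2 : ∀ y : ℝ, deriv (fun y : ℝ => y) y = 1 := fun y => deriv_id y
  have hJ : ∀ p : ℝ × ℝ, -(3 * β * cu β p ^ 2) + p.1 * 1 = -(-p.1 + 3 * β * cu β p ^ 2) := fun p => by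
    ring
  obtain ⟨h1, h2⟩ := implicit_label (h := fun y => -(β * y ^ 3)) (k := fun y => y) (L := cu β)
    (by fun_prop) (by fun_prop) isOpen_past
    (fun p hp => by linarith [cu_spec hβ hp])
    (fun p hp y hy => cu_unique hβ hp (by linarith))
    (fun p hp => by
      rw [hd1, hd2, hJ]
      exact neg_ne_zero.2 (cm_denom_pos hβ hp).ne')
  refine ⟨h1, fun p hp => ?_⟩
  have := h2 p hp
  rw [hd1, hd2, hJ, inv_neg, ← cm_eq hp] at this
  exact ⟨this.1, by rw [this.2]; ring⟩

theorem cu_smooth (hβ : 0 < β) : ContDiffOn ℝ ∞ (cu β) past := (cu_label hβ).1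

theorem cm_smooth (hβ : 0 < β) : ContDiffOn ℝ ∞ (cm β) past := by
  have h : ContDiffOn ℝ ∞ (fun p : ℝ × ℝ => -p.1 + 3 * β * cu β p ^ 2) past := by
    have := cu_smooth hβ
    fun_prop
  exact (h.inv fun p hp => (cm_denom_pos hβ hp).ne').congr fun p hp => cm_eq hp

theorem cu_diff (hβ : 0 < β) (hp : p ∈ past) : DifferentiableAt ℝ (cu β) p :=
  smooth_differentiableAt isOpen_past (cu_smooth hβ) hp

theorem cm_diff (hβ : 0 < β) (hp : p ∈ past) : DifferentiableAt ℝ (cm β) p :=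
  smooth_differentiableAt isOpen_past (cm_smooth hβ) hp

theorem pd_cm (hβ : 0 < β) (hp : p ∈ past) (d : Bool) :
    pd d (cm β) p = -(-pd d (fun q => q.1) p + 6 * β * cu β p * pd d (cu β) p) * cm β p ^ 2 := by
  have hc := cu_diff hβ hp
  have e1 : pd d (cm β) p = pd d (fun q => ((-1) * q.1 + 3 * β * cu β q ^ 2)⁻¹) p :=
    pd_congr isOpen_past (fun q hq => by rw [cm_eq hq]; ring_nf) d hp
  have hpos := cm_denom_pos hβ hp
  rw [e1, pd_inv (by fun_prop) (by simpa using hpos.ne'), pd_add (by fun_prop) (by fun_prop),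
    pd_const_mul _ (by fun_prop), pd_const_mul _ (by fun_prop), pd_pow _ hc, cm_eq hp]
  push_cast
  ring_nf

theorem scale_mem {μ : ℝ} (hμ : μ ≠ 0) (hp : p ∈ past) : (μ ^ 2 * p.1, μ ^ 3 * p.2) ∈ past := by
  have h : p.1 < 0 := hp
  have : 0 < μ ^ 2 := by positivity
  exact mul_neg_of_pos_of_neg this h

theorem cu_scale (hβ : 0 < β) {μ : ℝ} (hμ : μ ≠ 0) (hp : p ∈ past) :
    cu β (μ ^ 2 * p.1, μ ^ 3 * p.2) = μ * cu β p := by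
  refine (cu_unique hβ (scale_mem hμ hp) ?_).symm
  have := cu_spec hβ hp
  simp only
  rw [← this]; ring

theorem cm_scale (hβ : 0 < β) {μ : ℝ} (hμ : μ ≠ 0) (hp : p ∈ past) :
    cm β (μ ^ 2 * p.1, μ ^ 3 * p.2) = (μ ^ 2)⁻¹ * cm β p := by
  rw [cm_eq (scale_mem hμ hp), cu_scale hβ hμ hp, cm_eq hp, ← mul_inv]
  ring_nf

end cubic

/-! ### The spaces `𝒫(a, b)` -/

/-- The functions that agree for `t < 0` with a linear combination of monomials `𝔲ⁱ 𝔪ʲ` with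
`i - 2 j = a - 2 b` and `j ≥ b`. -/
inductive InP (β : ℝ) (a b : ℤ) : (ℝ × ℝ → ℝ) → Prop
  | zero : InP β a b fun _ => 0
  | mono (c : ℝ) (i j : ℕ) (h : (i : ℤ) - 2 * j = a - 2 * b) (hb : b ≤ j) :
      InP β a b fun p => c * (cu β p ^ i * cm β p ^ j)
  | add {f g : ℝ × ℝ → ℝ} (hf : InP β a b f) (hg : InP β a b g) : InP β a b fun p => f p + g p
  | congr {f g : ℝ × ℝ → ℝ} (hf : InP β a b f) (h : ∀ p ∈ past, f p = g p) : InP β a b g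

namespace InP

variable {β : ℝ} {a b a' b' : ℤ} {f g : ℝ × ℝ → ℝ}

theorem smooth (hβ : 0 < β) (hf : InP β a b f) : ContDiffOn ℝ ∞ f past := by
  induction hf with
  | zero => exact contDiffOn_const
  | mono c i j h hb => exact contDiffOn_const.mul (((cu_smooth hβ).pow i).mul ((cm_smooth hβ).pow j))
  | add hf hg ihf ihg => exact ihf.add ihg
  | congr hf h ih => exact ih.congr fun p hp => (h p hp).symm

theorem differentiableAt (hβ : 0 < β) (hf : InP β a b f) {p : ℝ × ℝ} (hp : p ∈ past) :
    DifferentiableAt ℝ f p :=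
  smooth_differentiableAt isOpen_past (hf.smooth hβ) hp

theorem scale (hβ : 0 < β) (hf : InP β a b f) {μ : ℝ} (hμ : μ ≠ 0) {p : ℝ × ℝ} (hp : p ∈ past) :
    f (μ ^ 2 * p.1, μ ^ 3 * p.2) = μ ^ (a - 2 * b) * f p := by
  induction hf with
  | zero => simp
  | mono c i j h hb =>
    simp only
    rw [cu_scale hβ hμ hp, cm_scale hβ hμ hp, ← h, zpow_sub₀ hμ, mul_pow, mul_pow, zpow_mul]
    norm_cast
    rw [inv_pow]
    field_simp
  | add hf hg ihf ihg => simp only [ihf, ihg]; ring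
  | congr hf h ih => rw [← h p hp, ← h _ (scale_mem hμ hp), ih]

theorem const_mul (c : ℝ) (hf : InP β a b f) : InP β a b fun p => c * f p := by
  induction hf with
  | zero => simpa using InP.zero
  | mono c' i j h hb => exact (mono (c * c') i j h hb).congr fun p _ => by ring
  | add hf hg ihf ihg => exact (ihf.add ihg).congr fun p _ => by ring
  | congr hf h ih => exact ih.congr fun p hp => by rw [h p hp]

theorem sum {ι : Type*} (s : Finset ι) {F : ι → ℝ × ℝ → ℝ} (h : ∀ i ∈ s, InP β a b (F i)) :
    InP β a b fun p => ∑ i ∈ s, F i p := by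
  classical
  induction s using Finset.induction_on with
  | empty => simpa using InP.zero
  | insert i s hi ih =>
    simp only [Finset.sum_insert hi]
    exact (h i (by simp)).add (ih fun j hj => h j (by simp [hj]))

theorem weaken (hf : InP β a' b' f) (h1 : a - 2 * b = a' - 2 * b') (h2 : b ≤ b') :
    InP β a b f := by
  induction hf with
  | zero => exact .zero
  | mono c i j h hb => exact mono c i j (by omega) (by omega)
  | add hf hg ihf ihg => exact ihf.add ihg
  | congr hf h ih => exact ih.congr h

theorem mul (hf : InP β a b f) (hg : InP β a' b' g) :
    InP β (a + a') (b + b') fun p => f p * g p := by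
  induction hf with
  | zero => simpa using InP.zero
  | mono c i j h hb =>
    induction hg with
    | zero => simpa using InP.zero
    | mono c' i' j' h' hb' =>
      exact (mono (c * c') (i + i') (j + j') (by push_cast; omega) (by push_cast; omega)).congr
        fun p _ => by ring
    | add hf hg ihf ihg => exact (ihf.add ihg).congr fun p _ => by ring
    | congr hf h ih => exact ih.congr fun p hp => by rw [h p hp]
  | add hf hg ihf ihg => exact (ihf.add ihg).congr fun p _ => by ring
  | congr hf h ih => exact ih.congr fun p hp => by rw [h p hp]

/-- Monomials go to monomials, by `∂ₓ𝔲 = -𝔪`, `∂ₜ𝔲 = 𝔲𝔪`, `∂ₓ𝔪 = 6β𝔲𝔪³` and `∂ₜ𝔪 = 𝔪² - 6β𝔲²𝔪³`.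
Each of them gains at least one power of `𝔪`. -/
theorem pd (hβ : 0 < β) (hf : InP β a b f) (d : Bool) : InP β (a - sh d) (b + 1) (pd d f) := by
  induction hf with
  | zero => exact InP.zero.congr fun p _ => (pd_const 0).symm
  | mono c i j h hb =>
    have key : ∀ p ∈ past, BurgersOuter.pd d (fun p => c * (cu β p ^ i * cm β p ^ j)) p =
        c * (i * cu β p ^ (i - 1) * BurgersOuter.pd d (cu β) p * cm β p ^ j + cu β p ^ i *
          (j * cm β p ^ (j - 1) * BurgersOuter.pd d (cm β) p)) := fun p hp => by
      have h1 := cu_diff hβ hp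
      have h2 := cm_diff hβ hp
      rw [pd_const_mul _ (by fun_prop), pd_mul (by fun_prop) (by fun_prop), pd_pow _ h1, pd_pow _ h2]
    -- The factor `j` makes the truncated exponent `j - 1` harmless when `j = 0`.
    have hj : ∀ (y : ℝ) (k : ℕ), (j : ℝ) * y ^ (j - 1) * y ^ (k + 1) = j * y ^ (j + k) := by
      intro y k
      rcases j with _ | j
      · simp
      · rw [Nat.add_sub_cancel]; ring
    cases d with
    | true =>
      have h2 : InP β (a - sh true) (b + 1)
          (fun p => 6 * β * c * j * (cu β p ^ (i + 1) * cm β p ^ (j + 2))) :=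
        mono _ _ _ (by simp [sh]; omega) (by push_cast; omega)
      have h1 : InP β (a - sh true) (b + 1)
          (fun p => -(c * i) * (cu β p ^ (i - 1) * cm β p ^ (j + 1))) := by
        rcases i with _ | i
        · simpa using InP.zero
        · exact mono _ _ _ (by simp [sh] at h ⊢; omega) (by push_cast; omega)
      refine (h1.add h2).congr fun p hp => ?_
      rw [key p hp, pd_cm hβ hp, ((cu_label hβ).2 p hp).1, pd_fst]
      have := hj (cm β p) 2
      simp only [if_true]
      linear_combination (-6 * β * c * cu β p ^ (i + 1)) * this
    | false =>
      have h1 : InP β (a - sh false) (b + 1)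
          (fun p => c * (i + j) * (cu β p ^ i * cm β p ^ (j + 1))) :=
        mono _ _ _ (by simp [sh]; omega) (by push_cast; omega)
      have h2 : InP β (a - sh false) (b + 1)
          (fun p => -(6 * β * c * j) * (cu β p ^ (i + 2) * cm β p ^ (j + 2))) :=
        mono _ _ _ (by simp [sh]; omega) (by push_cast; omega)
      refine (h1.add h2).congr fun p hp => ?_
      rw [key p hp, pd_cm hβ hp, ((cu_label hβ).2 p hp).2, pd_fst]
      have e1 := hj (cm β p) 2
      have e2 := hj (cm β p) 1
      have e3 : (i : ℝ) * cu β p ^ (i - 1) * cu β p = i * cu β p ^ i := by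
        rcases i with _ | i
        · simp
        · rw [Nat.add_sub_cancel]; ring
      simp only [Bool.false_eq_true, if_false]
      linear_combination (6 * β * c * cu β p ^ (i + 2)) * e1 - c * cu β p ^ i * e2
        - c * cm β p ^ (j + 1) * e3
  | add hf hg ihf ihg =>
    exact (ihf.add ihg).congr fun p hp =>
      (pd_add (hf.differentiableAt hβ hp) (hg.differentiableAt hβ hp)).symm
  | congr hf h ih => exact ih.congr fun p hp => pd_congr isOpen_past h d hp

/-- Multiplication by `t` lowers the exponent of `𝔪`. -/
theorem time_mul (hβ : 0 < β) (hf : InP β a b f) (hb : 1 ≤ b) :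
    InP β a (b - 1) fun p => p.1 * f p := by
  induction hf with
  | zero => simpa using InP.zero
  | mono c i j h hbj =>
    obtain ⟨j, rfl⟩ : ∃ j', j = j' + 1 := ⟨j - 1, by omega⟩
    -- From `t = 3β𝔲² - 1/𝔪` one gets `t 𝔲ⁱ𝔪ʲ⁺¹ = -𝔲ⁱ𝔪ʲ + 3β𝔲ⁱ⁺²𝔪ʲ⁺¹`.
    refine ((mono (-c) i j (by push_cast at h; omega) (by push_cast at hbj; omega)).add
      (mono (3 * β * c) (i + 2) (j + 1) (by push_cast at h ⊢; omega)
        (by push_cast at hbj ⊢; omega))).congr fun p hp => ?_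
    have := cm_mul hβ hp
    linear_combination (c * cu β p ^ i * cm β p ^ j) * this
  | add hf hg ihf ihg => exact (ihf.add ihg).congr fun p _ => by ring
  | congr hf h ih => exact ih.congr fun p hp => by rw [h p hp]

/-- In a monomial of the given degree, `i ≥ 0` and `j ≥ b` force `j ≥ b + c`. With `k = j - b - c`
it equals `𝔲^(a+2c) 𝔪^(b+c) (𝔲²𝔪)ᵏ`. -/
theorem memP {b : ℕ} (hf : InP β a b f) : MemP β a b (fun t x => f (t, x)) := by
  simp only [MemP]
  set c : ℕ := ((-a).toNat + 1) / 2 with hc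
  induction hf with
  | zero => exact ⟨0, by simp⟩
  | mono c' i j h hb =>
    refine ⟨.C c' * .X ^ (j - b - c), fun t ht x => ?_⟩
    obtain ⟨k, rfl⟩ : ∃ k, j = b + c + k := ⟨j - b - c, by omega⟩
    have hi : i = (a + 2 * c).toNat + 2 * k := by push_cast at h; omega
    simp only [Polynomial.eval_mul, Polynomial.eval_C, Polynomial.eval_pow, Polynomial.eval_X, hi, cu,
      cm, show b + c + k - b - c = k by omega]
    ring
  | add hf hg ihf ihg =>
    obtain ⟨p, hp⟩ := ihf
    obtain ⟨q, hq⟩ := ihg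
    exact ⟨p + q, fun t ht x => by simp only [hp t ht, hq t ht, Polynomial.eval_add]; ring⟩
  | congr hf h ih =>
    obtain ⟨p, hp⟩ := ih
    exact ⟨p, fun t ht x => by rw [← hp t ht]; exact (h (t, x) ht).symm⟩

end InP

/-! ### Expansions in homogeneous components -/

/-- A weight on a subset of `t < 0` for which `𝔲` and `𝔪` have their natural sizes. -/
structure IsCubicWeight (β : ℝ) (w : Weight) : Prop where
  pos : 0 < β
  sub : w.dom ⊆ past
  bd_cu : ∀ K, w.Bd K 1 0 (cu β)
  bd_cm : ∀ K, w.Bd K 0 1 (cm β)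
  bd_time : ∀ K, w.Bd K 0 (-1) fun p => p.1
  mem_of_small : ∀ p ∈ past, ∃ ε > 0, ∀ μ : ℝ, 0 < μ → μ < ε → (μ ^ 2 * p.1, μ ^ 3 * p.2) ∈ w.dom
  σ_scale : ∀ p ∈ past, ∀ μ : ℝ, 0 < μ → w.σ (μ ^ 2 * p.1, μ ^ 3 * p.2) = μ⁻¹ * w.σ p
  σ_pos : ∀ p ∈ past, 0 < w.σ p
  σ_sq : ∃ κ > 0, ∀ p ∈ past, κ * w.σ p ^ (-2 : ℤ) = -p.1 + 3 * β * cu β p ^ 2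

theorem InP.bd {β : ℝ} {w : Weight} (hw : IsCubicWeight β w) {a b : ℤ} {f : ℝ × ℝ → ℝ}
    (hf : InP β a b f) (K : ℕ) : w.Bd K a b f := by
  induction hf with
  | zero => exact .zero
  | mono c i j h hb =>
    exact ((((hw.bd_cu K).pow i).mul ((hw.bd_cm K).pow j)).const_mul c).weaken (by omega) (by omega)
  | add hf hg ihf ihg => exact ihf.add ihg
  | congr hf h ih => exact ih.congr fun p hp => h p (hw.sub hp)

/-- `f` has the homogeneous components `q l ∈ 𝒫(a + l, b)`, up to an error of size
`w.e (a + N) b`. -/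
def HasExp (β : ℝ) (w : Weight) (N : ℕ) (a b : ℤ) (f : ℝ × ℝ → ℝ) (q : ℕ → ℝ × ℝ → ℝ) : Prop :=
  (∀ l : ℕ, InP β (a + l) b (q l)) ∧ ∀ K, w.Bd K (a + N) b fun p => f p - ∑ l ∈ Finset.range N, q l p

/-- `f` has an expansion in homogeneous components with `N` terms. -/
def Expands (β : ℝ) (w : Weight) (N : ℕ) (a b : ℤ) (f : ℝ × ℝ → ℝ) : Prop :=
  ∃ q, HasExp β w N a b f q

namespace HasExp

variable {β : ℝ} {w : Weight} {N M : ℕ} {a b a' b' : ℤ} {f g : ℝ × ℝ → ℝ} {q q' : ℕ → ℝ × ℝ → ℝ}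

theorem congr (h : HasExp β w N a b f q) (he : Set.EqOn f g w.dom) : HasExp β w N a b g q :=
  ⟨h.1, fun K => (h.2 K).congr fun p hp => by simp only [he hp]⟩

theorem bd (h : HasExp β w N a b f q) (hw : IsCubicWeight β w) (K : ℕ) : w.Bd K a b f := by
  have h1 := ((h.2 K).weaken (a := a) (b := b) (by omega) (by omega)).add
    (Weight.Bd.sum (Finset.range N) fun l _ =>
      ((h.1 l).bd hw K).weaken (a := a) (b := b) (by omega) (by omega))
  exact h1.congr fun p _ => by ring

theorem add (h : HasExp β w N a b f q) (h' : HasExp β w N a b g q') :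
    HasExp β w N a b (fun p => f p + g p) fun l p => q l p + q' l p :=
  ⟨fun l => (h.1 l).add (h'.1 l), fun K => ((h.2 K).add (h'.2 K)).congr fun p _ => by
    simp only [Finset.sum_add_distrib]; ring⟩

theorem const_mul (c : ℝ) (h : HasExp β w N a b f q) :
    HasExp β w N a b (fun p => c * f p) fun l p => c * q l p :=
  ⟨fun l => (h.1 l).const_mul c, fun K => ((h.2 K).const_mul c).congr fun p _ => by
    simp only [← Finset.mul_sum]; ring⟩

theorem zero : HasExp β w N a b (fun _ => 0) fun _ _ => 0 :=
  ⟨fun _ => .zero, fun K => Weight.Bd.zero.congr fun p _ => by simp⟩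

theorem sum {ι : Type*} (s : Finset ι) {F : ι → ℝ × ℝ → ℝ} {Q : ι → ℕ → ℝ × ℝ → ℝ}
    (h : ∀ i ∈ s, HasExp β w N a b (F i) (Q i)) :
    HasExp β w N a b (fun p => ∑ i ∈ s, F i p) fun l p => ∑ i ∈ s, Q i l p := by
  classical
  induction s using Finset.induction_on with
  | empty => simpa using zero
  | insert i s hi ih =>
    simp only [Finset.sum_insert hi]
    exact (h i (by simp)).add (ih fun j hj => h j (by simp [hj]))

theorem pd (h : HasExp β w N a b f q) (hw : IsCubicWeight β w) (d : Bool) :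
    HasExp β w N (a - sh d) (b + 1) (pd d f) fun l => pd d (q l) := by
  refine ⟨fun l => ?_, fun K => ?_⟩
  · have := (h.1 l).pd hw.pos d
    rwa [show a + l - sh d = a - sh d + l by ring] at this
  · have h1 := (h.2 (K + 1)).pd d
    rw [show a + N - sh d = a - sh d + N by ring] at h1
    refine h1.congr fun p hp => ?_
    have df := (h.bd hw 0).differentiableAt hp
    have dq : ∀ l, DifferentiableAt ℝ (q l) p := fun l => (h.1 l).differentiableAt hw.pos (hw.sub hp)
    have e1 : BurgersOuter.pd d (fun p => f p - ∑ l ∈ Finset.range N, q l p) p =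
        BurgersOuter.pd d (fun p => f p + (-1) * ∑ l ∈ Finset.range N, q l p) p := by
      congr 1; funext p; ring
    have ds : DifferentiableAt ℝ (fun p => ∑ l ∈ Finset.range N, q l p) p :=
      DifferentiableAt.fun_sum fun l _ => dq l
    rw [e1, pd_add df (ds.const_mul _), pd_const_mul _ ds, pd_sum _ fun l _ => dq l]
    ring

/-- The remainder is split as `fg - ∑ = ∑ᵢ qᵢ (g - ∑_{j<N-i} q'ⱼ) + (f - ∑ᵢ qᵢ) g`. The component
`qᵢ` contributes `i` and its partner's remainder `N - i`, so every summand has leading exponent `a +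
a' + N`. -/
theorem mul (h : HasExp β w N a b f q) (h' : HasExp β w N a' b' g q') (hw : IsCubicWeight β w) :
    HasExp β w N (a + a') (b + b') (fun p => f p * g p)
      fun n p => ∑ c ∈ Finset.HasAntidiagonal.antidiagonal n, q c.1 p * q' c.2 p := by
  refine ⟨fun n => InP.sum _ fun c hc => ?_, fun K => ?_⟩
  · have := (h.1 c.1).mul (h'.1 c.2)
    rwa [show a + c.1 + (a' + c.2) = a + a' + n by
      rw [← Finset.HasAntidiagonal.mem_antidiagonal.1 hc]; push_cast; ring] at this
  · have hg : ∀ i ∈ Finset.range N, w.Bd K (a + a' + N) (b + b')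
        fun p => q i p * (g p - ∑ j ∈ Finset.range (N - i), q' j p) := by
      intro i hi
      have hi' := Finset.mem_range.1 hi
      have h1 : w.Bd K (a' + (N - i : ℕ)) b' fun p => g p - ∑ j ∈ Finset.range (N - i), q' j p := by
        have h2 := ((h'.2 K).weaken (a := a' + (N - i : ℕ)) (b := b') (by omega) (by omega)).add
          (Weight.Bd.sum (Finset.Ico (N - i) N) fun l hl =>
            ((h'.1 l).bd hw K).weaken (a := a' + (N - i : ℕ)) (b := b')
              (by have := Finset.mem_Ico.1 hl; omega) (by have := Finset.mem_Ico.1 hl; omega))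
        refine h2.congr fun p _ => ?_
        have := Finset.sum_range_add_sum_Ico (fun l => q' l p) (Nat.sub_le N i)
        simp only
        linarith
      exact (((h.1 i).bd hw K).mul h1).weaken (by omega) (by omega)
    have h3 := (Weight.Bd.sum _ hg).add
      (((h.2 K).mul (h'.bd hw K)).weaken (a := a + a' + N) (b := b + b') (by omega) (by omega))
    refine h3.congr fun p _ => ?_
    have e1 : ∑ n ∈ Finset.range N, ∑ c ∈ Finset.HasAntidiagonal.antidiagonal n, q c.1 p * q' c.2 p =
        ∑ i ∈ Finset.range N, q i p * ∑ j ∈ Finset.range (N - i), q' j p := by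
      simp only [Finset.Nat.sum_antidiagonal_eq_sum_range_succ (fun i j => q i p * q' j p),
        Finset.mul_sum]
      rw [Finset.sum_sigma', Finset.sum_sigma']
      refine Finset.sum_bij' (fun x _ => ⟨x.2, x.1 - x.2⟩) (fun x _ => ⟨x.1 + x.2, x.1⟩) ?_ ?_ ?_ ?_ ?_
      · rintro ⟨n, i⟩ hx; simp at hx ⊢; omega
      · rintro ⟨n, i⟩ hx; simp at hx ⊢; omega
      · rintro ⟨n, i⟩ hx; simp at hx ⊢; omega
      · rintro ⟨n, i⟩ hx; simp at hx ⊢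
      · rintro ⟨n, i⟩ hx; simp
    rw [e1]
    simp only [mul_sub, Finset.sum_sub_distrib, sub_mul, Finset.sum_mul]
    ring

theorem trunc (h : HasExp β w N a b f q) (hw : IsCubicWeight β w) (hM : M ≤ N) :
    HasExp β w M a b f q := by
  refine ⟨h.1, fun K => ?_⟩
  have h2 := ((h.2 K).weaken (a := a + M) (b := b) (by omega) (by omega)).add
    (Weight.Bd.sum (Finset.Ico M N) fun l hl => ((h.1 l).bd hw K).weaken (a := a + M) (b := b)
      (by have := Finset.mem_Ico.1 hl; omega) (by have := Finset.mem_Ico.1 hl; omega))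
  refine h2.congr fun p _ => ?_
  have := Finset.sum_range_add_sum_Ico (fun l => q l p) hM
  simp only
  linarith

theorem weaken (h : HasExp β w N a' b' f q) (h1 : a - 2 * b = a' - 2 * b') (h2 : b ≤ b') :
    HasExp β w N a b f q :=
  ⟨fun l => (h.1 l).weaken (by omega) h2, fun K => (h.2 K).weaken (by omega) (by omega)⟩

/-- Lowering the leading exponent gains a term. -/
theorem shift (h : HasExp β w N (a + 1) b f q) :
    HasExp β w (N + 1) a b f fun l => if l = 0 then fun _ => 0 else q (l - 1) := by
  refine ⟨fun l => ?_, fun K => ?_⟩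
  · rcases l with _ | l
    · simpa using InP.zero
    · have := h.1 l
      simp only [Nat.add_eq_zero_iff, one_ne_zero, and_false, if_false, Nat.add_sub_cancel]
      push_cast
      rwa [show a + (l + 1 : ℤ) = a + 1 + l by ring]
  · have := h.2 K
    push_cast
    rw [show a + (N + 1 : ℤ) = a + 1 + N by ring]
    exact this.congr fun p _ => by simp [Finset.sum_range_succ']

theorem time_mul (h : HasExp β w N a b f q) (hw : IsCubicWeight β w) (hb : 1 ≤ b) :
    HasExp β w N a (b - 1) (fun p => p.1 * f p) fun l p => p.1 * q l p := by
  refine ⟨fun l => (h.1 l).time_mul hw.pos hb, fun K => ?_⟩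
  exact (((hw.bd_time K).mul (h.2 K)).weaken (a := a + N) (b := b - 1) (by omega) (by omega)).congr
    fun p _ => by simp only [← Finset.mul_sum]; ring

end HasExp

namespace Expands

variable {β : ℝ} {w : Weight} {N M : ℕ} {a b a' b' : ℤ} {f g : ℝ × ℝ → ℝ}

theorem congr (h : Expands β w N a b f) (he : Set.EqOn f g w.dom) : Expands β w N a b g :=
  h.imp fun _ hq => hq.congr he

theorem bd (h : Expands β w N a b f) (hw : IsCubicWeight β w) (K : ℕ) : w.Bd K a b f :=
  h.choose_spec.bd hw K

theorem add (h : Expands β w N a b f) (h' : Expands β w N a b g) :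
    Expands β w N a b fun p => f p + g p :=
  let ⟨_, hq⟩ := h; let ⟨_, hq'⟩ := h'; ⟨_, hq.add hq'⟩

theorem const_mul (c : ℝ) (h : Expands β w N a b f) : Expands β w N a b fun p => c * f p :=
  let ⟨_, hq⟩ := h; ⟨_, hq.const_mul c⟩

theorem mul (h : Expands β w N a b f) (h' : Expands β w N a' b' g) (hw : IsCubicWeight β w) :
    Expands β w N (a + a') (b + b') fun p => f p * g p :=
  let ⟨_, hq⟩ := h; let ⟨_, hq'⟩ := h'; ⟨_, hq.mul hq' hw⟩

theorem pd (h : Expands β w N a b f) (hw : IsCubicWeight β w) (d : Bool) :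
    Expands β w N (a - sh d) (b + 1) (pd d f) :=
  let ⟨_, hq⟩ := h; ⟨_, hq.pd hw d⟩

theorem trunc (h : Expands β w N a b f) (hw : IsCubicWeight β w) (hM : M ≤ N) :
    Expands β w M a b f :=
  let ⟨_, hq⟩ := h; ⟨_, hq.trunc hw hM⟩

theorem weaken (h : Expands β w N a' b' f) (h1 : a - 2 * b = a' - 2 * b') (h2 : b ≤ b') :
    Expands β w N a b f :=
  let ⟨_, hq⟩ := h; ⟨_, hq.weaken h1 h2⟩

theorem shift (h : Expands β w N (a + 1) b f) : Expands β w (N + 1) a b f :=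
  let ⟨_, hq⟩ := h; ⟨_, hq.shift⟩

theorem of_inP (hw : IsCubicWeight β w) (h : InP β a b f) : Expands β w N a b f := by
  refine ⟨fun l => if l = 0 then f else fun _ => 0, fun l => ?_, fun K => ?_⟩
  · by_cases hl : l = 0
    · subst hl; simpa using h
    · simpa [hl] using InP.zero
  · rcases N with _ | N
    · simpa using h.bd hw K
    · exact Weight.Bd.zero.congr fun p _ => by simp [Finset.sum_range_succ']

theorem of_bd (h : ∀ K, w.Bd K (a + N) b f) : Expands β w N a b f :=
  ⟨fun _ _ => 0, fun _ => .zero, fun K => (h K).congr fun p _ => by simp⟩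

/-- Each unit by which the leading exponent drops adds a zero component at the front and drops the
last one. -/
theorem lower (h : Expands β w N a' b f) (hw : IsCubicWeight β w) (ha : a ≤ a') :
    Expands β w N a b f := by
  obtain ⟨k, rfl⟩ : ∃ k : ℕ, a' = a + k := ⟨(a' - a).toNat, by omega⟩
  clear ha
  induction k with
  | zero => simpa using h
  | succ k ih =>
    refine ih (Expands.trunc (N := N + 1) ?_ hw (Nat.le_succ N))
    refine Expands.shift ?_
    convert h using 1
    push_cast; ring

theorem pow (h : Expands β w N a b f) (hw : IsCubicWeight β w) (n : ℕ) :
    Expands β w N (n * a) (n * b) fun p => f p ^ n := by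
  induction n with
  | zero =>
    have : InP β 0 0 (fun _ => 1) := (InP.mono 1 0 0 (by simp) (by simp)).congr fun p _ => by simp
    simpa using of_inP hw this
  | succ n ih =>
    have := ih.mul h hw
    simp only [pow_succ]
    convert this using 1 <;> push_cast <;> ring

/-- Composition with a smooth function vanishing to order `n`. -/
theorem comp {Y : ℝ × ℝ → ℝ} (hY : Expands β w N 1 0 Y) (hw : IsCubicWeight β w) {n : ℤ}
    {φ : ℝ → ℝ} (hφ : Van n φ) : Expands β w N n 0 fun p => φ (Y p) := by
  induction N generalizing n φ with
  | zero => exact of_bd fun K => by simpa using (hY.bd hw K).comp hφ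
  | succ N ih =>
    have hY' := hY.trunc hw (Nat.le_succ N)
    rcases lt_or_ge n 0 with hn | hn
    -- For `n < 0` vanishing to order `n + 1` is no condition, so the leading component is taken to
    -- be zero.
    · exact (ih hY' (Van.of_nonpos (n := n + 1) hφ.1 (by omega))).shift
    · lift n to ℕ using hn
      have h1 : Expands β w (N + 1) n 0 fun p => Y p ^ n := by simpa using hY.pow hw n
      -- Without its leading Taylor monomial `φ` vanishes to one more order, so `N` terms of the
      -- rest count as `N + 1`.
      have h2 := (ih hY' hφ.sub_leading).shift
      exact (h2.add (h1.const_mul (iteratedDeriv n φ 0 / n.factorial))).congr fun p _ => by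
        simp only; ring

end Expands

/-! ### Uniqueness of expansions -/

/-- A polynomial of degree below `N` that is `O(μᴺ)` at `0⁺` is zero: the limit kills the constant
term, and division by `μ` reduces `N`. -/
theorem coeff_eq_zero_of_small {ε : ℝ} (hε : 0 < ε) (N : ℕ) (c : ℕ → ℝ) (C : ℝ)
    (h : ∀ μ : ℝ, 0 < μ → μ < ε → |∑ l ∈ Finset.range N, μ ^ l * c l| ≤ C * μ ^ N) :
    ∀ l < N, c l = 0 := by
  induction N generalizing c with
  | zero => intro l hl; omega
  | succ N ih =>
    have h0 : c 0 = 0 := by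
      have hlim : Filter.Tendsto (fun μ : ℝ => |∑ l ∈ Finset.range (N + 1), μ ^ l * c l|)
          (nhdsWithin 0 (Set.Ioi 0)) (nhds |c 0|) := by
        have hc : Continuous fun μ : ℝ => |∑ l ∈ Finset.range (N + 1), μ ^ l * c l| := by fun_prop
        have := hc.tendsto 0
        simp only [Finset.sum_range_succ', pow_succ, mul_zero, zero_mul, Finset.sum_const_zero,
          pow_zero, one_mul, zero_add] at this
        simp only [Finset.sum_range_succ', pow_succ, pow_zero, one_mul]
        exact this.mono_left nhdsWithin_le_nhds
      have hlim' : Filter.Tendsto (fun μ : ℝ => C * μ ^ (N + 1))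
          (nhdsWithin 0 (Set.Ioi 0)) (nhds 0) := by
        have hc : Continuous fun μ : ℝ => C * μ ^ (N + 1) := by fun_prop
        have := hc.tendsto 0
        simp only [ne_eq, Nat.add_eq_zero_iff, one_ne_zero, and_false, not_false_eq_true, zero_pow,
          mul_zero] at this
        exact this.mono_left nhdsWithin_le_nhds
      have hle := le_of_tendsto_of_tendsto hlim hlim' (by
        filter_upwards [Ioo_mem_nhdsGT hε] with μ hμ using h μ hμ.1 hμ.2)
      exact abs_eq_zero.1 (le_antisymm hle (abs_nonneg _))
    have h1 := ih (fun l => c (l + 1)) fun μ hμ hμε => by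
      have := h μ hμ hμε
      rw [Finset.sum_range_succ', h0] at this
      have e : ∑ k ∈ Finset.range N, μ ^ (k + 1) * c (k + 1) + μ ^ 0 * 0 =
          μ * ∑ k ∈ Finset.range N, μ ^ k * c (k + 1) := by
        rw [Finset.mul_sum, mul_zero, add_zero]
        exact Finset.sum_congr rfl fun k _ => by ring
      rw [e, abs_mul, abs_of_pos hμ, pow_succ, ← mul_assoc, mul_comm] at this
      exact le_of_mul_le_mul_right this hμ
    intro l hl
    rcases l with _ | l
    · exact h0
    · exact h1 l (by omega)

/-- At `(μ² t, μ³ x)` the components differ by `μ^(a-2b) ∑ μˡ (qₗ - q'ₗ)`, while the difference of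
the remainders is `O(μ^(a-2b+N))`. For small `μ` the point lies in the domain of the weight, so
equality follows at every point with `t < 0`. -/
theorem HasExp.unique {β : ℝ} {w : Weight} {N : ℕ} {a b : ℤ} {f : ℝ × ℝ → ℝ}
    {q q' : ℕ → ℝ × ℝ → ℝ} (h : HasExp β w N a b f q) (h' : HasExp β w N a b f q')
    (hw : IsCubicWeight β w) : ∀ l < N, ∀ p ∈ past, q l p = q' l p := by
  intro l hl p hp
  obtain ⟨ε, hε, hmem⟩ := hw.mem_of_small p hp
  obtain ⟨C, hC0, hC⟩ := ((h'.2 0).sub (h.2 0)).bd0.exists_nonneg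
  refine sub_eq_zero.1 (coeff_eq_zero_of_small hε N (fun l => q l p - q' l p)
    (C * w.σ p ^ (2 * b - (a + N))) (fun μ hμ hμε => ?_) l hl)
  have hm := hmem μ hμ hμε
  have hb := hC _ hm
  have hσ := hw.σ_pos p hp
  have e1 : (f (μ ^ 2 * p.1, μ ^ 3 * p.2) - ∑ l ∈ Finset.range N, q' l (μ ^ 2 * p.1, μ ^ 3 * p.2) -
      (f (μ ^ 2 * p.1, μ ^ 3 * p.2) - ∑ l ∈ Finset.range N, q l (μ ^ 2 * p.1, μ ^ 3 * p.2))) =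
      μ ^ (a - 2 * b) * ∑ l ∈ Finset.range N, μ ^ l * (q l p - q' l p) := by
    rw [Finset.mul_sum, sub_sub_sub_cancel_left, ← Finset.sum_sub_distrib]
    refine Finset.sum_congr rfl fun l _ => ?_
    rw [(h.1 l).scale hw.pos hμ.ne' hp, (h'.1 l).scale hw.pos hμ.ne' hp,
      show a + l - 2 * b = a - 2 * b + l by ring, zpow_add₀ hμ.ne', zpow_natCast]
    ring
  have hle : w.e (a + N) b (μ ^ 2 * p.1, μ ^ 3 * p.2) ≤
      μ ^ (a - 2 * b) * (μ ^ N * w.σ p ^ (2 * b - (a + N))) := by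
    have e2 : (μ⁻¹ * w.σ p) ^ (2 * b - (a + N)) =
        μ ^ (a - 2 * b) * (μ ^ N * w.σ p ^ (2 * b - (a + N))) := by
      rw [mul_zpow, inv_zpow', show -(2 * b - (a + N)) = a - 2 * b + N by ring, zpow_add₀ hμ.ne',
        zpow_natCast]
      ring
    rw [Weight.e, hw.σ_scale p hp μ hμ, e2]
    refine mul_le_of_le_one_left (by positivity) (pow_le_one₀ (w.r_nonneg _ hm) (w.r_le _ hm))
  rw [e1, abs_mul, abs_of_pos (zpow_pos hμ _)] at hb
  have h2 := hb.trans (mul_le_mul_of_nonneg_left hle hC0)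
  have hpos : 0 < μ ^ (a - 2 * b) := zpow_pos hμ _
  refine le_of_mul_le_mul_left (h2.trans_eq ?_) hpos
  ring

/-- The components of a function all of whose finite expansions exist. -/
theorem Expands.exists_hasExp {β : ℝ} {w : Weight} {a b : ℤ} {f : ℝ × ℝ → ℝ}
    (hw : IsCubicWeight β w) (h : ∀ N, Expands β w N a b f) :
    ∃ q, ∀ N, HasExp β w N a b f q := by
  choose q hq using h
  -- An expansion with `N` terms determines only the components of index below `N`, so the `l`-th
  -- one is read off from `l + 1` terms.
  refine ⟨fun l => q (l + 1) l, fun N => ⟨fun l => (hq (l + 1)).1 l, fun K => ?_⟩⟩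
  refine ((hq N).2 K).congr fun p hp => ?_
  refine congrArg (f p - ·) (Finset.sum_congr rfl fun l hl => ?_)
  have hl' := Finset.mem_range.1 hl
  exact ((hq N).trunc hw (M := l + 1) (by omega)).unique (hq (l + 1)) hw l (by omega) p (hw.sub hp)

/-! ### The weight of a strip -/

/-- The normalizing constant of `stripWeight`. -/
noncomputable def stripConst (β T X : ℝ) : ℝ := |T| + 3 * β * (1 + X / β) + 1

theorem stripConst_pos {β T X : ℝ} (hβ : 0 < β) (hX : 0 < X) : 0 < stripConst β T X := by
  unfold stripConst; positivity

theorem abs_eq_cubic {β : ℝ} {p : ℝ × ℝ} (hβ : 0 < β) (hp : p ∈ past) :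
    |p.2| = -p.1 * |cu β p| + β * |cu β p| ^ 3 := by
  have h := cu_spec hβ hp
  have ht : p.1 < 0 := hp
  rcases le_total 0 (cu β p) with hv | hv
  · rw [abs_of_nonneg hv, ← h, abs_of_nonpos]
    · ring
    · nlinarith [mul_nonneg hβ.le (pow_nonneg hv 3), mul_nonneg (neg_nonneg.2 ht.le) hv]
  · have hv' : 0 ≤ -cu β p := by linarith
    rw [abs_of_nonpos hv, ← h, abs_of_nonneg]
    · ring
    · nlinarith [mul_nonneg hβ.le (pow_nonneg hv' 3), mul_nonneg (neg_nonneg.2 ht.le) hv']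

/-- On the strip the cubic equation gives `|𝔲|³ ≤ X / β`, hence `𝔲² ≤ 1 + X / β`, which bounds `1 /
𝔪` from above. -/
theorem one_le_stripConst_mul {β T X : ℝ} (hβ : 0 < β) {p : ℝ × ℝ}
    (hp : p ∈ Set.Ioo T 0 ×ˢ Set.Ioo (-X) X) : 1 ≤ stripConst β T X * cm β p := by
  obtain ⟨⟨h1, h2⟩, h3, h4⟩ := hp
  have hpast : p ∈ past := h2
  have hx : |p.2| ≤ X := abs_le.2 ⟨h3.le, h4.le⟩
  rw [abs_eq_cubic hβ hpast] at hx
  have hv := abs_nonneg (cu β p)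
  have hv3 : |cu β p| ^ 3 ≤ X / β := by
    rw [le_div_iff₀ hβ]
    nlinarith [mul_nonneg (neg_nonneg.2 h2.le) hv]
  have hv2 : cu β p ^ 2 ≤ 1 + X / β := by
    rw [← sq_abs]
    nlinarith [sq_nonneg (|cu β p| - 1), mul_nonneg hv (sq_nonneg (|cu β p| - 1))]
  have hT : -p.1 ≤ |T| := by linarith [neg_abs_le T]
  rw [cm_eq hpast, ← div_eq_mul_inv, one_le_div (cm_denom_pos hβ hpast), stripConst]
  nlinarith

/-- The weight on the strip `T < t < 0`, `|x| < X` given by the cubic profile. -/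
noncomputable def stripWeight (β T X : ℝ) (hβ : 0 < β) : Weight where
  dom := Set.Ioo T 0 ×ˢ Set.Ioo (-X) X
  isOpen := isOpen_Ioo.prod isOpen_Ioo
  -- `r ∼ |𝔲| 𝔪^(1/2)` and `σ ∼ 𝔪^(1/2)` make `e a b` a multiple of `𝔢(a, b)` for both signs of `a`;
  -- the constants are those that give `r ≤ 1 ≤ σ`.
  r p := √(3 * β * cu β p ^ 2 * cm β p)
  σ p := √(stripConst β T X * cm β p)
  r_nonneg _ _ := Real.sqrt_nonneg _
  r_le p hp := by
    have hp' : p ∈ past := hp.1.2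
    rw [Real.sqrt_le_left zero_le_one, one_pow]
    have h1 := cm_mul hβ hp'
    have h2 := cm_pos hβ hp'
    have h3 : p.1 < 0 := hp'
    nlinarith
  one_le p hp := by
    rw [Real.one_le_sqrt]
    exact one_le_stripConst_mul hβ hp

/-- The two profiles bootstrap each other: `K` derivatives of `𝔲` control `K` derivatives of the
reciprocal `𝔪`, and since `∂ₓ𝔲 = -𝔪` and `∂ₜ𝔲 = 𝔲𝔪` these control `K + 1` derivatives of `𝔲`. -/
theorem stripWeight_isCubic {β T X : ℝ} (hβ : 0 < β) (hT : T < 0) (hX : 0 < X) :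
    IsCubicWeight β (stripWeight β T X hβ) := by
  set w := stripWeight β T X hβ with hw
  set κ := stripConst β T X with hκ
  have hκ0 : 0 < κ := stripConst_pos hβ hX
  have hsub : w.dom ⊆ past := fun p hp => hp.1.2
  have hσ2 : ∀ p ∈ past, w.σ p ^ 2 = κ * cm β p := fun p hp =>
    Real.sq_sqrt (mul_pos hκ0 (cm_pos hβ hp)).le
  have hσpos : ∀ p ∈ past, 0 < w.σ p := fun p hp =>
    Real.sqrt_pos.2 (mul_pos hκ0 (cm_pos hβ hp))
  have hσm2 : ∀ p ∈ past, κ * w.σ p ^ (-2 : ℤ) = -p.1 + 3 * β * cu β p ^ 2 := fun p hp => by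
    have h1 := cm_mul hβ hp
    have h2 := cm_pos hβ hp
    rw [zpow_neg]
    norm_cast
    rw [hσ2 p hp, mul_inv, ← mul_assoc, mul_inv_cancel₀ hκ0.ne', one_mul]
    exact inv_eq_of_mul_eq_one_right h1
  have ht0 : w.Bd0 0 (-1) fun p => p.1 := by
    refine ⟨contDiffOn_fst, κ, fun p hp => ?_⟩
    have h2 := hσm2 p (hsub hp)
    have h3 : p.1 < 0 := hsub hp
    simp only [Weight.e, Int.toNat_zero, pow_zero, one_mul, abs_of_neg h3]
    rw [show (2 * -1 - 0 : ℤ) = -2 by norm_num, h2]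
    nlinarith [mul_nonneg hβ.le (sq_nonneg (cu β p))]
  have ht : ∀ K, w.Bd K 0 (-1) fun p => p.1 := by
    intro K
    cases K with
    | zero => exact ht0
    | succ K =>
      refine ⟨ht0, fun d => ?_⟩
      cases d with
      | true => exact Weight.Bd.zero.congr fun p _ => by simp [pd_fst]
      | false =>
        exact ((Weight.Bd.const 1).weaken (by simp [sh]) (by simp [sh])).congr fun p _ => by
          simp [pd_fst]
  have hv0 : w.Bd0 1 0 (cu β) := by
    refine ⟨(cu_smooth hβ).mono hsub, √(κ / (3 * β)), fun p hp => ?_⟩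
    have hm := cm_pos hβ (hsub hp)
    have h1 : w.e 1 0 p = w.r p / w.σ p := by
      simp [Weight.e, div_eq_mul_inv]
    rw [h1]
    change _ ≤ √(κ / (3 * β)) * (√(3 * β * cu β p ^ 2 * cm β p) / √(κ * cm β p))
    rw [← Real.sqrt_div' _ (by positivity), ← Real.sqrt_mul (by positivity), ← Real.sqrt_sq_eq_abs]
    refine Real.sqrt_le_sqrt (le_of_eq ?_)
    field_simp
  have hmJ : ∀ K, w.Bd K 1 0 (cu β) → w.Bd K 0 1 (cm β) := by
    intro K hK
    have h1 : w.Bd K 0 (-1) fun p => -p.1 + 3 * β * cu β p ^ 2 :=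
      ((ht K).neg).add (((hK.pow 2).const_mul (3 * β)).weaken (by norm_num) (by norm_num))
    exact (h1.inv hκ0 fun p hp => (hσm2 p (hsub hp)).le).congr fun p hp => (cm_eq (hsub hp)).symm
  have hv : ∀ K, w.Bd K 1 0 (cu β) := by
    intro K
    induction K with
    | zero => exact hv0
    | succ K ih =>
      refine ⟨hv0, fun d => ?_⟩
      cases d with
      | true =>
        exact ((hmJ K ih).neg.weaken (by simp [sh]) (by simp [sh])).congr fun p hp =>
          (((cu_label hβ).2 p (hsub hp)).1).symm
      | false =>
        exact ((ih.mul (hmJ K ih)).weaken (by simp [sh]) (by simp [sh])).congr fun p hp =>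
          (((cu_label hβ).2 p (hsub hp)).2).symm
  refine ⟨hβ, hsub, hv, fun K => hmJ K (hv K), ht, fun p hp => ?_, fun p hp μ hμ => ?_, hσpos, κ, hκ0, hσm2⟩
  · have h1 : Filter.Tendsto (fun μ : ℝ => (μ ^ 2 * p.1, μ ^ 3 * p.2)) (nhds 0) (nhds (0, 0)) := by
      have hc : Continuous fun μ : ℝ => (μ ^ 2 * p.1, μ ^ 3 * p.2) := by fun_prop
      simpa using hc.tendsto 0
    have h2 : Set.Ioi T ×ˢ Set.Ioo (-X) X ∈ nhds ((0 : ℝ), (0 : ℝ)) :=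
      prod_mem_nhds (Ioi_mem_nhds hT) (Ioo_mem_nhds (by linarith) hX)
    obtain ⟨ε, hε, hball⟩ := Metric.eventually_nhds_iff.1 (h1.eventually h2)
    refine ⟨ε, hε, fun μ hμ hμε => ?_⟩
    have h3 := hball (y := μ) (by simpa [abs_of_pos hμ] using hμε)
    exact ⟨⟨h3.1, scale_mem hμ.ne' hp⟩, h3.2⟩
  · change √(κ * cm β (μ ^ 2 * p.1, μ ^ 3 * p.2)) = μ⁻¹ * √(κ * cm β p)
    rw [cm_scale hβ hμ.ne' hp, show κ * ((μ ^ 2)⁻¹ * cm β p) = (μ⁻¹) ^ 2 * (κ * cm β p) by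
      rw [inv_pow]; ring, Real.sqrt_mul (sq_nonneg _), Real.sqrt_sq (inv_pos.2 hμ).le]

/-! ### Shock data -/

namespace IsShockData

variable {u₀ : ℝ → ℝ}

theorem differentiable (h : IsShockData u₀) : Differentiable ℝ u₀ := h.smooth.differentiable (by simp)

theorem smooth_deriv (h : IsShockData u₀) : ContDiff ℝ ∞ (deriv u₀) :=
  (contDiff_infty_iff_deriv.1 h.smooth).2

theorem startTime_neg (h : IsShockData u₀) : startTime u₀ < 0 := inv_lt_zero.2 h.slope_neg

theorem slope_mul (h : IsShockData u₀) : startTime u₀ * deriv u₀ 0 = 1 :=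
  inv_mul_cancel₀ h.slope_neg.ne

theorem beta_pos (h : IsShockData u₀) : 0 < beta u₀ := by
  have h1 := h.startTime_neg
  have h2 := h.nondegenerate
  have : 0 < startTime u₀ ^ 4 := Even.pow_pos ⟨2, rfl⟩ h1.ne
  unfold beta
  positivity

theorem le_deriv (h : IsShockData u₀) (x : ℝ) : deriv u₀ 0 ≤ deriv u₀ x := by
  by_cases hx : x = 0
  · rw [hx]
  · exact (h.unique_min x hx).le

theorem second_deriv_zero (h : IsShockData u₀) : deriv (deriv u₀) 0 = 0 :=
  IsLocalMin.deriv_eq_zero (Filter.Eventually.of_forall h.le_deriv)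

/-- The data agree with their cubic Taylor polynomial to fourth order. -/
theorem van_taylor (h : IsShockData u₀) :
    Van 4 (fun y => u₀ y - (startTime u₀)⁻¹ * y - iteratedDeriv 3 u₀ 0 / 6 * y ^ 3) := by
  have h0 : Van (0 : ℕ) u₀ := Van.of_nonpos h.smooth (by simp)
  have h1 := h0.sub_leading
  simp only [iteratedDeriv_zero, h.value_zero, zero_div, zero_mul, sub_zero] at h1
  have h2 := Van.sub_leading (k := 1) (by simpa using h1)
  have e1 : ∀ y, u₀ y - iteratedDeriv 1 u₀ 0 / (Nat.factorial 1 : ℝ) * y ^ 1 =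
      u₀ y - (startTime u₀)⁻¹ * y := fun y => by simp [startTime]
  simp only [e1] at h2
  have hd : ∀ n, iteratedDeriv (n + 2) (fun y => u₀ y - (startTime u₀)⁻¹ * y) 0 =
      iteratedDeriv (n + 2) u₀ 0 := fun n => by
    rw [iteratedDeriv_fun_sub (contDiff_infty.1 h.smooth (n + 2)).contDiffAt (by fun_prop),
      iteratedDeriv_const_mul_field]
    have : iteratedDeriv (n + 2) (fun y : ℝ => y) 0 = 0 := by
      rw [iteratedDeriv_succ', iteratedDeriv_succ']
      simp
    rw [this]; simp
  -- The quadratic Taylor coefficient is absent because the slope is minimal at `0`.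
  have h3 : Van 3 (fun y => u₀ y - (startTime u₀)⁻¹ * y) := by
    refine ⟨h2.1, fun i hi => ?_⟩
    rcases lt_or_ge i 2 with hi2 | hi2
    · exact h2.2 i (by push_cast; omega)
    · obtain rfl : i = 0 + 2 := by omega
      rw [hd 0, iteratedDeriv_succ', iteratedDeriv_succ', iteratedDeriv_zero, h.second_deriv_zero]
  have h4 := Van.sub_leading (k := 3) (by simpa using h3)
  rw [hd 1] at h4
  exact h4

theorem van_linear (h : IsShockData u₀) : Van 3 (fun y => u₀ y - (startTime u₀)⁻¹ * y) := by
  have h3 : Van 3 (fun y : ℝ => y ^ 3) := by simpa using Van.pow_id 3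
  have := (h.van_taylor.weaken (n := 3) (by norm_num)).add (h3.const_mul (iteratedDeriv 3 u₀ 0 / 6))
  simpa using this

theorem van_one (h : IsShockData u₀) : Van 1 u₀ := by
  have h3 : Van 1 (fun y : ℝ => y) := by simpa using Van.pow_id 1
  have := (h.van_linear.weaken (n := 1) (by norm_num)).add (h3.const_mul (startTime u₀)⁻¹)
  simpa using this

/-- The deviation of the initial labels from the linear profile. -/
theorem van_label (h : IsShockData u₀) : Van 3 (fun y => y - startTime u₀ * u₀ y) := by
  have := h.van_linear.const_mul (-startTime u₀)
  have h0 := h.startTime_neg.ne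
  convert this using 2 with y
  field_simp
  ring

/-- The deviation of the initial labels from the cubic profile. -/
theorem van_cubic (h : IsShockData u₀) :
    Van 4 (fun y => y - startTime u₀ * u₀ y + beta u₀ * u₀ y ^ 3) := by
  have h0 := h.startTime_neg.ne
  have hid : Van 1 (fun y : ℝ => y) := by simpa using Van.pow_id 1
  -- The choice of `β` enters through `β / t₀³ = t₀ u₀'''(0) / 6`: up to the Taylor remainder only
  -- `β (u₀³ - (y/t₀)³)` is left. Its factor `u₀ - y/t₀` has order 3 and the other one, treated
  -- here, order 2.
  have hq : Van 2 (fun y => u₀ y * u₀ y + ((startTime u₀)⁻¹ * (u₀ y * y) +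
      (startTime u₀)⁻¹ ^ 2 * (y * y))) :=
    (h.van_one.mul h.van_one).add (((h.van_one.mul hid).const_mul _).add ((hid.mul hid).const_mul _))
  have := (h.van_taylor.const_mul (-startTime u₀)).add
    (((h.van_linear.mul hq).weaken (n := 4) (by norm_num)).const_mul (beta u₀))
  convert this using 2 with y
  unfold beta
  field_simp
  ring

theorem van_deriv (h : IsShockData u₀) : Van 2 (fun y => 1 - startTime u₀ * deriv u₀ y) := by
  have := h.van_label.deriv.weaken (n := 2) (by norm_num)
  convert this using 2 with y
  have hd := h.differentiable y
  simp [deriv_fun_sub differentiableAt_fun_id (hd.const_mul _), deriv_const_mul _ hd]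

theorem exists_bounds (h : IsShockData u₀) :
    ∃ B, 0 < B ∧ (∀ y, |u₀ y| ≤ B) ∧ ∀ y, |deriv u₀ y| ≤ B := by
  obtain ⟨c, L, hL, hc⟩ := h.const_outside
  obtain ⟨B₀, hB₀⟩ := (isCompact_Icc (a := -L) (b := L)).exists_bound_of_continuousOn
    h.smooth.continuous.continuousOn
  obtain ⟨B₁, hB₁⟩ := (isCompact_Icc (a := -L) (b := L)).exists_bound_of_continuousOn
    h.smooth_deriv.continuous.continuousOn
  have hp0 := abs_nonneg c
  have hp1 := abs_nonneg B₀
  have hp2 := abs_nonneg B₁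
  refine ⟨|c| + |B₀| + |B₁| + 1, by positivity, fun y => ?_, fun y => ?_⟩
  · by_cases hy : y ∈ Set.Icc (-L) L
    · have := hB₀ y hy
      rw [Real.norm_eq_abs] at this
      linarith [le_abs_self B₀]
    · rw [hc y hy]; linarith
  · by_cases hy : y ∈ Set.Icc (-L) L
    · have := hB₁ y hy
      rw [Real.norm_eq_abs] at this
      linarith [le_abs_self B₁]
    · have : u₀ =ᶠ[nhds y] fun _ => c :=
        Filter.eventuallyEq_of_mem (isClosed_Icc.isOpen_compl.mem_nhds hy) fun z hz => hc z hz
      rw [this.deriv_eq]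
      simp; linarith

/-- Quadratic bounds of the slope near its minimum. -/
theorem slope_bounds (h : IsShockData u₀) {B : ℝ} (hB : 0 < B) :
    ∃ c C, 0 < c ∧ 0 < C ∧ ∀ y, |y| ≤ B → c * y ^ 2 ≤ 1 - startTime u₀ * deriv u₀ y ∧
      1 - startTime u₀ * deriv u₀ y ≤ C * y ^ 2 := by
  have ht := h.startTime_neg
  set q : ℝ → ℝ := fun y => 1 - startTime u₀ * deriv u₀ y with hq
  have hqpos : ∀ y, y ≠ 0 → 0 < q y := fun y hy => by
    have := mul_lt_mul_of_neg_left (h.unique_min y hy) ht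
    rw [h.slope_mul] at this
    simp only [hq]; linarith
  obtain ⟨C, hC0, hC⟩ := Van.bound_pow (k := 2) (by simpa using h.van_deriv) B
  set γ := -startTime u₀ * (iteratedDeriv 3 u₀ 0 / 2) with hγ
  have hγ0 : 0 < γ := mul_pos (by linarith) (by linarith [h.nondegenerate])
  have hqv : Van 3 (fun y => q y - γ * y ^ 2) := by
    have h4 := (h.van_taylor.const_mul (-startTime u₀)).deriv.weaken (n := 3) (by norm_num)
    have h0 := ht.ne
    convert h4 using 2 with y
    have hd := h.differentiable y
    have e1 : HasDerivAt (fun y => -startTime u₀ * (u₀ y - (startTime u₀)⁻¹ * y -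
        iteratedDeriv 3 u₀ 0 / 6 * y ^ 3)) _ y :=
      ((hd.hasDerivAt.sub ((hasDerivAt_id y).const_mul _)).sub
        ((hasDerivAt_pow 3 y).const_mul _)).const_mul _
    rw [e1.deriv]
    simp only [hq, hγ]
    field_simp
    push_cast
    ring
  obtain ⟨D, hD0, hD⟩ := Van.bound_pow (k := 3) (by simpa using hqv) B
  -- For `|y| ≤ s` the cubic error `D |y|³` is at most half of the main term `γ y²`.
  set s := min B (γ / (2 * (D + 1))) with hs
  have hs0 : 0 < s := lt_min hB (by positivity)
  -- Away from `0`, compactness and strictness of the minimum give a positive lower bound. The bound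
  -- `s ≤ B` keeps the compact set nonempty.
  obtain ⟨m, hm0, hm⟩ : ∃ m > 0, ∀ y, s ≤ |y| → |y| ≤ B → m ≤ q y := by
    have hcomp : IsCompact (Set.Icc (-B) B \ Set.Ioo (-s) s) := isCompact_Icc.diff isOpen_Ioo
    have hmem : ∀ y, s ≤ |y| → |y| ≤ B → y ∈ Set.Icc (-B) B \ Set.Ioo (-s) s := fun y h1 h2 =>
      ⟨abs_le.1 h2, fun h3 => absurd (abs_lt.2 ⟨h3.1, h3.2⟩) (not_lt.2 h1)⟩
    have hne : (Set.Icc (-B) B \ Set.Ioo (-s) s).Nonempty :=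
      ⟨B, hmem B (by rw [abs_of_pos hB]; exact min_le_left _ _) (by rw [abs_of_pos hB])⟩
    have hcq : Continuous q := continuous_const.sub (continuous_const.mul h.smooth_deriv.continuous)
    obtain ⟨z, hz, hmin⟩ := hcomp.exists_isMinOn hne hcq.continuousOn
    refine ⟨q z, hqpos z ?_, fun y h1 h2 => hmin (hmem y h1 h2)⟩
    rintro rfl
    exact hz.2 ⟨by linarith, hs0⟩
  refine ⟨min (γ / 2) (m / B ^ 2), C + 1, lt_min (by positivity) (by positivity), by positivity,
    fun y hy => ⟨?_, ?_⟩⟩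
  · rcases le_total s |y| with hsy | hsy
    · have h1 := hm y hsy hy
      have h2 : y ^ 2 ≤ B ^ 2 := by rw [← sq_abs]; exact pow_le_pow_left₀ (abs_nonneg y) hy 2
      calc min (γ / 2) (m / B ^ 2) * y ^ 2 ≤ m / B ^ 2 * B ^ 2 :=
            mul_le_mul (min_le_right _ _) h2 (sq_nonneg _) (by positivity)
        _ = m := by field_simp
        _ ≤ _ := h1
    · have h1 := (abs_le.1 (hD y hy)).1
      have h2 : (D + 1) * |y| ≤ γ / 2 := by
        have : |y| ≤ γ / (2 * (D + 1)) := hsy.trans (min_le_right _ _)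
        rw [le_div_iff₀ (by positivity)] at this
        linarith
      have h3 : D * |y| ^ 3 ≤ γ / 2 * y ^ 2 := by
        have h4 : D * |y| ≤ γ / 2 := by linarith [abs_nonneg y]
        calc D * |y| ^ 3 = D * |y| * |y| ^ 2 := by ring
          _ ≤ γ / 2 * |y| ^ 2 := mul_le_mul_of_nonneg_right h4 (sq_nonneg _)
          _ = _ := by rw [sq_abs]
      have h5 : min (γ / 2) (m / B ^ 2) * y ^ 2 ≤ γ / 2 * y ^ 2 :=
        mul_le_mul_of_nonneg_right (min_le_left _ _) (sq_nonneg _)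
      change _ ≤ q y
      linarith
  · have := (abs_le.1 (hC y hy)).2
    rw [sq_abs] at this
    linarith [sq_nonneg y]

end IsShockData

/-! ### The Lagrangian label -/

/-- The slab `T < t < 0` in the plane. -/
def slab (T : ℝ) : Set (ℝ × ℝ) := Set.Ioo T 0 ×ˢ Set.univ

theorem isOpen_slab (T : ℝ) : IsOpen (slab T) := isOpen_Ioo.prod isOpen_univ

/-- `Y (t, x)` is the position at the initial time of the particle that is in `x` at time `t`,
for times in `(T, 0)`, which contains the initial time. -/
structure IsLabel (u₀ : ℝ → ℝ) (T : ℝ) (Y : ℝ × ℝ → ℝ) : Prop where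
  lt_start : T < startTime u₀
  half_le : ∀ t, T < t → t ≤ startTime u₀ → ∀ y, 1 / 2 ≤ 1 + (t - startTime u₀) * deriv u₀ y
  jac_pos : ∀ t, T < t → t < 0 → ∀ y, 0 < 1 + (t - startTime u₀) * deriv u₀ y
  spec : ∀ p ∈ slab T, Y p + (p.1 - startTime u₀) * u₀ (Y p) = p.2

/-- The reciprocal `∂ₓY` of the Jacobian of the flow. -/
noncomputable def labelN (u₀ : ℝ → ℝ) (Y : ℝ × ℝ → ℝ) (p : ℝ × ℝ) : ℝ :=
  (1 + (p.1 - startTime u₀) * deriv u₀ (Y p))⁻¹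

/-- The elapsed time multiplied by `∂ₓY`. -/
noncomputable def labelZ (u₀ : ℝ → ℝ) (Y : ℝ × ℝ → ℝ) (p : ℝ × ℝ) : ℝ :=
  (p.1 - startTime u₀) * labelN u₀ Y p

theorem flow_deriv {u₀ : ℝ → ℝ} (h : IsShockData u₀) (τ y : ℝ) :
    HasDerivAt (fun y => y + τ * u₀ y) (1 + τ * deriv u₀ y) y :=
  (hasDerivAt_id y).add ((h.differentiable y).hasDerivAt.const_mul τ)

/-- Up to `t = 0` the Jacobian is at least `t u₀'(0) > 0`, as `u₀'` is minimal at `0` and `t₀ u₀'(0)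
= 1`. Backwards from `t₀` it stays above `1/2` for a time `1 / (2B)`, where `B` bounds `|u₀'|`.
Since `u₀` is bounded, the intermediate value theorem provides a label. -/
theorem IsShockData.exists_label {u₀ : ℝ → ℝ} (h : IsShockData u₀) : ∃ T Y, IsLabel u₀ T Y := by
  obtain ⟨B, hB, hB0, hB1⟩ := h.exists_bounds
  have ht := h.startTime_neg
  set T := startTime u₀ - 1 / (2 * B) with hT
  have hhalf : ∀ t, T < t → t ≤ startTime u₀ → ∀ y,
      1 / 2 ≤ 1 + (t - startTime u₀) * deriv u₀ y := by
    intro t h1 h2 y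
    have h3 : |(t - startTime u₀) * deriv u₀ y| ≤ 1 / (2 * B) * B := by
      rw [abs_mul]
      refine mul_le_mul ?_ (hB1 y) (abs_nonneg _) (by positivity)
      rw [abs_of_nonpos (by linarith)]
      linarith
    have h4 : 1 / (2 * B) * B = 1 / 2 := by field_simp
    linarith [(abs_le.1 h3).1]
  have hpos : ∀ t, T < t → t < 0 → ∀ y, 0 < 1 + (t - startTime u₀) * deriv u₀ y := by
    intro t h1 h2 y
    rcases le_total t (startTime u₀) with h3 | h3
    · linarith [hhalf t h1 h3 y]
    · have h4 := mul_le_mul_of_nonneg_left (h.le_deriv y) (sub_nonneg.2 h3)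
      have h5 := mul_pos_of_neg_of_neg h2 h.slope_neg
      linarith [h.slope_mul]
  have hex : ∀ p : ℝ × ℝ, ∃ y, y + (p.1 - startTime u₀) * u₀ y = p.2 := by
    intro p
    set τ := p.1 - startTime u₀
    have hc : Continuous fun y => y + τ * u₀ y :=
      continuous_id.add (continuous_const.mul h.smooth.continuous)
    have hb : ∀ y, |τ * u₀ y| ≤ |τ| * B := fun y => by
      rw [abs_mul]; exact mul_le_mul_of_nonneg_left (hB0 y) (abs_nonneg _)
    set M := |p.2| + |τ| * B
    have hM : 0 ≤ M := by positivity
    obtain ⟨y, -, hy⟩ := intermediate_value_Icc (show -M ≤ M by linarith) hc.continuousOn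
      (show p.2 ∈ Set.Icc _ _ from
        ⟨by linarith [(abs_le.1 (hb (-M))).2, neg_abs_le p.2],
          by linarith [(abs_le.1 (hb M)).1, le_abs_self p.2]⟩)
    exact ⟨y, hy⟩
  choose Y hY using hex
  exact ⟨T, Y, by rw [hT]; linarith [show 0 < 1 / (2 * B) by positivity], hhalf, hpos, fun p _ => hY p⟩

namespace IsLabel

variable {u₀ : ℝ → ℝ} {T : ℝ} {Y : ℝ × ℝ → ℝ} {p : ℝ × ℝ} (h : IsShockData u₀)
  (hY : IsLabel u₀ T Y)

include h hY

theorem unique (hp : p ∈ slab T) {y : ℝ} (hy : y + (p.1 - startTime u₀) * u₀ y = p.2) :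
    y = Y p := by
  have hmono : StrictMono fun y => y + (p.1 - startTime u₀) * u₀ y :=
    strictMono_of_deriv_pos fun y => by
      rw [(flow_deriv h _ y).deriv]; exact hY.jac_pos p.1 hp.1.1 hp.1.2 y
  exact hmono.injective (hy.trans (hY.spec p hp).symm)

theorem label : ContDiffOn ℝ ∞ Y (slab T) ∧ ∀ p ∈ slab T,
    pd true Y p = labelN u₀ Y p ∧ pd false Y p = -u₀ (Y p) * labelN u₀ Y p := by
  have hd : ∀ y, deriv (fun y => y - startTime u₀ * u₀ y) y = 1 - startTime u₀ * deriv u₀ y :=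
    fun y => ((hasDerivAt_id y).sub ((h.differentiable y).hasDerivAt.const_mul _)).deriv
  have hJ : ∀ p : ℝ × ℝ, 1 - startTime u₀ * deriv u₀ (Y p) + p.1 * deriv u₀ (Y p) =
      1 + (p.1 - startTime u₀) * deriv u₀ (Y p) := fun p => by ring
  obtain ⟨h1, h2⟩ := implicit_label (h := fun y => y - startTime u₀ * u₀ y) (k := u₀) (L := Y)
    (contDiff_id.sub (contDiff_const.mul h.smooth)) h.smooth (isOpen_slab T)
    (fun p hp => by linarith [hY.spec p hp])
    (fun p hp y hy => hY.unique h hp (by linarith))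
    (fun p hp => by
      rw [hd, hJ]; exact (hY.jac_pos p.1 hp.1.1 hp.1.2 _).ne')
  refine ⟨h1, fun p hp => ?_⟩
  have := h2 p hp
  rwa [hd, hJ] at this

theorem smooth : ContDiffOn ℝ ∞ Y (slab T) := (hY.label h).1

theorem differentiableAt (hp : p ∈ slab T) : DifferentiableAt ℝ Y p :=
  smooth_differentiableAt (isOpen_slab T) (hY.smooth h) hp

theorem smooth_N : ContDiffOn ℝ ∞ (labelN u₀ Y) (slab T) := by
  have h1 := h.smooth_deriv.comp_contDiffOn (hY.smooth h)
  exact (contDiffOn_const.add ((contDiffOn_fst.sub contDiffOn_const).mul h1)).inv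
    fun p hp => (hY.jac_pos p.1 hp.1.1 hp.1.2 _).ne'

theorem smooth_Z : ContDiffOn ℝ ∞ (labelZ u₀ Y) (slab T) :=
  (contDiffOn_fst.sub contDiffOn_const).mul (hY.smooth_N h)

theorem diff_N (hp : p ∈ slab T) : DifferentiableAt ℝ (labelN u₀ Y) p :=
  smooth_differentiableAt (isOpen_slab T) (hY.smooth_N h) hp

theorem diff_Z (hp : p ∈ slab T) : DifferentiableAt ℝ (labelZ u₀ Y) p :=
  smooth_differentiableAt (isOpen_slab T) (hY.smooth_Z h) hp

omit h in
theorem N_add (hp : p ∈ slab T) : labelN u₀ Y p = 1 - deriv u₀ (Y p) * labelZ u₀ Y p := by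
  have h1 := (hY.jac_pos p.1 hp.1.1 hp.1.2 (Y p)).ne'
  have h2 : labelN u₀ Y p * (1 + (p.1 - startTime u₀) * deriv u₀ (Y p)) = 1 := inv_mul_cancel₀ h1
  unfold labelZ
  linarith

theorem pd_N (hp : p ∈ slab T) (d : Bool) : pd d (labelN u₀ Y) p =
    -(pd d (fun q => q.1) p * deriv u₀ (Y p) + (p.1 - startTime u₀) *
      (deriv (deriv u₀) (Y p) * pd d Y p)) * labelN u₀ Y p ^ 2 := by
  have hYd := hY.differentiableAt h hp
  have hu : DifferentiableAt ℝ (deriv u₀) (Y p) := h.smooth_deriv.differentiable (by simp) _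
  have hc : DifferentiableAt ℝ (fun q => deriv u₀ (Y q)) p := hu.comp p hYd
  have h1 : pd d (labelN u₀ Y) p =
      pd d (fun q => (1 + (-startTime u₀ + q.1) * deriv u₀ (Y q))⁻¹) p := by
    congr 1; funext q; rw [labelN]; ring_nf
  have hne := (hY.jac_pos p.1 hp.1.1 hp.1.2 (Y p)).ne'
  have e : 1 + (-startTime u₀ + p.1) * deriv u₀ (Y p) =
      1 + (p.1 - startTime u₀) * deriv u₀ (Y p) := by ring
  rw [h1, pd_inv (by fun_prop) (by rwa [e]), pd_add (by fun_prop) (by fun_prop), pd_const,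
    pd_mul (by fun_prop) hc, pd_add (by fun_prop) (by fun_prop), pd_const, pd_comp hu hYd, e,
    labelN]
  ring

theorem pd_true_N (hp : p ∈ slab T) : pd true (labelN u₀ Y) p =
    -(labelN u₀ Y p ^ 2 * (labelZ u₀ Y p * deriv (deriv u₀) (Y p))) := by
  rw [hY.pd_N h hp, ((hY.label h).2 p hp).1, pd_fst, labelZ]
  simp only [if_true]; ring

theorem transport_N (hp : p ∈ slab T) :
    pd false (labelN u₀ Y) p + u₀ (Y p) * pd true (labelN u₀ Y) p =
      -(labelN u₀ Y p ^ 2 * deriv u₀ (Y p)) := by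
  rw [hY.pd_N h hp, hY.pd_N h hp, ((hY.label h).2 p hp).1, ((hY.label h).2 p hp).2, pd_fst, pd_fst]
  simp only [if_true, Bool.false_eq_true, if_false]; ring

theorem pd_Z (hp : p ∈ slab T) (d : Bool) : pd d (labelZ u₀ Y) p =
    pd d (fun q => q.1) p * labelN u₀ Y p + (p.1 - startTime u₀) * pd d (labelN u₀ Y) p := by
  have hN := hY.diff_N h hp
  have h1 : pd d (labelZ u₀ Y) p = pd d (fun q => (-startTime u₀ + q.1) * labelN u₀ Y q) p := by
    congr 1; funext q; rw [labelZ]; ring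
  rw [h1, pd_mul (by fun_prop) hN, pd_add (by fun_prop) (by fun_prop), pd_const]
  ring

theorem pd_true_Z (hp : p ∈ slab T) : pd true (labelZ u₀ Y) p =
    -(labelN u₀ Y p * (labelZ u₀ Y p ^ 2 * deriv (deriv u₀) (Y p))) := by
  rw [hY.pd_Z h hp, hY.pd_true_N h hp, pd_fst, labelZ]
  simp only [if_true]; ring

/-- Along the flow the product rule gives `N - N Z u₀'(Y)`, which `N_add` collapses to `N²`. This
makes `Z` the variable of integration along characteristics. -/
theorem transport_Z (hp : p ∈ slab T) :
    pd false (labelZ u₀ Y) p + u₀ (Y p) * pd true (labelZ u₀ Y) p = labelN u₀ Y p ^ 2 := by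
  have h1 := hY.transport_N h hp
  have h2 := hY.N_add hp
  have h3 : labelZ u₀ Y p = (p.1 - startTime u₀) * labelN u₀ Y p := rfl
  rw [hY.pd_Z h hp, hY.pd_Z h hp, pd_fst, pd_fst]
  simp only [if_true, Bool.false_eq_true, if_false]
  rw [h3] at h2
  linear_combination (p.1 - startTime u₀) * h1 - labelN u₀ Y p * h2

omit h in
theorem eq_of_start (hp : p ∈ slab T) (ht : p.1 = startTime u₀) : Y p = p.2 := by
  have := hY.spec p hp
  rw [ht] at this
  linarith

omit h hY in
theorem Z_of_start (ht : p.1 = startTime u₀) : labelZ u₀ Y p = 0 := by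
  rw [labelZ, ht, sub_self, zero_mul]

end IsLabel

/-! ### Comparison of the label with the cubic profile -/

/-- Integrates a bound on the Jacobian from `0` to `y`; the factor `y` treats both signs at once. -/
theorem mul_nonneg_of_deriv_nonneg {G : ℝ → ℝ} (hG : Differentiable ℝ G) (h0 : G 0 = 0) {B : ℝ}
    (hB : 0 ≤ B) (hd : ∀ s, |s| ≤ B → 0 ≤ deriv G s) {y : ℝ} (hy : |y| ≤ B) : 0 ≤ y * G y := by
  have hm : MonotoneOn G (Set.Icc (-B) B) :=
    monotoneOn_of_deriv_nonneg (convex_Icc _ _) hG.continuous.continuousOn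
      hG.differentiableOn fun s hs => by
        rw [interior_Icc] at hs
        exact hd s (abs_le.2 ⟨hs.1.le, hs.2.le⟩)
  have hz : (0 : ℝ) ∈ Set.Icc (-B) B := ⟨by linarith, hB⟩
  have hy' : y ∈ Set.Icc (-B) B := abs_le.1 hy
  rcases le_total 0 y with h | h
  · exact mul_nonneg h (h0 ▸ hm hz hy' h)
  · exact mul_nonneg_of_nonpos_of_nonpos h (h0 ▸ hm hy' hz h)

/-- If `y > A v`, then `a₁ A ≥ a₂` and `b₁ A³ ≥ b₂` make the left side the larger one, term by term.
The constant `A` does not depend on `τ`, which plays the role of `-t`. -/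
theorem le_of_cubic_le {a₁ b₁ a₂ b₂ τ y v : ℝ} (ha₁ : 0 < a₁) (hb₁ : 0 < b₁) (ha₂ : 0 ≤ a₂)
    (hb₂ : 0 ≤ b₂) (hτ : 0 < τ) (hv : 0 ≤ v)
    (h : a₁ * (τ * y) + b₁ * y ^ 3 ≤ a₂ * (τ * v) + b₂ * v ^ 3) :
    y ≤ (1 + a₂ / a₁ + b₂ / b₁) * v := by
  set A := 1 + a₂ / a₁ + b₂ / b₁ with hA
  have h1 : 0 ≤ a₂ / a₁ := by positivity
  have h2 : 0 ≤ b₂ / b₁ := by positivity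
  have hA1 : 1 ≤ A := by linarith
  have hA3 : A ≤ A ^ 3 := le_self_pow₀ hA1 (by norm_num)
  have e1 : a₂ ≤ a₁ * A := by
    calc a₂ = a₁ * (a₂ / a₁) := by field_simp
      _ ≤ a₁ * A := mul_le_mul_of_nonneg_left (by linarith) ha₁.le
  have e2 : b₂ ≤ b₁ * A ^ 3 := by
    calc b₂ = b₁ * (b₂ / b₁) := by field_simp
      _ ≤ b₁ * A ^ 3 := mul_le_mul_of_nonneg_left (by linarith) hb₁.le
  by_contra! hc
  have hAv : 0 ≤ A * v := by positivity
  have f1 : a₂ * (τ * v) < a₁ * (τ * y) := by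
    calc a₂ * (τ * v) ≤ a₁ * A * (τ * v) := mul_le_mul_of_nonneg_right e1 (by positivity)
      _ = a₁ * (τ * (A * v)) := by ring
      _ < _ := by gcongr
  have f2 : b₂ * v ^ 3 ≤ b₁ * y ^ 3 := by
    calc b₂ * v ^ 3 ≤ b₁ * A ^ 3 * v ^ 3 := mul_le_mul_of_nonneg_right e2 (by positivity)
      _ = b₁ * (A * v) ^ 3 := by ring
      _ ≤ _ := by gcongr
  linarith

namespace IsLabel

variable {u₀ : ℝ → ℝ} {T : ℝ} {Y : ℝ × ℝ → ℝ} {p : ℝ × ℝ} (h : IsShockData u₀)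
  (hY : IsLabel u₀ T Y)

include h hY

/-- The Jacobian of the flow is comparable to `|t| + y²`. -/
theorem jac_bounds {B : ℝ} (hB : 0 < B) :
    ∃ c C, 0 < c ∧ 0 < C ∧ ∀ t, T < t → t < 0 → ∀ y, |y| ≤ B →
      c * (-t + y ^ 2) ≤ 1 + (t - startTime u₀) * deriv u₀ y ∧
      1 + (t - startTime u₀) * deriv u₀ y ≤ C * (-t + y ^ 2) := by
  obtain ⟨c₁, C₁, hc₁, hC₁, hq⟩ := h.slope_bounds hB
  have ht₀ := h.startTime_neg
  set t₀ := startTime u₀ with ht₀'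
  have hT := hY.lt_start
  -- One entry per estimate below: `c (-t) ≤ l/2`; the term in `y²` when `l ≤ 1/2`; the same when `l
  -- ≥ 1/2`; and times before `t₀`, where the Jacobian is at least `1/2`.
  set c := min (min (1 / (2 * -t₀)) (c₁ / 2)) (min (1 / (4 * B ^ 2)) (1 / (2 * (-T + B ^ 2))))
  have hTpos : 0 < -T + B ^ 2 := by have := sq_nonneg B; linarith
  have hnt : 0 < -t₀ := by linarith
  have hc0 : 0 < c := by positivity
  refine ⟨c, max (1 / -t₀) C₁, hc0, by positivity, fun t h1 h2 y hy => ?_⟩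
  obtain ⟨hq1, hq2⟩ := hq y hy
  set q := 1 - t₀ * deriv u₀ y with hqdef
  -- The Jacobian is the combination `l + (1 - l) q` of its values at `t = 0`, where it is `q ∼ y²`,
  -- and at `t = t₀`, where it is `1`.
  set l := t / t₀ with hl
  have hlt : l = 1 / -t₀ * -t := by rw [hl]; field_simp
  have hl0 : 0 < l := div_pos_of_neg_of_neg h2 ht₀
  have hJ : 1 + (t - t₀) * deriv u₀ y = l + (1 - l) * q := by
    have h0 := ht₀.ne
    rw [hl, hqdef]; field_simp; ring
  have hy2 : y ^ 2 ≤ B ^ 2 := by rw [← sq_abs]; exact pow_le_pow_left₀ (abs_nonneg y) hy 2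
  have hq0 : 0 ≤ q := (by positivity : 0 ≤ c₁ * y ^ 2).trans hq1
  have hy0 := sq_nonneg y
  constructor
  · rcases le_total t t₀ with h3 | h3
    · refine le_trans ?_ (hY.half_le t h1 h3 y)
      calc c * (-t + y ^ 2) ≤ 1 / (2 * (-T + B ^ 2)) * (-T + B ^ 2) :=
            mul_le_mul ((min_le_right _ _).trans (min_le_right _ _)) (by linarith) (by linarith)
              (by positivity)
        _ = 1 / 2 := by field_simp
    · have hl1 : l ≤ 1 := by rw [hl, div_le_one_of_neg ht₀]; exact h3
      have e1 : c * -t ≤ l / 2 := by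
        calc c * -t ≤ 1 / (2 * -t₀) * -t :=
              mul_le_mul_of_nonneg_right ((min_le_left _ _).trans (min_le_left _ _)) (by linarith)
          _ = l / 2 := by rw [hlt]; field_simp
      rw [hJ, mul_add]
      rcases le_total l (1 / 2) with h4 | h4
      · have e2 : c * y ^ 2 ≤ c₁ / 2 * y ^ 2 :=
          mul_le_mul_of_nonneg_right ((min_le_left _ _).trans (min_le_right _ _)) hy0
        nlinarith
      · have e2 : c * y ^ 2 ≤ 1 / (4 * B ^ 2) * B ^ 2 :=
          mul_le_mul ((min_le_right _ _).trans (min_le_left _ _)) hy2 hy0 (by positivity)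
        have e3 : 1 / (4 * B ^ 2) * B ^ 2 = 1 / 4 := by field_simp
        nlinarith
  · rw [hJ, mul_add]
    have e1 : l ≤ max (1 / -t₀) C₁ * -t := by
      rw [hlt]; exact mul_le_mul_of_nonneg_right (le_max_left _ _) (by linarith)
    have e2 : C₁ * y ^ 2 ≤ max (1 / -t₀) C₁ * y ^ 2 :=
      mul_le_mul_of_nonneg_right (le_max_right _ _) hy0
    nlinarith

theorem exists_bound (X : ℝ) (hX : 0 < X) :
    ∃ B, 0 < B ∧ ∀ p ∈ Set.Ioo T 0 ×ˢ Set.Ioo (-X) X, |Y p| ≤ B := by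
  obtain ⟨B, hB, hB0, -⟩ := h.exists_bounds
  refine ⟨X + |T| * B, by positivity, fun p hp => ?_⟩
  have h1 := hY.spec p ⟨hp.1, trivial⟩
  have h2 : |p.1 - startTime u₀| ≤ |T| := by
    have := h.startTime_neg
    have := hY.lt_start
    have h3 := hp.1.1
    have h4 := hp.1.2
    rw [abs_of_neg (show T < 0 by linarith), abs_le]
    constructor <;> linarith
  have h3 : |(p.1 - startTime u₀) * u₀ (Y p)| ≤ |T| * B := by
    rw [abs_mul]; exact mul_le_mul h2 (hB0 _) (abs_nonneg _) (abs_nonneg _)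
  have h4 : |p.2| ≤ X := abs_le.2 ⟨hp.2.1.le, hp.2.2.le⟩
  have h5 : Y p = p.2 - (p.1 - startTime u₀) * u₀ (Y p) := by linarith
  rw [h5]
  exact (abs_sub _ _).trans (by linarith)

/-- The label and the cubic profile are comparable on a strip, and so are their slopes. -/
theorem comparable {X : ℝ} (hX : 0 < X) : ∃ A c, 0 < A ∧ 0 < c ∧
    ∀ p ∈ Set.Ioo T 0 ×ˢ Set.Ioo (-X) X, |Y p| ≤ A * |cu (beta u₀) p| ∧
      c * (-p.1 + 3 * beta u₀ * cu (beta u₀) p ^ 2) ≤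
        1 + (p.1 - startTime u₀) * deriv u₀ (Y p) := by
  have hβ := h.beta_pos
  set β := beta u₀
  obtain ⟨B, hB, hYB⟩ := hY.exists_bound h X hX
  obtain ⟨c, C, hc, hC, hJ⟩ := hY.jac_bounds h hB
  -- The constants of `le_of_cubic_le` for comparing `|x| = -t|𝔲| + β|𝔲|³` with the integrated
  -- bounds `c (-t|y| + |y|³/3) ≤ |x| ≤ C (-t|y| + |y|³/3)`.
  set A₁ := 1 + 1 / c + β / (c / 3)
  set A₂ := 1 + C / 1 + (C / 3) / β
  have hA₁ : 0 < A₁ := by positivity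
  have hA₂ : 0 < A₂ := by positivity
  refine ⟨A₁, c / (1 + 3 * β * A₂ ^ 2), hA₁, by positivity, fun p hp => ?_⟩
  have ht : p.1 < 0 := hp.1.2
  have hp' : p ∈ past := ht
  have hx := abs_eq_cubic hβ hp'
  have hy := hYB p hp
  have hs := hY.spec p ⟨hp.1, trivial⟩
  set y := Y p
  set F : ℝ → ℝ := fun y => y + (p.1 - startTime u₀) * u₀ y with hF
  have hFd := flow_deriv h (p.1 - startTime u₀)
  have hE : ∀ k s : ℝ, HasDerivAt (fun s : ℝ => k * (-p.1 * s + s ^ 3 / 3)) (k * (-p.1 + s ^ 2)) s :=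
    fun k s => by
      have e : HasDerivAt (fun s : ℝ => k * (-p.1 * s + s ^ 3 / 3))
          (k * (-p.1 * 1 + (3 : ℕ) * s ^ (3 - 1) / 3)) s :=
        (((hasDerivAt_id s).const_mul (-p.1)).add ((hasDerivAt_pow 3 s).div_const 3)).const_mul k
      refine e.congr_deriv ?_
      push_cast
      ring
  have low : 0 ≤ y * (F y - c * (-p.1 * y + y ^ 3 / 3)) := by
    refine mul_nonneg_of_deriv_nonneg (G := fun y => F y - c * (-p.1 * y + y ^ 3 / 3))
      (fun s => ((hFd s).sub (hE c s)).differentiableAt) (by simp [hF, h.value_zero]) hB.le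
      (fun s hs => ?_) hy
    have e : HasDerivAt (fun y => F y - c * (-p.1 * y + y ^ 3 / 3)) _ s := (hFd s).sub (hE c s)
    rw [e.deriv]
    linarith [(hJ p.1 hp.1.1 ht s hs).1]
  have upp : 0 ≤ y * (C * (-p.1 * y + y ^ 3 / 3) - F y) := by
    refine mul_nonneg_of_deriv_nonneg (G := fun y => C * (-p.1 * y + y ^ 3 / 3) - F y)
      (fun s => ((hE C s).sub (hFd s)).differentiableAt) (by simp [hF, h.value_zero]) hB.le
      (fun s hs => ?_) hy
    have e : HasDerivAt (fun y => C * (-p.1 * y + y ^ 3 / 3) - F y) _ s := (hE C s).sub (hFd s)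
    rw [e.deriv]
    linarith [(hJ p.1 hp.1.1 ht s hs).2]
  rw [show F y = p.2 from hs, mul_sub] at low upp
  have hyE : y * (-p.1 * y + y ^ 3 / 3) = |y| * (-p.1 * |y| + |y| ^ 3 / 3) := by
    have e2 : |y| ^ 2 = y ^ 2 := sq_abs y
    calc y * (-p.1 * y + y ^ 3 / 3) = -p.1 * y ^ 2 + (y ^ 2) ^ 2 / 3 := by ring
      _ = _ := by rw [← e2]; ring
  have hE0 : 0 ≤ |y| * (-p.1 * |y| + |y| ^ 3 / 3) := by
    have : 0 ≤ -p.1 := by linarith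
    positivity
  have hyx : y * p.2 = |y| * |p.2| := by
    rw [← abs_mul, abs_of_nonneg]
    have e := mul_nonneg hc.le hE0
    rw [← hyE, mul_left_comm] at e
    linarith
  have low' : |y| * (c * (-p.1 * |y| + |y| ^ 3 / 3)) ≤ |y| * |p.2| := by
    rw [← hyx, mul_left_comm, ← hyE, mul_left_comm]; linarith
  have upp' : |y| * |p.2| ≤ |y| * (C * (-p.1 * |y| + |y| ^ 3 / 3)) := by
    rw [← hyx, mul_left_comm, ← hyE, mul_left_comm]; linarith
  have hvY : |y| ≤ A₁ * |cu β p| ∧ |cu β p| ≤ A₂ * |y| := by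
    rcases eq_or_ne y 0 with hy0 | hy0
    · have hp2 : p.2 = 0 := by rw [← hs, hy0, h.value_zero]; ring
      have hv : cu β p = 0 := (cu_unique hβ hp' (by rw [hp2]; ring)).symm
      simp [hy0, hv]
    · have hypos : 0 < |y| := abs_pos.2 hy0
      have l1 := le_of_mul_le_mul_left low' hypos
      have u1 := le_of_mul_le_mul_left upp' hypos
      rw [hx] at l1 u1
      constructor
      · refine le_of_cubic_le hc (by positivity : 0 < c / 3) zero_le_one hβ.le
          (show 0 < -p.1 by linarith) (abs_nonneg _) ?_
        linarith
      · refine le_of_cubic_le zero_lt_one hβ hC.le (by positivity : 0 ≤ C / 3)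
          (show 0 < -p.1 by linarith) (abs_nonneg _) ?_
        linarith
  refine ⟨hvY.1, le_trans ?_ (hJ p.1 hp.1.1 ht y hy).1⟩
  have hv2 : cu β p ^ 2 ≤ A₂ ^ 2 * y ^ 2 := by
    rw [← sq_abs, ← sq_abs y, ← mul_pow]
    exact pow_le_pow_left₀ (abs_nonneg _) hvY.2 2
  suffices hle : -p.1 + 3 * β * cu β p ^ 2 ≤ (1 + 3 * β * A₂ ^ 2) * (-p.1 + y ^ 2) by
    calc _ ≤ c / (1 + 3 * β * A₂ ^ 2) * ((1 + 3 * β * A₂ ^ 2) * (-p.1 + y ^ 2)) :=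
          mul_le_mul_of_nonneg_left hle (by positivity)
      _ = _ := by field_simp
  have h3 : 3 * β * cu β p ^ 2 ≤ 3 * β * (A₂ ^ 2 * y ^ 2) :=
    mul_le_mul_of_nonneg_left hv2 (by positivity)
  have h4 : 0 ≤ 3 * β * A₂ ^ 2 * -p.1 := by
    have : 0 ≤ -p.1 := by linarith
    positivity
  nlinarith [sq_nonneg y]

omit h in
theorem T_neg (h : IsShockData u₀) : T < 0 := hY.lt_start.trans h.startTime_neg

/-- The label is a symbol of the same class as the cubic profile. -/
theorem bd_label {X : ℝ} (hX : 0 < X) (K : ℕ) :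
    (stripWeight (beta u₀) T X h.beta_pos).Bd K 1 0 Y ∧
      (stripWeight (beta u₀) T X h.beta_pos).Bd K 0 1 (labelN u₀ Y) := by
  have hw := stripWeight_isCubic h.beta_pos (hY.T_neg h) hX
  obtain ⟨A, c, hA, hc, hcomp⟩ := hY.comparable h hX
  set w := stripWeight (beta u₀) T X h.beta_pos with hwdef
  have hslab : ∀ p ∈ w.dom, p ∈ slab T := fun p hp => ⟨hp.1, trivial⟩
  obtain ⟨κ, hκ, hσ⟩ := hw.σ_sq
  have hY0 : w.Bd0 1 0 Y := by
    obtain ⟨C, -, hC⟩ := (hw.bd_cu 0).bd0.exists_nonneg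
    refine ⟨(hY.smooth h).mono hslab, A * C, fun p hp => (hcomp p hp).1.trans ?_⟩
    rw [mul_assoc]
    exact mul_le_mul_of_nonneg_left (hC p hp) hA.le
  -- In `1/N = (1 - t₀ u₀'(Y)) + t u₀'(Y)` the bracket vanishes to second order in `Y`, hence has
  -- the size of `𝔲²`, which is dominated by `1/𝔪`.
  have hN : ∀ K, w.Bd K 1 0 Y → w.Bd K 0 1 (labelN u₀ Y) := by
    intro K hK
    have h1 : w.Bd K 0 (-1) fun p => (1 - startTime u₀ * deriv u₀ (Y p)) + p.1 * deriv u₀ (Y p) :=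
      ((hK.comp h.van_deriv).weaken (by norm_num) (by norm_num)).add
        (((hw.bd_time K).mul (hK.comp (Van.of_nonpos h.smooth_deriv le_rfl))).weaken
          (by norm_num) (by norm_num))
    refine (h1.inv (mul_pos hc hκ) fun p hp => ?_).congr fun p hp => ?_
    · have h2 := (hcomp p hp).2
      rw [← hσ p (hw.sub hp)] at h2
      linarith
    · simp only [labelN]; ring_nf
  have hall : ∀ K, w.Bd K 1 0 Y := by
    intro K
    induction K with
    | zero => exact hY0
    | succ K ih =>
      refine ⟨hY0, fun d => ?_⟩
      cases d with
      | true =>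
        exact ((hN K ih).weaken (by simp [sh]) (by simp [sh])).congr fun p hp =>
          (((hY.label h).2 p (hslab p hp)).1).symm
      | false =>
        exact (((ih.comp h.van_one).neg.mul (hN K ih)).weaken (by simp [sh]) (by simp [sh])).congr
          fun p hp => (((hY.label h).2 p (hslab p hp)).2).symm
  exact ⟨hall K, hN K (hall K)⟩

/-- The equation of the difference of the inviscid solution and the cubic profile. -/
theorem diff_cubic (hp : p ∈ slab T) : (u₀ (Y p) - cu (beta u₀) p) *
    (-p.1 + beta u₀ * (u₀ (Y p) ^ 2 + u₀ (Y p) * cu (beta u₀) p + cu (beta u₀) p ^ 2)) =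
      Y p - startTime u₀ * u₀ (Y p) + beta u₀ * u₀ (Y p) ^ 3 := by
  have h1 := hY.spec p hp
  have h2 := cu_spec h.beta_pos (show p ∈ past from hp.1.2)
  linear_combination h2 - h1

/-- The identity `diff_cubic` is divided by its second factor, which is comparable to `1/𝔪`. The
right side is a function of `Y` vanishing to fourth order. -/
theorem bd_diff {X : ℝ} (hX : 0 < X) (K : ℕ) :
    (stripWeight (beta u₀) T X h.beta_pos).Bd K 4 1 fun p => u₀ (Y p) - cu (beta u₀) p := by
  have hw := stripWeight_isCubic h.beta_pos (hY.T_neg h) hX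
  have hYb := (hY.bd_label h hX K).1
  set w := stripWeight (beta u₀) T X h.beta_pos with hwdef
  have hβ := h.beta_pos
  set β := beta u₀
  obtain ⟨κ, hκ, hσ⟩ := hw.σ_sq
  have hU : w.Bd K 1 0 fun p => u₀ (Y p) := hYb.comp h.van_one
  have hv := hw.bd_cu K
  have hden : w.Bd K 0 (-1)
      fun p => -p.1 + β * (u₀ (Y p) ^ 2 + u₀ (Y p) * cu β p + cu β p ^ 2) := by
    have h1 : w.Bd K 2 0 fun p => u₀ (Y p) ^ 2 + u₀ (Y p) * cu β p + cu β p ^ 2 :=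
      ((hU.pow 2).add (hU.mul hv)).add (hv.pow 2)
    exact (hw.bd_time K).neg.add ((h1.const_mul β).weaken (by norm_num) (by norm_num))
  -- `U² + U𝔲 + 𝔲² = (U + 𝔲/2)² + (3/4)𝔲²`, so a quarter of `-t + 3β𝔲²` is a lower bound.
  have hlow : ∀ p ∈ w.dom, (1 / 4 * κ) * w.σ p ^ (-2 : ℤ) ≤
      -p.1 + β * (u₀ (Y p) ^ 2 + u₀ (Y p) * cu β p + cu β p ^ 2) := by
    intro p hp
    rw [mul_assoc, hσ p (hw.sub hp)]
    have h1 : p.1 < 0 := hw.sub hp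
    have h2 : 0 ≤ β * (u₀ (Y p) + cu β p / 2) ^ 2 := by positivity
    linarith
  have hinv := hden.inv (by positivity) hlow
  refine ((hinv.mul (hYb.comp h.van_cubic)).weaken (by norm_num) (by norm_num)).congr fun p hp => ?_
  have hpos : 0 < -p.1 + β * (u₀ (Y p) ^ 2 + u₀ (Y p) * cu β p + cu β p ^ 2) :=
    (mul_pos (by positivity) (zpow_pos (hw.σ_pos p (hw.sub hp)) _)).trans_le (hlow p hp)
  have := hY.diff_cubic h (p := p) ⟨hp.1, trivial⟩
  simp only
  rw [inv_mul_eq_iff_eq_mul₀ hpos.ne']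
  exact this.symm.trans (mul_comm _ _)

/-- The inviscid solution and the label expand in homogeneous components. -/
theorem expands {X : ℝ} (hX : 0 < X) (N : ℕ) :
    Expands (beta u₀) (stripWeight (beta u₀) T X h.beta_pos) N 4 1
        (fun p => u₀ (Y p) - cu (beta u₀) p) ∧
      Expands (beta u₀) (stripWeight (beta u₀) T X h.beta_pos) (N + 1) 1 0 Y := by
  have hw := stripWeight_isCubic h.beta_pos (hY.T_neg h) hX
  have hD := hY.bd_diff h hX
  have hYb := fun K => (hY.bd_label h hX K).1
  set w := stripWeight (beta u₀) T X h.beta_pos with hwdef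
  have hβ := h.beta_pos
  set β := beta u₀
  have hcu : ∀ M, Expands β w M 1 0 (cu β) := fun M =>
    .of_inP hw ((InP.mono 1 1 0 (by norm_num) le_rfl).congr fun p _ => by simp)
  have hcm : ∀ M, Expands β w M 0 1 (cm β) := fun M =>
    .of_inP hw ((InP.mono 1 0 1 (by norm_num) (by norm_num)).congr fun p _ => by simp)
  -- Class `(4, 1)` lies in `(2, 0)`, one above the class `(1, 0)` of `𝔲`: this is the gained term.
  have step1 : ∀ M, Expands β w M 4 1 (fun p => u₀ (Y p) - cu β p) →
      Expands β w (M + 1) 1 0 fun p => u₀ (Y p) := by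
    intro M hM
    have h1 : Expands β w M 2 0 fun p => u₀ (Y p) - cu β p := hM.weaken (by norm_num) (by norm_num)
    exact ((Expands.shift (a := 1) h1).add (hcu (M + 1))).congr fun p _ => by ring
  -- `Y = t₀ U + (Y - t₀ U)`, and the bracket is a function of `Y` vanishing to third order, so it
  -- too gains a term.
  have step2 : ∀ M, Expands β w M 1 0 Y → Expands β w (M + 1) 1 0 (fun p => u₀ (Y p)) →
      Expands β w (M + 1) 1 0 Y := by
    intro M hM hU
    have h1 := ((hM.comp hw h.van_label).lower (a := 2) hw (by norm_num)).shift (a := 1)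
    exact (h1.add (hU.const_mul (startTime u₀))).congr fun p _ => by ring
  induction N with
  | zero =>
    have hD0 : Expands β w 0 4 1 fun p => u₀ (Y p) - cu β p := .of_bd fun K => by simpa using hD K
    have hY0 : Expands β w 0 1 0 Y := .of_bd fun K => by simpa using hYb K
    exact ⟨hD0, step2 0 hY0 (step1 0 hD0)⟩
  | succ N ih =>
    obtain ⟨hDN, hYN⟩ := ih
    have hUN := step1 N hDN
    have hH := hYN.comp hw h.van_cubic
    -- The quadratic term has class `(9, 2)`, contained in `(5, 0)`; its `N` known terms therefore
    -- suffice for `N + 1` terms in class `(4, 0)`.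
    have hD2 : Expands β w (N + 1) 4 0 fun p => β * ((u₀ (Y p) - cu β p) ^ 2 *
        (u₀ (Y p) + 2 * cu β p)) := by
      have h1 := (hUN.trunc hw (Nat.le_succ N)).add ((hcu N).const_mul 2)
      have h2 : Expands β w N 9 2 fun p => (u₀ (Y p) - cu β p) * (u₀ (Y p) - cu β p) *
          (u₀ (Y p) + 2 * cu β p) := (hDN.mul hDN hw).mul h1 hw
      have h3 : Expands β w N 5 0 _ := h2.weaken (by norm_num) (by norm_num)
      exact ((h3.shift (a := 4)).const_mul β).congr fun p _ => by ring
    have hD' : Expands β w (N + 1) 4 1 fun p => u₀ (Y p) - cu β p := by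
      refine ((hcm (N + 1)).mul (hH.add (hD2.const_mul (-1))) hw).congr fun p hp => ?_
      have h1 := hY.diff_cubic h (p := p) ⟨hp.1, trivial⟩
      have h2 := cm_mul hβ (hw.sub hp)
      simp only
      linear_combination (u₀ (Y p) - cu β p) * h2 - cm β p * h1
    exact ⟨hD', step2 (N + 1) hYN (step1 (N + 1) hD')⟩

end IsLabel

/-! ### Polynomials in the elapsed time along the flow -/

/-- Linear combinations of functions `g(Y) Zⁱ` with `g` smooth and vanishing to order `n + 2 i`. -/
inductive InR (u₀ : ℝ → ℝ) (Y : ℝ × ℝ → ℝ) (n : ℤ) : (ℝ × ℝ → ℝ) → Prop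
  | mono (i : ℕ) (g : ℝ → ℝ) (hg : Van (n + 2 * i) g) :
      InR u₀ Y n fun p => g (Y p) * labelZ u₀ Y p ^ i
  | add {f g : ℝ × ℝ → ℝ} (hf : InR u₀ Y n f) (hg : InR u₀ Y n g) : InR u₀ Y n fun p => f p + g p

/-- Functions on the slab of the form `Nᵇ q`, with `q` in `InR u₀ Y n`. -/
def InNR (u₀ : ℝ → ℝ) (T : ℝ) (Y : ℝ × ℝ → ℝ) (b : ℕ) (n : ℤ) (f : ℝ × ℝ → ℝ) : Prop :=
  ∃ q, InR u₀ Y n q ∧ ∀ p ∈ slab T, f p = labelN u₀ Y p ^ b * q p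

section

variable {u₀ : ℝ → ℝ} {T : ℝ} {Y : ℝ × ℝ → ℝ} {n m : ℤ} {f g : ℝ × ℝ → ℝ}

theorem InR.comp {φ : ℝ → ℝ} (hφ : Van n φ) : InR u₀ Y n fun p => φ (Y p) := by
  have := InR.mono (u₀ := u₀) (Y := Y) (n := n) 0 φ (by simpa using hφ)
  simpa using this

theorem InR.zero : InR u₀ Y n fun _ => 0 :=
  InR.comp (φ := fun _ => 0) ⟨contDiff_const, fun i _ => by simp⟩

theorem InR.const_mul (c : ℝ) (hf : InR u₀ Y n f) : InR u₀ Y n fun p => c * f p := by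
  induction hf with
  | mono i g hg =>
    have := InR.mono (u₀ := u₀) (Y := Y) i _ (hg.const_mul c)
    simpa only [mul_assoc] using this
  | add hf hg ihf ihg => simpa only [mul_add] using ihf.add ihg

theorem InR.weaken (hf : InR u₀ Y m f) (hnm : n ≤ m) : InR u₀ Y n f := by
  induction hf with
  | mono i g hg => exact .mono i g (hg.weaken (by omega))
  | add hf hg ihf ihg => exact ihf.add ihg

theorem InR.mul (hf : InR u₀ Y n f) (hg : InR u₀ Y m g) : InR u₀ Y (n + m) fun p => f p * g p := by
  induction hf with
  | mono i φ hφ =>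
    induction hg with
    | mono j ψ hψ =>
      have := InR.mono (u₀ := u₀) (Y := Y) (n := n + m) (i + j) _
        ((hφ.mul hψ).weaken (by push_cast; omega))
      convert this using 2 with p
      ring
    | add hf hg ihf ihg => simpa only [mul_add] using ihf.add ihg
  | add hf hg ihf ihg => simpa only [add_mul] using ihf.add ihg

section
variable (h : IsShockData u₀) (hY : IsLabel u₀ T Y)
include h hY

theorem InR.smooth (hf : InR u₀ Y n f) : ContDiffOn ℝ ∞ f (slab T) := by
  induction hf with
  | mono i g hg => exact (hg.1.comp_contDiffOn (hY.smooth h)).mul ((hY.smooth_Z h).pow i)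
  | add hf hg ihf ihg => exact ihf.add ihg

theorem InR.differentiableAt (hf : InR u₀ Y n f) {p : ℝ × ℝ} (hp : p ∈ slab T) :
    DifferentiableAt ℝ f p :=
  smooth_differentiableAt (isOpen_slab T) (hf.smooth h hY) hp

omit hY in
theorem InR.van_second : Van 1 (deriv (deriv u₀)) := by
  refine ⟨(contDiff_infty_iff_deriv.1 h.smooth_deriv).2, fun i hi => ?_⟩
  obtain rfl : i = 0 := by omega
  simpa using h.second_deriv_zero

/-- Differentiating `Zⁱ` produces `-i N Zⁱ⁺¹ u₀''(Y)`. The additional power of `Z` requires two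
orders, of which `u₀''` supplies one; the other is the loss from `n` to `n - 1`. -/
theorem InR.pd (hf : InR u₀ Y n f) :
    ∃ G, InR u₀ Y (n - 1) G ∧ ∀ p ∈ slab T, pd true f p = labelN u₀ Y p * G p := by
  induction hf with
  | mono i g hg =>
    refine ⟨_, (InR.mono i (deriv g) (hg.deriv.weaken (by omega))).add
      (InR.mono (i + 1) (fun y => -(i : ℝ) * (g y * deriv (deriv u₀) y))
        (((hg.mul (InR.van_second h)).const_mul _).weaken (by push_cast; omega))), fun p hp => ?_⟩
    have dY := hY.differentiableAt h hp
    have dZ := hY.diff_Z h hp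
    have dg : DifferentiableAt ℝ g (Y p) := hg.differentiable _
    have dgY : DifferentiableAt ℝ (fun q => g (Y q)) p := dg.comp p dY
    have dZi : DifferentiableAt ℝ (fun q => labelZ u₀ Y q ^ i) p := dZ.pow i
    rw [pd_mul dgY dZi, pd_comp dg dY, pd_pow i dZ, hY.pd_true_Z h hp, ((hY.label h).2 p hp).1]
    have e : (i : ℝ) * labelZ u₀ Y p ^ (i - 1) * labelZ u₀ Y p ^ 2 =
        i * labelZ u₀ Y p ^ (i + 1) := by
      rcases i with _ | i
      · simp
      · rw [Nat.add_sub_cancel]; ring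
    linear_combination (-g (Y p) * labelN u₀ Y p * deriv (deriv u₀) (Y p)) * e
  | add hf hg ihf ihg =>
    obtain ⟨F, hF, hF'⟩ := ihf
    obtain ⟨G, hG, hG'⟩ := ihg
    refine ⟨_, hF.add hG, fun p hp => ?_⟩
    rw [pd_add (hf.differentiableAt h hY hp) (hg.differentiableAt h hY hp), hF' p hp, hG' p hp]
    ring

/-- Primitives along the flow that vanish at the initial time. -/
theorem InR.primitive (hf : InR u₀ Y n f) : ∃ G, InR u₀ Y (n - 2) G ∧
    (∀ p ∈ slab T, p.1 = startTime u₀ → G p = 0) ∧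
    ∀ p ∈ slab T, BurgersOuter.pd false G p + u₀ (Y p) * BurgersOuter.pd true G p =
      labelN u₀ Y p ^ 2 * f p := by
  induction hf with
  | mono i g hg =>
    -- Along the flow `Y` is constant and `Z` has derivative `N²`, so `Zⁱ` integrates to `Zⁱ⁺¹ / (i
    -- + 1)`, which vanishes at `t₀`.
    refine ⟨_, InR.mono (i + 1) (fun y => ((i : ℝ) + 1)⁻¹ * g y)
      ((hg.const_mul _).weaken (by push_cast; omega)),
      fun p _ ht => by simp [IsLabel.Z_of_start ht], fun p hp => ?_⟩
    have dY := hY.differentiableAt h hp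
    have dZ := hY.diff_Z h hp
    have dg : DifferentiableAt ℝ (fun y => ((i : ℝ) + 1)⁻¹ * g y) (Y p) :=
      (hg.differentiable _).const_mul _
    have dgY : DifferentiableAt ℝ (fun q => ((i : ℝ) + 1)⁻¹ * g (Y q)) p :=
      ((hg.differentiable _).comp p dY).const_mul _
    have dZi : DifferentiableAt ℝ (fun q => labelZ u₀ Y q ^ (i + 1)) p := dZ.pow _
    have hdg : deriv (fun y => ((i : ℝ) + 1)⁻¹ * g y) (Y p) = ((i : ℝ) + 1)⁻¹ * deriv g (Y p) :=
      deriv_const_mul _ (hg.differentiable _)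
    rw [pd_mul dgY dZi, pd_mul dgY dZi, pd_comp dg dY, pd_comp dg dY, hdg, pd_pow _ dZ,
      pd_pow _ dZ, ((hY.label h).2 p hp).1, ((hY.label h).2 p hp).2, Nat.add_sub_cancel]
    have e := hY.transport_Z h hp
    have hi : ((i : ℝ) + 1)⁻¹ * (i + 1) = 1 := inv_mul_cancel₀ (by positivity)
    push_cast
    linear_combination (((i : ℝ) + 1)⁻¹ * g (Y p) * (i + 1) * labelZ u₀ Y p ^ i) * e +
      g (Y p) * labelZ u₀ Y p ^ i * labelN u₀ Y p ^ 2 * hi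
  | add hf hg ihf ihg =>
    obtain ⟨F, hF, hF0, hF'⟩ := ihf
    obtain ⟨G, hG, hG0, hG'⟩ := ihg
    refine ⟨_, hF.add hG, fun p hp ht => by simp [hF0 p hp ht, hG0 p hp ht], fun p hp => ?_⟩
    have dF := hF.differentiableAt h hY hp
    have dG := hG.differentiableAt h hY hp
    rw [pd_add dF dG, pd_add dF dG]
    linear_combination hF' p hp + hG' p hp

omit h hY in
theorem InNR.add {b : ℕ} (hf : InNR u₀ T Y b n f) (hg : InNR u₀ T Y b n g) :
    InNR u₀ T Y b n fun p => f p + g p := by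
  obtain ⟨F, hF, hF'⟩ := hf
  obtain ⟨G, hG, hG'⟩ := hg
  exact ⟨_, hF.add hG, fun p hp => by simp only [hF' p hp, hG' p hp]; ring⟩

omit h hY in
theorem InNR.const_mul {b : ℕ} (c : ℝ) (hf : InNR u₀ T Y b n f) :
    InNR u₀ T Y b n fun p => c * f p := by
  obtain ⟨F, hF, hF'⟩ := hf
  exact ⟨_, hF.const_mul c, fun p hp => by simp only [hF' p hp]; ring⟩

omit h hY in
theorem InNR.sum {ι : Type*} {b : ℕ} (s : Finset ι) {F : ι → ℝ × ℝ → ℝ}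
    (hF : ∀ i ∈ s, InNR u₀ T Y b n (F i)) : InNR u₀ T Y b n fun p => ∑ i ∈ s, F i p := by
  classical
  induction s using Finset.induction_on with
  | empty => exact ⟨_, .zero, fun p _ => by simp⟩
  | insert i s hi ih =>
    simp only [Finset.sum_insert hi]
    exact (hF i (by simp)).add (ih fun j hj => hF j (by simp [hj]))

omit h hY in
theorem InNR.mul {b c : ℕ} (hf : InNR u₀ T Y b n f) (hg : InNR u₀ T Y c m g) :
    InNR u₀ T Y (b + c) (n + m) fun p => f p * g p := by
  obtain ⟨F, hF, hF'⟩ := hf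
  obtain ⟨G, hG, hG'⟩ := hg
  exact ⟨_, hF.mul hG, fun p hp => by simp only [hF' p hp, hG' p hp]; ring⟩

theorem InNR.smooth {b : ℕ} (hf : InNR u₀ T Y b n f) : ContDiffOn ℝ ∞ f (slab T) := by
  obtain ⟨F, hF, hF'⟩ := hf
  exact (((hY.smooth_N h).pow b).mul (hF.smooth h hY)).congr hF'

theorem InNR.pd {b : ℕ} (hf : InNR u₀ T Y b n f) :
    InNR u₀ T Y (b + 1) (n - 1) (pd true f) := by
  obtain ⟨F, hF, hF'⟩ := hf
  obtain ⟨G, hG, hG'⟩ := hF.pd h hY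
  have h1 : InR u₀ Y (-1) fun p => -(b : ℝ) * deriv (deriv u₀) (Y p) * labelZ u₀ Y p ^ 1 :=
    InR.mono 1 (fun y => -(b : ℝ) * deriv (deriv u₀) y)
      (((InR.van_second h).const_mul _).weaken (by norm_num))
  refine ⟨_, hG.add ((h1.mul hF).weaken (n := n - 1) (by omega)), fun p hp => ?_⟩
  have dF := hF.differentiableAt h hY hp
  have dN := hY.diff_N h hp
  have dNb : DifferentiableAt ℝ (fun q => labelN u₀ Y q ^ b) p := dN.pow b
  rw [pd_congr (isOpen_slab T) (g := fun p => labelN u₀ Y p ^ b * F p) hF' true hp,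
    pd_mul dNb dF, pd_pow b dN, hY.pd_true_N h hp, hG' p hp]
  have e : (b : ℝ) * labelN u₀ Y p ^ (b - 1) * labelN u₀ Y p ^ 2 =
      b * labelN u₀ Y p ^ (b + 1) := by
    rcases b with _ | b
    · simp
    · rw [Nat.add_sub_cancel]; ring
  linear_combination (-labelZ u₀ Y p * deriv (deriv u₀) (Y p) * F p) * e

theorem pd_inviscid {p : ℝ × ℝ} (hp : p ∈ slab T) :
    BurgersOuter.pd true (fun p => u₀ (Y p)) p = deriv u₀ (Y p) * labelN u₀ Y p ∧
    BurgersOuter.pd false (fun p => u₀ (Y p)) p = -(u₀ (Y p) * (deriv u₀ (Y p) * labelN u₀ Y p)) := by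
  have dY := hY.differentiableAt h hp
  rw [pd_comp (h.differentiable _) dY, pd_comp (h.differentiable _) dY, ((hY.label h).2 p hp).1,
    ((hY.label h).2 p hp).2]
  exact ⟨rfl, by ring⟩

/-- The second derivative is `N² u₀''(Y) (1 - u₀'(Y) Z)`, and the bracket is `N`. This source of the
first corrector fits the general pattern `N³` with order `-4k + 1`. -/
theorem pd_pd_inviscid :
    InNR u₀ T Y 3 1 (BurgersOuter.pd true (BurgersOuter.pd true fun p => u₀ (Y p))) := by
  refine ⟨_, InR.comp (InR.van_second h), fun p hp => ?_⟩
  have dY := hY.differentiableAt h hp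
  have dN := hY.diff_N h hp
  have du : DifferentiableAt ℝ (deriv u₀) (Y p) := h.smooth_deriv.differentiable (by simp) _
  have duY : DifferentiableAt ℝ (fun q => deriv u₀ (Y q)) p := du.comp p dY
  rw [pd_congr (isOpen_slab T) (g := fun p => deriv u₀ (Y p) * labelN u₀ Y p)
    (fun q hq => (pd_inviscid h hY hq).1) true hp, pd_mul duY dN, pd_comp du dY,
    ((hY.label h).2 p hp).1, hY.pd_true_N h hp]
  have e := hY.N_add hp
  linear_combination (-labelN u₀ Y p ^ 2 * deriv (deriv u₀) (Y p)) * e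

/-! ### The outer expansion -/

omit h hY in
/-- The source term of the transport equation of the `(k + 1)`-th outer term. -/
noncomputable def outerSource (us : ℕ → ℝ × ℝ → ℝ) (k : ℕ) (p : ℝ × ℝ) : ℝ :=
  -∑ j ∈ Finset.Icc 1 k, us j p * BurgersOuter.pd true (us (k + 1 - j)) p +
    BurgersOuter.pd true (BurgersOuter.pd true (us k)) p

omit h hY in
-- Recursive choice where the condition on the `k`-th entry involves the earlier ones; `hcongr` says
-- that it ignores the later ones.
theorem exists_seq_of_step {α : Type*} [Inhabited α] {Q : ℕ → (ℕ → α) → Prop}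
    (hcongr : ∀ k u v, (∀ j ≤ k, u j = v j) → Q k u → Q k v)
    (step : ∀ k u, (∀ j < k, Q j u) → ∃ a, Q k (Function.update u k a)) :
    ∃ u, ∀ k, Q k u := by
  have hex : ∀ k (u : ℕ → α), ∃ a, (∀ j < k, Q j u) → Q k (Function.update u k a) := by
    intro k u
    by_cases hu : ∀ j < k, Q j u
    · obtain ⟨a, ha⟩ := step k u hu
      exact ⟨a, fun _ => ha⟩
    · exact ⟨default, fun h => absurd h hu⟩
  choose a ha using hex
  let s : ℕ → ℕ → α := fun k => Nat.rec (fun _ => default) (fun k u => Function.update u k (a k u)) k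
  have hs : ∀ k, s (k + 1) = Function.update (s k) k (a k (s k)) := fun k => rfl
  have hst : ∀ k i j, j < k → s (k + i) j = s k j := by
    intro k i j hj
    induction i with
    | zero => rfl
    | succ i ih => rw [← add_assoc, hs, Function.update_of_ne (by omega), ih]
  have hQ : ∀ k, ∀ j < k, Q j (s k) := by
    intro k
    induction k with
    | zero => intro j hj; omega
    | succ k ih =>
      intro j hj
      rcases Nat.lt_succ_iff_lt_or_eq.1 hj with hj | rfl
      · exact hcongr j _ _ (fun i hi => (hst k 1 i (by omega)).symm) (ih j hj)
      · rw [hs]; exact ha j _ ih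
  refine ⟨fun k => s (k + 1) k, fun k => hcongr k _ _ (fun j hj => ?_) (hQ (k + 1) k (by omega))⟩
  obtain ⟨i, rfl⟩ : ∃ i, k = j + i := ⟨k - j, by omega⟩
  rw [show j + i + 1 = j + 1 + i by ring]
  exact hst (j + 1) i j (by omega)

/-- An explicit solution of the equations of the outer expansion. -/
theorem exists_outer : ∃ us : ℕ → ℝ × ℝ → ℝ, us 0 = (fun p => u₀ (Y p)) ∧ ∀ k : ℕ,
    InNR u₀ T Y 1 (-4 * ((k : ℤ) + 1) + 3) (us (k + 1)) ∧
    (∀ p ∈ slab T, p.1 = startTime u₀ → us (k + 1) p = 0) ∧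
    ∀ p ∈ slab T, BurgersOuter.pd false (us (k + 1)) p =
      -(BurgersOuter.pd true (fun p => us 0 p * us (k + 1) p) p) + outerSource us k p := by
  let Q : ℕ → (ℕ → ℝ × ℝ → ℝ) → Prop := fun k us => match k with
    | 0 => us 0 = (fun p => u₀ (Y p))
    | k + 1 => InNR u₀ T Y 1 (-4 * ((k : ℤ) + 1) + 3) (us (k + 1)) ∧
      (∀ p ∈ slab T, p.1 = startTime u₀ → us (k + 1) p = 0) ∧
      ∀ p ∈ slab T, BurgersOuter.pd false (us (k + 1)) p =
        -(BurgersOuter.pd true (fun p => us 0 p * us (k + 1) p) p) + outerSource us k p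
  suffices hus : ∃ us, ∀ k, Q k us from
    let ⟨us, hus⟩ := hus; ⟨us, hus 0, fun k => hus (k + 1)⟩
  refine exists_seq_of_step ?_ ?_
  · rintro k u v huv hQ
    rcases k with _ | k
    · exact (huv 0 le_rfl).symm.trans hQ
    · have hsrc : outerSource v k = outerSource u k := by
        funext p
        have : ∀ j ∈ Finset.Icc 1 k, v j p * BurgersOuter.pd true (v (k + 1 - j)) p =
            u j p * BurgersOuter.pd true (u (k + 1 - j)) p := fun j hj => by
          have := Finset.mem_Icc.1 hj
          rw [huv j (by omega), huv (k + 1 - j) (by omega)]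
        simp only [outerSource, Finset.sum_congr rfl this, huv k (by omega)]
      simp only [Q] at hQ ⊢
      rw [hsrc, ← huv 0 (by omega), ← huv (k + 1) le_rfl]
      exact hQ
  · rintro k u hu
    rcases k with _ | k
    · exact ⟨fun p => u₀ (Y p), by simp [Q]⟩
    · have h0 : u 0 = fun p => u₀ (Y p) := hu 0 (by omega)
      have hpos : ∀ j, 1 ≤ j → j ≤ k → InNR u₀ T Y 1 (-4 * j + 3) (u j) := fun j h1 h2 => by
        obtain ⟨i, rfl⟩ : ∃ i, j = i + 1 := ⟨j - 1, by omega⟩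
        have := (hu (i + 1) (by omega)).1
        push_cast
        exact this
      have hS : InNR u₀ T Y 3 (-4 * k + 1) (outerSource u k) := by
        have h1 : InNR u₀ T Y 3 (-4 * k + 1)
            fun p => ∑ j ∈ Finset.Icc 1 k, u j p * BurgersOuter.pd true (u (k + 1 - j)) p := by
          refine InNR.sum _ fun j hj => ?_
          have hj' := Finset.mem_Icc.1 hj
          have := (hpos j hj'.1 hj'.2).mul ((hpos (k + 1 - j) (by omega) (by omega)).pd h hY)
          convert this using 1
          push_cast [show j ≤ k + 1 by omega]; ring
        have h2 : InNR u₀ T Y 3 (-4 * k + 1) (BurgersOuter.pd true (BurgersOuter.pd true (u k))) := by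
          rcases k with _ | k
          · rw [h0]; simpa using pd_pd_inviscid h hY
          · have := ((hpos (k + 1) (by omega) le_rfl).pd h hY).pd h hY
            convert this using 1
            push_cast; ring
        obtain ⟨q, hq, hq'⟩ := (h1.const_mul (-1)).add h2
        exact ⟨q, hq, fun p hp => by rw [← hq' p hp, outerSource]; ring⟩
      obtain ⟨S, hSR, hS'⟩ := hS
      obtain ⟨G, hG, hG0, hG'⟩ := hSR.primitive h hY
      -- `N` solves the homogeneous equation, so for `N G` and the source `N³ S` it remains to solve
      -- `DG = N² S` along the flow. The primitive costs two orders: `-4k + 1` becomes `-4(k + 1) +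
      -- 3`.
      refine ⟨fun p => labelN u₀ Y p * G p, ?_⟩
      have hsrc : outerSource (Function.update u (k + 1) fun p => labelN u₀ Y p * G p) k =
          outerSource u k := by
        funext p
        have : ∀ j ∈ Finset.Icc 1 k,
            (Function.update u (k + 1) fun p => labelN u₀ Y p * G p) j p * BurgersOuter.pd true
              ((Function.update u (k + 1) fun p => labelN u₀ Y p * G p) (k + 1 - j)) p =
            u j p * BurgersOuter.pd true (u (k + 1 - j)) p := fun j hj => by
          have := Finset.mem_Icc.1 hj
          rw [Function.update_of_ne (by omega), Function.update_of_ne (by omega)]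
        simp only [outerSource, Finset.sum_congr rfl this]
        rw [Function.update_of_ne (by omega)]
      simp only [Q]
      rw [hsrc, Function.update_self, Function.update_of_ne (by omega), h0]
      refine ⟨⟨G, hG.weaken (by omega), fun p _ => by ring⟩, fun p hp ht => by
        rw [hG0 p hp ht, mul_zero], fun p hp => ?_⟩
      have dG := hG.differentiableAt h hY hp
      have dN := hY.diff_N h hp
      have dU : DifferentiableAt ℝ (fun p => u₀ (Y p)) p :=
        (h.differentiable _).comp p (hY.differentiableAt h hp)
      have dNG : DifferentiableAt ℝ (fun p => labelN u₀ Y p * G p) p := dN.mul dG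
      beta_reduce
      rw [pd_mul dN dG, pd_mul dU dNG, pd_mul dN dG, (pd_inviscid h hY hp).1, hS' p hp]
      have e1 := hY.transport_N h hp
      have e2 := hG' p hp
      linear_combination G p * e1 + labelN u₀ Y p * e2

end

end

/-! ### Uniqueness of the outer expansion -/

section

variable {u₀ : ℝ → ℝ} {T : ℝ} {Y : ℝ × ℝ → ℝ}

section
variable (h : IsShockData u₀) (hY : IsLabel u₀ T Y)
include h hY

/-- Linear transport equations along the straight characteristics have unique solutions. -/
theorem eq_zero_of_transport {d c : ℝ × ℝ → ℝ}
    (hd : ContDiffOn ℝ ∞ d (Set.Ico (startTime u₀) 0 ×ˢ Set.univ))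
    (hc : ContinuousOn c (Set.Ico (startTime u₀) 0 ×ˢ Set.univ))
    (h0 : ∀ x, d (startTime u₀, x) = 0)
    (heq : ∀ t ∈ Set.Ioo (startTime u₀) 0, ∀ x, pd false d (t, x) =
      -(u₀ (Y (t, x)) * pd true d (t, x)) - c (t, x) * d (t, x)) :
    ∀ t ∈ Set.Ico (startTime u₀) 0, ∀ x, d (t, x) = 0 := by
  intro t₁ ht₁ x₁
  set t₀ := startTime u₀ with ht₀
  have hslab : ∀ t ∈ Set.Ico t₀ 0, ∀ x, (t, x) ∈ slab T := fun t ht x =>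
    ⟨⟨hY.lt_start.trans_le ht.1, ht.2⟩, trivial⟩
  set y := Y (t₁, x₁) with hy
  set L : ℝ → ℝ × ℝ := fun s => (s, y + (s - t₀) * u₀ y) with hL
  have hL1 : L t₁ = (t₁, x₁) := by
    have := hY.spec _ (hslab t₁ ht₁ x₁)
    simp only [hL, Prod.mk.injEq, true_and]
    exact this
  have hLc : Continuous L := by fun_prop
  have hLmem : Set.MapsTo L (Set.Icc t₀ t₁) (Set.Ico t₀ 0 ×ˢ Set.univ) := fun s hs =>
    ⟨⟨hs.1, hs.2.trans_lt ht₁.2⟩, trivial⟩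
  have hLY : ∀ s ∈ Set.Ioo t₀ t₁, Y (L s) = y := fun s hs =>
    (hY.unique h (hslab s ⟨hs.1.le, hs.2.trans ht₁.2⟩ _) rfl).symm
  obtain ⟨C, hC⟩ := isCompact_Icc.exists_bound_of_continuousOn
    (hc.comp hLc.continuousOn hLmem)
  have hDc : ContinuousOn (fun s => d (L s)) (Set.Icc t₀ t₁) :=
    hd.continuousOn.comp hLc.continuousOn hLmem
  have hDd : ∀ s ∈ Set.Ioo t₀ t₁, HasDerivAt (fun s => d (L s)) (-(c (L s) * d (L s))) s := by
    intro s hs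
    have hmem : Set.Ico t₀ 0 ×ˢ Set.univ ∈ nhds (L s) :=
      prod_mem_nhds (Ico_mem_nhds hs.1 (hs.2.trans ht₁.2)) Filter.univ_mem
    have dd : DifferentiableAt ℝ d (L s) := (hd.contDiffAt hmem).differentiableAt (by simp)
    have hLd : HasDerivAt L (1, u₀ y) s := by
      refine (hasDerivAt_id s).prodMk ?_
      simpa using (((hasDerivAt_id s).sub_const t₀).mul_const (u₀ y)).const_add y
    have h1 := dd.hasFDerivAt.comp_hasDerivAt s hLd
    refine h1.congr_deriv ?_
    have h2 := heq s ⟨hs.1, hs.2.trans ht₁.2⟩ (L s).2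
    rw [show (s, (L s).2) = L s from rfl, hLY s hs] at h2
    have h3 : ((1, u₀ y) : ℝ × ℝ) = pdir false + u₀ y • pdir true := by simp [pdir]
    rw [h3, map_add, map_smul, smul_eq_mul]
    change pd false d (L s) + u₀ y * pd true d (L s) = _
    linarith
  -- Grönwall's weight: since `|c| ≤ C` on the characteristic, `e' = -2 (c + C) e ≤ 0`.
  set e : ℝ → ℝ := fun s => d (L s) ^ 2 * Real.exp (-(2 * C) * s) with he
  have hed : ∀ s ∈ Set.Ioo t₀ t₁, HasDerivAt e
      (2 * d (L s) ^ (2 - 1) * -(c (L s) * d (L s)) * Real.exp (-(2 * C) * s) +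
        d (L s) ^ 2 * (Real.exp (-(2 * C) * s) * (-(2 * C) * 1))) s := by
    intro s hs
    exact ((hDd s hs).pow 2).mul (((hasDerivAt_id s).const_mul (-(2 * C))).exp)
  have hanti : AntitoneOn e (Set.Icc t₀ t₁) := by
    refine antitoneOn_of_deriv_nonpos (convex_Icc _ _)
      ((hDc.pow 2).mul (by fun_prop)) ?_ ?_
    · rw [interior_Icc]
      exact fun s hs => (hed s hs).differentiableAt.differentiableWithinAt
    · rw [interior_Icc]
      intro s hs
      rw [(hed s hs).deriv]
      have h1 := hC s ⟨hs.1.le, hs.2.le⟩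
      rw [Real.norm_eq_abs] at h1
      have h2 : -C ≤ c (L s) := (abs_le.1 h1).1
      have h3 : 0 ≤ d (L s) ^ 2 * Real.exp (-(2 * C) * s) := by positivity
      have : 2 * d (L s) ^ (2 - 1) * -(c (L s) * d (L s)) * Real.exp (-(2 * C) * s) +
        d (L s) ^ 2 * (Real.exp (-(2 * C) * s) * (-(2 * C) * 1)) =
          -(2 * (c (L s) + C) * (d (L s) ^ 2 * Real.exp (-(2 * C) * s))) := by
        norm_num; ring
      rw [this]
      have : 0 ≤ 2 * (c (L s) + C) := by linarith
      linarith [mul_nonneg this h3]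
  have hfin := hanti ⟨le_rfl, ht₁.1⟩ ⟨ht₁.1, le_rfl⟩ ht₁.1
  have he0 : e t₀ = 0 := by
    have : d (L t₀) = 0 := h0 _
    simp [he, this]
  rw [he0] at hfin
  have : d (L t₁) ^ 2 ≤ 0 := by
    by_contra! hcon
    have : 0 < e t₁ := mul_pos hcon (Real.exp_pos _)
    linarith
  have := pow_eq_zero_iff (two_ne_zero) |>.1 (le_antisymm this (sq_nonneg _))
  rwa [hL1] at this

/-- Every outer expansion agrees with the explicit one. -/
theorem outer_unique {us uo : ℕ → ℝ × ℝ → ℝ} (hs : ∀ k, ContDiffOn ℝ ∞ (us k) (slab T))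
    (hus0 : us 0 = fun p => u₀ (Y p))
    (hinit : ∀ k, ∀ p ∈ slab T, p.1 = startTime u₀ → us (k + 1) p = 0)
    (heq : ∀ k, ∀ p ∈ slab T, pd false (us (k + 1)) p =
      -(pd true (fun p => us 0 p * us (k + 1) p) p) + outerSource us k p)
    (huo : IsOuterExpansion u₀ fun k t x => uo k (t, x)) (k : ℕ) :
    ∀ t ∈ Set.Ico (startTime u₀) 0, ∀ x, uo k (t, x) = us k (t, x) := by
  set t₀ := startTime u₀ with ht₀
  have ht₀neg := h.startTime_neg
  have hslab : ∀ t ∈ Set.Ico t₀ 0, ∀ x, (t, x) ∈ slab T := fun t ht x =>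
    ⟨⟨hY.lt_start.trans_le ht.1, ht.2⟩, trivial⟩
  have hsub : Set.Ico t₀ 0 ×ˢ Set.univ ⊆ slab T := fun p hp => hslab p.1 hp.1 p.2
  have dW : ∀ j, ∀ t ∈ Set.Ioo t₀ 0, ∀ x, DifferentiableAt ℝ (uo j) (t, x) := fun j t ht x =>
    ((huo.smooth j).contDiffAt (prod_mem_nhds (Ico_mem_nhds ht.1 ht.2) Filter.univ_mem)).differentiableAt
      (by simp)
  have dS : ∀ j, ∀ t ∈ Set.Ioo t₀ 0, ∀ x, DifferentiableAt ℝ (us j) (t, x) := fun j t ht x =>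
    smooth_differentiableAt (isOpen_slab T) (hs j) (hslab t ⟨ht.1.le, ht.2⟩ x)
  have pd_sub : ∀ j d, ∀ t ∈ Set.Ioo t₀ 0, ∀ x, pd d (fun p => uo j p - us j p) (t, x) =
      pd d (uo j) (t, x) - pd d (us j) (t, x) := fun j d t ht x => by
    simp [pd, fderiv_fun_sub (dW j t ht x) (dS j t ht x)]
  induction k using Nat.strong_induction_on with
  | _ k ih =>
  rcases k with _ | k
  -- The difference of two Burgers solutions is transported by the explicit one, with the slope of
  -- the other as zeroth-order coefficient. The latter is a derivative within the set because that
  -- solution is given only for `t ≥ t₀`.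
  · have hcont : ContinuousOn (fun p => fderivWithin ℝ (uo 0) (Set.Ico t₀ 0 ×ˢ Set.univ) p (pdir true))
        (Set.Ico t₀ 0 ×ˢ Set.univ) :=
      ((huo.smooth 0).continuousOn_fderivWithin ((uniqueDiffOn_Ico _ _).prod uniqueDiffOn_univ)
        (by simp)).clm_apply continuousOn_const
    have := eq_zero_of_transport h hY (d := fun p => uo 0 p - us 0 p)
      ((huo.smooth 0).sub ((hs 0).mono hsub)) hcont (fun x => by
        have h1 := huo.init 0 x
        have h2 : Y (startTime u₀, x) = x :=
          hY.eq_of_start (hslab t₀ ⟨le_rfl, ht₀neg⟩ x) rfl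
        simp only [outerInit] at h1
        simp only [hus0, h2, h1, sub_self]) (fun t ht x => by
        have hp := hslab t ⟨ht.1.le, ht.2⟩ x
        have hfd : fderivWithin ℝ (uo 0) (Set.Ico t₀ 0 ×ˢ Set.univ) (t, x) = fderiv ℝ (uo 0) (t, x) :=
          fderivWithin_of_mem_nhds (prod_mem_nhds (Ico_mem_nhds ht.1 ht.2) Filter.univ_mem)
        have e1 : pd false (uo 0) (t, x) = -(uo 0 (t, x) * pd true (uo 0) (t, x)) := by
          rw [pd_false_eq_deriv (dW 0 t ht x), pd_true_eq_deriv (dW 0 t ht x)]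
          exact huo.burgers t ht x
        have e2 := pd_inviscid h hY hp
        rw [hfd, pd_sub 0 _ t ht, pd_sub 0 _ t ht, e1, hus0, e2.1, e2.2]
        change _ = _ - pd true (uo 0) (t, x) * _
        ring)
    exact fun t ht x => sub_eq_zero.1 (this t ht x)
  -- By induction the source terms agree, so the difference solves the homogeneous equation with
  -- coefficient `∂ₓU`.
  · have hcont : ContinuousOn (pd true (us 0)) (Set.Ico t₀ 0 ×ˢ Set.univ) :=
      (smooth_pd (isOpen_slab T) (hs 0) true).continuousOn.mono hsub
    have := eq_zero_of_transport h hY (d := fun p => uo (k + 1) p - us (k + 1) p)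
      ((huo.smooth (k + 1)).sub ((hs (k + 1)).mono hsub)) hcont (fun x => by
        have h1 := huo.init (k + 1) x
        simp only [outerInit] at h1
        have h2 : us (k + 1) (startTime u₀, x) = 0 :=
          hinit k _ (hslab t₀ ⟨le_rfl, ht₀neg⟩ x) rfl
        simp only [h1, h2, sub_self]) (fun t ht x => by
        have ht' : t ∈ Set.Ico t₀ 0 := ⟨ht.1.le, ht.2⟩
        have hp := hslab t ht' x
        have hfun : ∀ j ≤ k, (fun y => uo j (t, y)) = fun y => us j (t, y) := fun j hj =>
          funext fun y => ih j (by omega) t ht' y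
        have e1 := huo.transport k t ht x
        have e2 := heq k (t, x) hp
        have hsum : ∑ j ∈ Finset.Icc 1 k, uo j (t, x) * deriv (fun y => uo (k + 1 - j) (t, y)) x =
            ∑ j ∈ Finset.Icc 1 k, us j (t, x) * pd true (us (k + 1 - j)) (t, x) :=
          Finset.sum_congr rfl fun j hj => by
            have hj' := Finset.mem_Icc.1 hj
            rw [hfun (k + 1 - j) (by omega), ih j (by omega) t ht' x,
              pd_true_eq_deriv (dS (k + 1 - j) t ht x)]
        have hvis : iteratedDeriv 2 (fun y => uo k (t, y)) x = pd true (pd true (us k)) (t, x) := by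
          rw [hfun k le_rfl, iteratedDeriv_slice (isOpen_slab T) 2 (hs k) hp]
          rfl
        have hprod : deriv (fun y => uo 0 (t, y) * uo (k + 1) (t, y)) x =
            pd true (fun p => us 0 p * uo (k + 1) p) (t, x) := by
          rw [pd_true_eq_deriv (f := fun p => us 0 p * uo (k + 1) p)
            (DifferentiableAt.mul (dS 0 t ht x) (dW (k + 1) t ht x))]
          simp only [ih 0 (by omega) t ht']
        beta_reduce at e1
        rw [hsum, hprod] at e1
        have hvis' : iteratedDeriv 2 ((fun k t x => uo k (t, x)) k t) x =
            pd true (pd true (us k)) (t, x) := hvis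
        have e1' : pd false (uo (k + 1)) (t, x) =
            -(pd true (fun p => us 0 p * uo (k + 1) p) (t, x)) + outerSource us k (t, x) := by
          rw [pd_false_eq_deriv (dW (k + 1) t ht x), outerSource, ← hvis]
          refine e1.trans ?_
          ring
        rw [pd_mul (dS 0 t ht x) (dW (k + 1) t ht x)] at e1'
        rw [pd_mul (dS 0 t ht x) (dS (k + 1) t ht x)] at e2
        have hU : us 0 (t, x) = u₀ (Y (t, x)) := by rw [hus0]
        rw [pd_sub _ _ t ht, pd_sub _ _ t ht, e1', e2, hU]
        ring)
    exact fun t ht x => sub_eq_zero.1 (this t ht x)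

end

/-- The quadratic terms of the outer equations in symmetric form. -/
theorem sum_antidiagonal_pd {us : ℕ → ℝ × ℝ → ℝ} {p : ℝ × ℝ}
    (hd : ∀ k, DifferentiableAt ℝ (us k) p) (k : ℕ) :
    (1 / 2) * ∑ c ∈ Finset.HasAntidiagonal.antidiagonal (k + 1), pd true (fun p => us c.1 p * us c.2 p) p =
      pd true (fun p => us 0 p * us (k + 1) p) p +
        ∑ j ∈ Finset.Icc 1 k, us j p * pd true (us (k + 1 - j)) p := by
  have h1 : ∑ c ∈ Finset.HasAntidiagonal.antidiagonal (k + 1), pd true (fun p => us c.1 p * us c.2 p) p =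
      2 * ∑ c ∈ Finset.HasAntidiagonal.antidiagonal (k + 1), us c.1 p * pd true (us c.2) p := by
    have h2 : ∑ c ∈ Finset.HasAntidiagonal.antidiagonal (k + 1), pd true (us c.1) p * us c.2 p =
        ∑ c ∈ Finset.HasAntidiagonal.antidiagonal (k + 1), us c.1 p * pd true (us c.2) p := by
      rw [← Finset.Nat.sum_antidiagonal_swap]
      exact Finset.sum_congr rfl fun c _ => by simp [mul_comm]
    rw [two_mul]
    nth_rewrite 1 [← h2]
    rw [← Finset.sum_add_distrib]
    exact Finset.sum_congr rfl fun c _ => pd_mul (hd _) (hd _)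
  rw [h1, pd_mul (hd _) (hd _),
    Finset.Nat.sum_antidiagonal_eq_sum_range_succ (fun i j => us i p * pd true (us j) p) (k + 1),
    Finset.sum_range_succ, Finset.sum_range_succ',
    show Finset.Icc 1 k = Finset.Ico 1 (k + 1) by ext; simp, Finset.sum_Ico_eq_sum_range]
  simp only [Nat.add_sub_cancel, Nat.sub_zero, Nat.sub_self, add_comm 1]
  ring

end

/-! ### Expansion of the outer terms -/

section

variable {u₀ : ℝ → ℝ} {T : ℝ} {Y : ℝ × ℝ → ℝ}

section
variable (h : IsShockData u₀) (hY : IsLabel u₀ T Y) {X : ℝ} (hX : 0 < X)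
include h hY hX

/-- `N` is expanded as `∂ₓY`. In `Z = tN - t₀N` the dominant part `-t₀N` has class `(0, 1)`,
contained in `(-2, 0)`; hence the two orders of vanishing that `InR` demands per power of `Z`. -/
theorem expands_label (N : ℕ) :
    Expands (beta u₀) (stripWeight (beta u₀) T X h.beta_pos) N 1 0 Y ∧
    Expands (beta u₀) (stripWeight (beta u₀) T X h.beta_pos) N 0 1 (labelN u₀ Y) ∧
    Expands (beta u₀) (stripWeight (beta u₀) T X h.beta_pos) N (-2) 0 (labelZ u₀ Y) := by
  have hw := stripWeight_isCubic h.beta_pos (hY.T_neg h) hX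
  have h1 := (hY.expands h hX N).2.trunc hw (Nat.le_succ N)
  have h2 : Expands (beta u₀) (stripWeight (beta u₀) T X h.beta_pos) N 0 1 (labelN u₀ Y) :=
    (h1.pd hw true).congr fun p hp => ((hY.label h).2 p ⟨hp.1, trivial⟩).1
  refine ⟨h1, h2, ?_⟩
  have h3 : Expands (beta u₀) (stripWeight (beta u₀) T X h.beta_pos) N 0 0
      fun p => p.1 * labelN u₀ Y p := by
    obtain ⟨q, hq⟩ := h2
    exact ⟨_, hq.time_mul hw le_rfl⟩
  have h4 := (h3.lower (a := -2) hw (by norm_num)).add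
    ((h2.const_mul (-startTime u₀)).weaken (a := -2) (b := 0) (by norm_num) (by norm_num))
  exact h4.congr fun p _ => by rw [labelZ]; ring

theorem InR.expands {n : ℤ} {f : ℝ × ℝ → ℝ} (hf : InR u₀ Y n f) (N : ℕ) :
    Expands (beta u₀) (stripWeight (beta u₀) T X h.beta_pos) N n 0 f := by
  have hw := stripWeight_isCubic h.beta_pos (hY.T_neg h) hX
  obtain ⟨h1, -, h3⟩ := expands_label h hY hX N
  induction hf with
  | mono i g hg =>
    have := (h1.comp hw hg).mul (h3.pow hw i) hw
    convert this using 1 <;> ring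
  | add hf hg ihf ihg => exact ihf.add ihg

theorem InNR.expands {n : ℤ} {f : ℝ × ℝ → ℝ} (hf : InNR u₀ T Y 1 n f) (N : ℕ) :
    Expands (beta u₀) (stripWeight (beta u₀) T X h.beta_pos) N n 1 f := by
  have hw := stripWeight_isCubic h.beta_pos (hY.T_neg h) hX
  obtain ⟨-, h2, -⟩ := expands_label h hY hX N
  obtain ⟨q, hq, hq'⟩ := hf
  have := h2.mul (hq.expands h hY hX N) hw
  rw [zero_add, add_zero] at this
  exact this.congr fun p hp => by rw [hq' p ⟨hp.1, trivial⟩, pow_one]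

/-- The homogeneous components of the outer terms. -/
theorem exists_components {us : ℕ → ℝ × ℝ → ℝ} (hus0 : us 0 = fun p => u₀ (Y p))
    (hus : ∀ k : ℕ, InNR u₀ T Y 1 (-4 * ((k : ℤ) + 1) + 3) (us (k + 1))) :
    ∃ q : ℕ → ℕ → ℝ × ℝ → ℝ, q 0 0 = cu (beta u₀) ∧
      (∀ k N : ℕ, HasExp (beta u₀) (stripWeight (beta u₀) T X h.beta_pos) N (-4 * k + 1) 0 (us k) (q k)) ∧
      (∀ k l : ℕ, (k, l) ≠ (0, 0) → InP (beta u₀) (-4 * k + l + 3) 1 (q k l)) ∧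
      ∀ k l K : ℕ, (stripWeight (beta u₀) T X h.beta_pos).Bd K (-4 * k + l + 4) 1
        fun p => us k p - ∑ j ∈ Finset.range (l + 1), q k j p := by
  have hw := stripWeight_isCubic h.beta_pos (hY.T_neg h) hX
  set w := stripWeight (beta u₀) T X h.beta_pos with hwdef
  obtain ⟨d, hd⟩ := Expands.exists_hasExp hw fun N => (hY.expands h hX N).1
  choose r hr using fun k => Expands.exists_hasExp hw fun N => (hus k).expands h hY hX N
  -- For `k = 0` the expansion is that of `U - 𝔲`, whose leading class `(4, 1)` belongs to index
  -- `1`; index `0` is `𝔲` itself.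
  let q : ℕ → ℕ → ℝ × ℝ → ℝ := fun k l => match k, l with
    | 0, 0 => cu (beta u₀)
    | 0, l + 1 => d l
    | k + 1, l => r k l
  have hq0 : ∀ p N, ∑ j ∈ Finset.range (N + 1), q 0 j p =
      ∑ j ∈ Finset.range N, d j p + cu (beta u₀) p := fun p N => Finset.sum_range_succ' _ _
  have hbd0 : ∀ N K : ℕ, w.Bd K (4 + N) 1 fun p => us 0 p - ∑ j ∈ Finset.range (N + 1), q 0 j p :=
    fun N K => ((hd N).2 K).congr fun p _ => by rw [hq0, hus0]; ring
  refine ⟨q, rfl, fun k N => ?_, fun k l hkl => ?_, fun k l K => ?_⟩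
  · rcases k with _ | k
    · refine ⟨fun l => ?_, fun K => ?_⟩
      · rcases l with _ | l
        · exact (InP.mono 1 1 0 (by norm_num) (by norm_num)).congr fun p _ => by simp [q]
        · exact ((hd 0).1 l).weaken (by push_cast; ring) (by norm_num)
      · rcases N with _ | N
        · have hU := ((hY.bd_label h hX K).1).comp h.van_one
          simp only [Finset.range_zero, Finset.sum_empty, sub_zero, hus0]
          simpa using hU
        · exact (hbd0 N K).weaken (by push_cast; omega) (by push_cast; omega)
    · exact (hr k N).weaken (by push_cast; ring) (by norm_num)
  · rcases k with _ | k
    · rcases l with _ | l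
      · exact absurd rfl hkl
      · have := (hd 0).1 l
        convert this using 1
        push_cast; ring
    · have := (hr k 0).1 l
      convert this using 1
      push_cast; ring
  · rcases k with _ | k
    · have := hbd0 l K
      convert this using 1
      push_cast; ring
    · have := (hr k (l + 1)).2 K
      convert this using 1
      push_cast; ring

end

end

/-! ### Comparison of the control functions -/

theorem sqrt_zpow {m : ℝ} (hm : 0 < m) (n : ℤ) : √m ^ n = m ^ ((n : ℝ) / 2) := by
  rw [Real.sqrt_eq_rpow, ← Real.rpow_intCast, ← Real.rpow_mul hm.le]
  congr 1; ring

/-- The two control functions are proportional: `r = √(3β) |𝔲| √𝔪` and `σ = √κ √𝔪`, so only the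
constants remain. -/
theorem exists_e_le_errE {β T X : ℝ} (hβ : 0 < β) (hX : 0 < X) (a b : ℤ) : ∃ C, 0 ≤ C ∧
    ∀ p ∈ (stripWeight β T X hβ).dom, (stripWeight β T X hβ).e a b p ≤ C * errE β a b p.1 p.2 := by
  have hκ := stripConst_pos (T := T) hβ hX
  set κ := stripConst β T X with hκdef
  refine ⟨√(3 * β) ^ a.toNat * √κ ^ (2 * b - a), by positivity, fun p hp => le_of_eq ?_⟩
  have hp' : p ∈ past := hp.1.2
  have hm : 0 < cm β p := cm_pos hβ hp'
  have hsm : 0 < √(cm β p) := Real.sqrt_pos.2 hm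
  have hr : (stripWeight β T X hβ).r p = √(3 * β) * |cu β p| * √(cm β p) := by
    change √(3 * β * cu β p ^ 2 * cm β p) = _
    rw [Real.sqrt_mul (by positivity), Real.sqrt_mul (by positivity), Real.sqrt_sq_eq_abs]
  have hσ : (stripWeight β T X hβ).σ p = √κ * √(cm β p) := by
    change √(κ * cm β p) = _
    rw [Real.sqrt_mul hκ.le]
  rw [Weight.e, hr, hσ, mul_zpow, errE]
  change _ = _ * if 0 ≤ a then |cu β p| ^ a * cm β p ^ b else cm β p ^ ((b : ℝ) + |(a : ℝ)| / 2)
  split_ifs with ha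
  · lift a to ℕ using ha
    have h1 : cm β p ^ b = √(cm β p) ^ a * √(cm β p) ^ (2 * b - (a : ℤ)) := by
      rw [← zpow_natCast, ← zpow_add₀ hsm.ne', add_sub_cancel, zpow_mul]
      norm_cast
      rw [Real.sq_sqrt hm.le]
    rw [h1, Int.toNat_natCast, zpow_natCast]
    ring
  · have ha' : (a : ℝ) < 0 := by exact_mod_cast not_le.1 ha
    rw [Int.toNat_of_nonpos (not_le.1 ha).le, sqrt_zpow hm, abs_of_neg ha']
    push_cast
    rw [show (2 * (b : ℝ) - a) / 2 = b + -a / 2 by ring]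
    ring

end BurgersOuter

/-! ### The proposition -/

open BurgersOuter in
theorem proposition3p8 (u₀ : ℝ → ℝ) (hu₀ : BurgersOuter.IsShockData u₀) :
    ∃ u : ℕ → ℕ → ℝ → ℝ → ℝ,
      BurgersOuter.IsHomogeneousExpansion u₀ u ∧
      (∀ k l : ℕ, (k, l) ≠ (0, 0) →
        BurgersOuter.MemP (BurgersOuter.beta u₀) (-4 * k + l + 3) 1 (u k l)) ∧
      ∀ i k l : ℕ, ∃ C : ℝ, ∀ uo : ℕ → ℝ → ℝ → ℝ, BurgersOuter.IsOuterExpansion u₀ uo →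
        ∀ t ∈ Set.Ico (BurgersOuter.startTime u₀) 0, ∀ x ∈ Set.Icc (-1 : ℝ) 1,
          |iteratedDeriv i (fun y => uo k t y - BurgersOuter.partialSum u k l t y) x| ≤
            C * BurgersOuter.errE (BurgersOuter.beta u₀) (-4 * k + l - i + 4) (i + 1) t x := by
  obtain ⟨T, Y, hY⟩ := hu₀.exists_label
  obtain ⟨us, hus0, hus⟩ := exists_outer hu₀ hY
  have hβ := hu₀.beta_pos
  -- Any half-width above `1` puts the closed interval `[-1, 1]` into the open strip.
  have hX : (0 : ℝ) < 2 := by norm_num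
  have hw := stripWeight_isCubic hβ (hY.T_neg hu₀) hX
  obtain ⟨q, hq00, hexp, hinP, hbd⟩ := exists_components hu₀ hY hX hus0 fun k => (hus k).1
  set w := stripWeight (beta u₀) T 2 hβ with hwdef
  have ht₀ := hu₀.startTime_neg
  have hsmooth : ∀ k, ContDiffOn ℝ ∞ (us k) (slab T) := fun k => by
    rcases k with _ | k
    · rw [hus0]; exact hu₀.smooth.comp_contDiffOn (hY.smooth hu₀)
    · exact (hus k).1.smooth hu₀ hY
  have hstart : ∀ k y, us k (startTime u₀, y) = outerInit u₀ k y := fun k y => by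
    have hp : (startTime u₀, y) ∈ slab T := ⟨⟨hY.lt_start, ht₀⟩, trivial⟩
    rcases k with _ | k
    · rw [hus0]
      simp only [outerInit]
      rw [hY.eq_of_start hp rfl]
    · exact (hus k).2.1 _ hp rfl
  have hqP : ∀ k l : ℕ, InP (beta u₀) (-4 * k + 1 + l) 0 (q k l) := fun k l => (hexp k 0).1 l
  have hqd : ∀ k l, ∀ p ∈ past, DifferentiableAt ℝ (q k l) p := fun k l p hp =>
    (hqP k l).differentiableAt hβ hp
  -- The advection, the time derivative and the viscous term can all be placed in the class `(-4k +
  -- 1, 1)`, so their components of equal index have equal degree and may be compared.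
  have hadv : ∀ k N : ℕ, HasExp (beta u₀) w N (-4 * k + 1) 1
      (fun p => (-(1 / 2) : ℝ) * ∑ c ∈ Finset.HasAntidiagonal.antidiagonal k,
        pd true (fun p => us c.1 p * us c.2 p) p)
      (fun l p => (-(1 / 2) : ℝ) * ∑ c ∈ Finset.HasAntidiagonal.antidiagonal k,
        pd true (fun p => ∑ e ∈ Finset.HasAntidiagonal.antidiagonal l, q c.1 e.1 p * q c.2 e.2 p) p) := by
    intro k N
    refine HasExp.const_mul _ (HasExp.sum _ fun c hc => ?_)
    have hc' := Finset.HasAntidiagonal.mem_antidiagonal.1 hc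
    have := ((hexp c.1 N).mul (hexp c.2 N) hw).pd hw true
    convert this using 1
    · rw [← hc', sh]; push_cast; simp; ring
    · norm_num
  have hadv_eq : ∀ k l, ∀ p ∈ past, (-(1 / 2) : ℝ) * ∑ c ∈ Finset.HasAntidiagonal.antidiagonal k,
      pd true (fun p => ∑ e ∈ Finset.HasAntidiagonal.antidiagonal l, q c.1 e.1 p * q c.2 e.2 p) p =
      advection (fun k l t x => q k l (t, x)) k l p.1 p.2 := by
    intro k l p hp
    rw [advection]
    congr 1
    refine Finset.sum_congr rfl fun c _ => ?_
    rw [pd_sum _ fun e _ => (hqd c.1 e.1 p hp).mul (hqd c.2 e.2 p hp)]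
    exact Finset.sum_congr rfl fun e _ =>
      pd_true_eq_deriv (f := fun p => q c.1 e.1 p * q c.2 e.2 p)
        ((hqd c.1 e.1 p hp).mul (hqd c.2 e.2 p hp))
  have htime : ∀ k N : ℕ, HasExp (beta u₀) w N (-4 * k + 1) 1 (pd false (us k))
      fun l => pd false (q k l) := fun k N => by
    have := (hexp k N).pd hw false
    simpa [sh] using this
  have hdiff : ∀ p ∈ slab T, ∀ k, DifferentiableAt ℝ (us k) p := fun p hp k =>
    smooth_differentiableAt (isOpen_slab T) (hsmooth k) hp
  refine ⟨fun k l t x => q k l (t, x), ?_, ?_, ?_⟩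
  · refine ⟨fun t _ x => by simp only [hq00]; rfl, fun k l => ?_, fun k l => ?_, fun l t ht x => ?_,
      fun k l t ht x => ?_, fun k l n hn => ?_⟩
    · refine ((hqP k l).smooth hβ).mono ?_
      exact fun p hp => hp.1
    · intro μ hμ t ht x
      have := (hqP k l).scale hβ hμ (p := (t, x)) ht
      refine this.trans ?_
      congr 2; ring
    · have h1 : HasExp (beta u₀) w (l + 1) (-4 * (0 : ℕ) + 1) 1 (pd false (us 0)) _ :=
        (hadv 0 (l + 1)).congr fun p hp => by
          have hp' : p ∈ slab T := ⟨hp.1, trivial⟩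
          have hU := pd_inviscid hu₀ hY hp'
          have hd : DifferentiableAt ℝ (fun p => u₀ (Y p)) p := by
            have := hdiff p hp' 0; rwa [hus0] at this
          simp only [Finset.Nat.antidiagonal_zero, Finset.sum_singleton, hus0]
          rw [pd_mul hd hd, hU.1, hU.2]
          ring
      -- Two expansions of the same function `∂ₜU`; their equal components form the equation of the
      -- hierarchy, on the whole half plane.
      have h2 := (htime 0 (l + 1)).unique h1 hw l (Nat.lt_succ_self l) (t, x) ht
      rw [hadv_eq 0 l (t, x) ht, pd_false_eq_deriv (hqd 0 l (t, x) ht)] at h2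
      exact h2
    · have hvis : HasExp (beta u₀) w (l + 1) (-4 * (k + 1 : ℕ) + 1) 1 (pd true (pd true (us k)))
          fun l => pd true (pd true (q k l)) :=
        (((hexp k (l + 1)).pd hw true).pd hw true).weaken (by simp [sh]; ring) (by norm_num)
      have h1 : HasExp (beta u₀) w (l + 1) (-4 * (k + 1 : ℕ) + 1) 1 (pd false (us (k + 1))) _ :=
        ((hadv (k + 1) (l + 1)).add hvis).congr fun p hp => by
          have hp' : p ∈ slab T := ⟨hp.1, trivial⟩
          have e1 := sum_antidiagonal_pd (hdiff p hp') k
          simp only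
          rw [(hus k).2.2 p hp', outerSource]
          linarith
      have h2 := (htime (k + 1) (l + 1)).unique h1 hw l (Nat.lt_succ_self l) (t, x) ht
      rw [hadv_eq (k + 1) l (t, x) ht, pd_false_eq_deriv (hqd (k + 1) l (t, x) ht)] at h2
      have h3 := iteratedDeriv_slice isOpen_past 2 ((hqP k l).smooth hβ)
        (show (t, x) ∈ past from ht)
      exact h2.trans (congrArg _ h3.symm)
    · have hp : (startTime u₀, (0 : ℝ)) ∈ w.dom := ⟨⟨hY.lt_start, ht₀⟩, by norm_num, by norm_num⟩
      have hcu : cu (beta u₀) (startTime u₀, 0) = 0 :=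
        (cu_unique hβ (show (startTime u₀, (0 : ℝ)) ∈ past from ht₀) (by simp)).symm
      obtain ⟨-, C, hC⟩ := Weight.Bd.iterate n fun K => hbd k l K
      have hr : w.r (startTime u₀, 0) = 0 := by
        change √(3 * beta u₀ * cu (beta u₀) (startTime u₀, 0) ^ 2 * _) = 0
        rw [hcu]; simp
      have hz := hC _ hp
      -- The bound on the `n`-th derivative contains `r` to the power `-4k + l + 4 - n`, positive
      -- exactly in the matching range, and `r` vanishes at `(t₀, 0)`.
      rw [Weight.e, hr, zero_pow (by omega), zero_mul, mul_zero] at hz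
      have hz' := abs_eq_zero.1 (le_antisymm hz (abs_nonneg _))
      rw [← iteratedDeriv_slice w.isOpen n (hbd k l 0).smooth hp] at hz'
      have hpart : ContDiffAt ℝ n (partialSum (fun k l t x => q k l (t, x)) k l (startTime u₀)) 0 := by
        have : ContDiff ℝ ∞ fun y : ℝ => (startTime u₀, y) := by fun_prop
        refine ContDiffAt.sum fun j _ => ?_
        have h1 : ContDiffAt ℝ ∞ (q k j) (startTime u₀, 0) :=
          ((hqP k j).smooth hβ).contDiffAt (isOpen_past.mem_nhds (show (startTime u₀, (0 : ℝ)) ∈ past from ht₀))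
        exact (h1.comp (0 : ℝ) this.contDiffAt).of_le (by exact_mod_cast le_top)
      have hout : ContDiff ℝ n (outerInit u₀ k) := by
        rcases k with _ | k
        · exact contDiff_infty.1 hu₀.smooth n
        · exact contDiff_const
      have hsub : (fun y => us k (startTime u₀, y) - ∑ j ∈ Finset.range (l + 1), q k j (startTime u₀, y)) =
          fun y => outerInit u₀ k y - partialSum (fun k l t x => q k l (t, x)) k l (startTime u₀) y :=
        funext fun y => by rw [hstart]; rfl
      rw [hsub, iteratedDeriv_fun_sub hout.contDiffAt hpart] at hz'
      linarith
  · intro k l hkl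
    exact (hinP k l hkl).memP (b := 1)
  · intro i k l
    obtain ⟨C, hC0, hC⟩ := (Weight.Bd.iterate i fun K => hbd k l K).exists_nonneg
    obtain ⟨D, hD0, hD⟩ := exists_e_le_errE (T := T) hβ hX (-4 * k + l - i + 4) (i + 1)
    -- The constant is that of the explicit solution, so it does not depend on `uo`.
    refine ⟨C * D, fun uo huo t ht x hx => ?_⟩
    have hp : (t, x) ∈ w.dom :=
      ⟨⟨hY.lt_start.trans_le ht.1, ht.2⟩, by simp only; linarith [hx.1], by simp only; linarith [hx.2]⟩
    have heq : (fun y => uo k t y - partialSum (fun k l t x => q k l (t, x)) k l t y) =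
        fun y => us k (t, y) - ∑ j ∈ Finset.range (l + 1), q k j (t, y) :=
      funext fun y => by
        have := outer_unique hu₀ hY hsmooth hus0 (fun k => (hus k).2.1) (fun k => (hus k).2.2)
          (uo := fun k p => uo k p.1 p.2) huo k t ht y
        rw [show uo k t y = us k (t, y) from this]
        rfl
    rw [heq, iteratedDeriv_slice w.isOpen i (hbd k l 0).smooth hp, mul_assoc]
    refine (hC _ hp).trans (mul_le_mul_of_nonneg_left ?_ hC0)
    rw [show -4 * (k : ℤ) + l + 4 - i = -4 * k + l - i + 4 by ring, add_comm (1 : ℤ)]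
    exact hD _ hp
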